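/- Fix $0<q\le 1$. All entropies and logarithms are to base $2$. \emph{Binary energy harvesting channel (BEHC).} Let $E_0,E_1,E_2,\dots$ be i.i.d. Bernoulli$(q)$ and let the battery state be $S_1=E_0$, $S_{i+1}=\min\{S_i-X_i+E_i,1\}$, where the input $X_i\in\{0,1\}$ is a function of the message and of $S_1,\dots,S_i$ with $X_i=0$ whenever $S_i=0$. The receiver observes only $Y_i=X_i$. A rate $R$ is achievable if, for every $\varepsilon>0$ and all sufficiently large $n$, there is a code for $n$ channel uses with $M\ge 2^{nR}$ equiprobable messages and error probability at most $\varepsilon$; $C_{BEHC}$ is the supremum of the achievable rates. \emph{Timing channel.} Let $Z_1,Z_2,\dots$ be i.i.d. with $\Pr[Z_k=z]=q(1-q)^z$, $z=0,1,\dots$. The output is $T_k=V_k+Z_k$, where the input $V_k\in\{1,2,\dots\}$ is a function of the message and of $Z_1,\dots,Z_k$; the receiver observes only $T_1,T_2,\dots$. A rate $R$ is achievable if, for every $\varepsilon>0$ and all sufficiently large $m$, there is a code for $m$ uses of the timing channel with $M$ equiprobable messages, error probability at most $\varepsilon$, and $\log M\ge R\,\sum_{k=1}^m\mathbb E[T_k]$;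 $C_T$ is the supremum of the achievable rates. \emph{Theorem.} One has $C_T=C_{BEHC}$, and $$C_T=C_{BEHC}\ \le\ C_{UB}^{leakage}=\max_{p_T\in\mathcal P}\ \frac{H(T)-\sum_{t=1}^\infty \frac{H_2((1-q)^t)}{1-(1-q)^t}\,p(t)}{\mathbb E[T]},$$ where $H_2$ is the binary entropy function and $\mathcal P$ is the set of all probability distributions $p_T=(p(t))_{t\ge1}$ on $\{1,2,\dots\}$ with finite mean $\mathbb E[T]=\sum_t t\,p(t)$ that satisfy $\sum_{t=1}^s p(t)\le 1-(1-q)^s$ for all $s=1,2,\dots$; the maximum is attained. -/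

import Mathlib

open MeasureTheory ProbabilityTheory Filter
open scoped ENNReal

namespace BEHC

/-! ### The binary energy harvesting channel -/

/-- The list `[S_{i+1}, S_i, …, S_1]` (newest first) of the battery states at the beginning of the
first `i + 1` channel uses, for the encoding rule `x` (a function of the state history, newest state
first) and the harvests `e`.  `true` stands for one unit of energy, `false` for none.
In each channel use the encoder first sends `X_i = x [S_i, …, S_1]`, and then harvests `E_i = e i`
into the battery of capacity one, so that `S_{i+1} = min (S_i - X_i + E_i) 1`; the battery is empty
before the first harvest `E_0 = e 0`, so that `S_1 = E_0`. -/
def stateHistory (x : List Bool → Bool) (e : ℕ → Bool) : ℕ → List Bool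
  | 0 => [e 0]
  | i + 1 =>
    let h := stateHistory x e i
    ((h.headD false && !(x h)) || e (i + 1)) :: h

/-- A finite harvest sequence, extended by zeros (only its actual entries ever matter). -/
def extendHarvests {n : ℕ} (e : Fin n → Bool) (i : ℕ) : Bool :=
  if h : i < n then e ⟨i, h⟩ else false

/-- A code with `M` messages for `n` uses of the noiseless binary energy harvesting channel with
unit battery.  The encoder observes the battery states causally, and may send a `1` only when the
battery is not empty.  The decoder observes the channel output `Y^n = X^n` only. -/
structure Code (n M : ℕ) where
  /-- The channel input for a message, as a function of the states so far (newest first). -/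
  enc : Fin M → List Bool → Bool
  /-- The energy constraint: the input is `0` whenever the current state is `0`. -/
  enc_empty : ∀ w h, enc w (false :: h) = false
  /-- The decoder. -/
  dec : (Fin n → Bool) → Fin M

/-- The channel output for message `w` and harvests `e`. -/
def Code.output {n M : ℕ} (c : Code n M) (w : Fin M) (e : Fin n → Bool) : Fin n → Bool :=
  fun i => c.enc w (stateHistory (c.enc w) (extendHarvests e) i)

/-- The law of `n` independent harvests, each of them `1` with probability `q`. -/
noncomputable def harvestLaw (q : unitInterval) (n : ℕ) : Measure (Fin n → Bool) :=
  Measure.pi fun _ => bernoulliMeasure true false q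

/-- The probability of a decoding error for a uniformly distributed message. -/
noncomputable def Code.errorProb {n M : ℕ} (c : Code n M) (q : unitInterval) : ℝ :=
  (∑ w, (harvestLaw q n).real {e | c.dec (c.output w e) ≠ w}) / M

/-- The rate `R` (in bits per channel use) is achievable over the binary energy harvesting channel
with harvest probability `q`. -/
def Achievable (q : unitInterval) (R : ℝ) : Prop :=
  ∀ ε : ℝ, 0 < ε → ∀ᶠ n : ℕ in atTop, ∃ M : ℕ, 0 < M ∧ ∃ c : Code n M,
    R * n ≤ Real.logb 2 M ∧ c.errorProb q ≤ ε

/-- The capacity of the binary energy harvesting channel, in bits per channel use. -/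
noncomputable def capacity (q : unitInterval) : EReal :=
  ⨆ (R : ℝ) (_ : Achievable q R), (R : EReal)

/-! ### The timing channel -/

/-- A code with `M` messages for `m` uses of the timing channel `T_k = V_k + Z_k`.  The encoder
chooses `V_k ∈ {1, 2, …}` as a function of the message and of the states `Z_1, …, Z_k`;
the decoder observes `T_1, …, T_m`. -/
structure TimingCode (m M : ℕ) where
  /-- The channel input `V_k`, given the message and the states up to the present one. -/
  enc : Fin M → (k : Fin m) → (Fin (k + 1) → ℕ) → ℕ
  enc_pos : ∀ w k z, 1 ≤ enc w k z
  /-- The decoder. -/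
  dec : (Fin m → ℕ) → Fin M

/-- The output `T_1, …, T_m` of the timing channel for message `w` and states `z`. -/
def TimingCode.output {m M : ℕ} (c : TimingCode m M) (w : Fin M) (z : Fin m → ℕ) : Fin m → ℕ :=
  fun k => c.enc w k (fun j => z (Fin.castLE k.isLt j)) + z k

/-- The law of `m` independent states, geometrically distributed on `{0, 1, …}` with
parameter `q`. -/
noncomputable def idleLaw (q : unitInterval) (m : ℕ) : Measure (Fin m → ℕ) :=
  Measure.pi fun _ => geometricMeasure q

/-- The probability of a decoding error for a uniformly distributed message. -/
noncomputable def TimingCode.errorProb {m M : ℕ} (c : TimingCode m M) (q : unitInterval) : ℝ :=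
  (∑ w, (idleLaw q m).real {z | c.dec (c.output w z) ≠ w}) / M

/-- The expected total time `∑ k, 𝔼[T_k]`, i.e. the expected number of uses of the binary channel,
for a uniformly distributed message. -/
noncomputable def TimingCode.expectedTime {m M : ℕ} (c : TimingCode m M) (q : unitInterval) :
    ℝ≥0∞ :=
  (∑ w, ∫⁻ z, ∑ k, (c.output w z k : ℝ≥0∞) ∂(idleLaw q m)) / M

/-- The rate `R` (in bits per use of the binary channel) is achievable over the timing channel.
A code of infinite expected duration achieves no positive rate. -/
def TimingAchievable (q : unitInterval) (R : ℝ) : Prop :=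
  ∀ ε : ℝ, 0 < ε → ∀ᶠ m : ℕ in atTop, ∃ M : ℕ, 0 < M ∧ ∃ c : TimingCode m M,
    ENNReal.ofReal R * c.expectedTime q ≤ ENNReal.ofReal (Real.logb 2 M) ∧ c.errorProb q ≤ ε

/-- The capacity of the timing channel, in bits per use of the binary channel. -/
noncomputable def timingCapacity (q : unitInterval) : EReal :=
  ⨆ (R : ℝ) (_ : TimingAchievable q R), (R : EReal)

/-! ### The state leakage bound -/

/-- The entropy, in bits, of a probability mass function on `ℕ`. -/
noncomputable def entropy (p : ℕ → ℝ) : ℝ := (∑' t, Real.negMulLog (p t)) / Real.log 2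

/-- The binary entropy function, in bits. -/
noncomputable def binaryEntropy (x : ℝ) : ℝ := Real.binEntropy x / Real.log 2

/-- `p` is the probability mass function of a random variable with values in `{1, 2, …}` and with
finite expectation. -/
structure IsTimePMF (p : ℕ → ℝ) : Prop where
  zero : p 0 = 0
  nonneg : ∀ t, 0 ≤ p t
  hasSum : HasSum p 1
  summable_mean : Summable fun t : ℕ => (t : ℝ) * p t

/-- The set `𝒫` of the distributions `p` with `∑_{t=1}^s p t ≤ 1 - (1 - q)^s` for all `s ≥ 1`
(and with finite expectation, so that the objective below makes sense). -/
def leakageSet (q : unitInterval) : Set (ℕ → ℝ) :=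
  {p | IsTimePMF p ∧ ∀ s : ℕ, 1 ≤ s → ∑ t ∈ Finset.Icc 1 s, p t ≤ 1 - (1 - (q : ℝ)) ^ s}

/-- The objective
`(H(T) - ∑_{t ≥ 1} H₂((1 - q)^t) / (1 - (1 - q)^t) * p t) / 𝔼[T]` for `T` with distribution `p`
(the terms of the sums at `t = 0` vanish, since `p 0 = 0`). -/
noncomputable def leakageObjective (q : unitInterval) (p : ℕ → ℝ) : ℝ :=
  (entropy p - ∑' t : ℕ, binaryEntropy ((1 - (q : ℝ)) ^ t) / (1 - (1 - (q : ℝ)) ^ t) * p t)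
    / ∑' t : ℕ, (t : ℝ) * p t

end BEHC

/-!
The binary channel with unit battery is a timing channel in disguise: between two pulses the encoder
waits for a harvest (a geometric idle time `Z`) and then holds the full battery for `V ≥ 1` slots,
which may depend on `Z`, so that the pulses are `T = V + Z` slots apart.  A strategy for the binary
channel determines a rule for the timing channel, and conversely (`Follows`), and
`Follows.coupling` compares the probabilities of events on the two sides; laws are discrete
distributions (`PMF`) on lists with the newest entry first.  The two notions of capacity still
differ, since one fixes the number of slots and the other the number of pulses, with only the
expected number of slots taken into account.

* `timingCapacity_le_capacity`: A fixed good timing code is repeated in many blocks.  By the law of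
  large numbers the total time is close to its mean, so that it fits into a fixed number of slots.
  The few blocks in error are corrected by a description of the errors, sent through the parities
  of further output times, at a small cost (`eventually_exists_code`).
* `capacity_le_timingCapacity`: A good code for the binary channel is used in `B` blocks, where the
  battery is emptied in an additional slot at the end of each block, to make the blocks independent.
  By Chebyshev's inequality the number of pulses is close to its mean `B * μ`.  Given the number `m`
  of pulses, `B` is taken such that `m` lies slightly above `B * μ`; then `m` pulses suffice, and the
  expected time for the pulses after the last block is small.  As the blocks have length about
  `δ * m`, the number `B` remains bounded while the error probability of a block tends to `0`
  (`exists_timingCode_of_blocks`, `timingAchievable_of_achievable`).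
* The converse, `le_of_timingAchievable`: By Fano's inequality the logarithm of the number of
  messages is at most the sum of the entropies of the output times, less their conditional entropies
  given the message, up to small terms (`log_card_add_leakage_le`).  The conditional entropy is not
  zero, since the output reveals something of `Z`: given `T = t`, the variable `Z` lies in a subset
  of `{0, …, t - 1}`, and its entropy there is at most that for the full set `{0, …, t - 1}`, by a
  comparison of mean ranks (`mean_rank_le`).  So `T` carries at least the expectation of
  `H₂((1 - q) ^ t) / (1 - (1 - q) ^ t)` of information on `Z` (`expect_leakage_le_natEntropy`).
  The inequality `Z < T` gives the constraint in the definition of `leakageSet`.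
* `exists_isGreatest_leakageObjective`: Near the supremum the mean is bounded, because the entropy
  grows more slowly than the mean.  A maximizing sequence then has a pointwise limit that is again
  in the set, and Fatou's lemma, applied to the deviations from the linear bound `negMulLog_le` on
  the entropy terms, shows that the limit is a maximizer.
-/

namespace BEHC

/-! ### Expectations and independent sequences -/

section Expectation

variable {α β γ : Type}

/-- The expectation of a nonnegative function under a probability mass function. -/
noncomputable def expect (p : PMF α) (F : α → ℝ≥0∞) : ℝ≥0∞ := ∑' a, p a * F a

lemma expect_mono_of_support {p : PMF α} {F G : α → ℝ≥0∞} (h : ∀ a ∈ p.support, F a ≤ G a) :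
    expect p F ≤ expect p G := by
  refine ENNReal.tsum_le_tsum fun a => ?_
  by_cases ha : a ∈ p.support
  · gcongr; exact h a ha
  · rw [(p.apply_eq_zero_iff a).2 ha]; simp

lemma expect_mono {p : PMF α} {F G : α → ℝ≥0∞} (h : ∀ a, F a ≤ G a) : expect p F ≤ expect p G :=
  expect_mono_of_support fun a _ => h a

lemma expect_congr_of_support {p : PMF α} {F G : α → ℝ≥0∞} (h : ∀ a ∈ p.support, F a = G a) :
    expect p F = expect p G :=
  le_antisymm (expect_mono_of_support fun a ha => (h a ha).le)
    (expect_mono_of_support fun a ha => (h a ha).ge)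

lemma expect_add (p : PMF α) (F G : α → ℝ≥0∞) :
    expect p (fun a => F a + G a) = expect p F + expect p G := by
  simp only [expect, mul_add, ENNReal.tsum_add]

lemma expect_const_mul (p : PMF α) (c : ℝ≥0∞) (F : α → ℝ≥0∞) :
    expect p (fun a => c * F a) = c * expect p F := by
  simp only [expect, ← ENNReal.tsum_mul_left]
  exact tsum_congr fun a => by ring

lemma expect_const (p : PMF α) (c : ℝ≥0∞) : expect p (fun _ => c) = c := by
  simp [expect, ENNReal.tsum_mul_right, p.tsum_coe]

lemma expect_pure (a : α) (F : α → ℝ≥0∞) : expect (PMF.pure a) F = F a := by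
  rw [expect, tsum_eq_single a]
  · simp
  · intro b hb; simp [PMF.pure_apply, hb]

lemma expect_bind (p : PMF α) (f : α → PMF β) (F : β → ℝ≥0∞) :
    expect (p.bind f) F = expect p fun a => expect (f a) F := by
  simp only [expect, PMF.bind_apply, ← ENNReal.tsum_mul_right, ← ENNReal.tsum_mul_left]
  rw [ENNReal.tsum_comm]
  exact tsum_congr fun a => tsum_congr fun b => by ring

lemma expect_map (p : PMF α) (f : α → β) (F : β → ℝ≥0∞) :
    expect (p.map f) F = expect p fun a => F (f a) := by
  rw [← PMF.bind_pure_comp, expect_bind]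
  simp [expect_pure]

lemma expect_comm (p : PMF α) (r : PMF β) (F : α → β → ℝ≥0∞) :
    expect p (fun a => expect r (F a)) = expect r fun b => expect p fun a => F a b := by
  simp only [expect, ← ENNReal.tsum_mul_left]
  rw [ENNReal.tsum_comm]
  exact tsum_congr fun a => tsum_congr fun b => by ring

lemma toOuterMeasure_eq_expect (p : PMF α) (s : Set α) :
    p.toOuterMeasure s = expect p (s.indicator fun _ => 1) := by
  classical
  rw [PMF.toOuterMeasure_apply, expect]
  refine tsum_congr fun a => ?_
  by_cases h : a ∈ s <;> simp [h]

lemma toOuterMeasure_le_one (p : PMF α) (s : Set α) : p.toOuterMeasure s ≤ 1 := by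
  rw [toOuterMeasure_eq_expect]
  refine le_of_le_of_eq (expect_mono fun a => ?_) (expect_const p 1)
  by_cases h : a ∈ s <;> simp [h]

lemma toOuterMeasure_add_compl (p : PMF α) (s : Set α) :
    p.toOuterMeasure s + p.toOuterMeasure sᶜ = 1 := by
  rw [toOuterMeasure_eq_expect, toOuterMeasure_eq_expect, ← expect_add]
  refine Eq.trans ?_ (expect_const p 1)
  congr 1; ext a
  by_cases h : a ∈ s <;> simp [h]

lemma mul_toOuterMeasure_le_expect (p : PMF α) (F : α → ℝ≥0∞) (c : ℝ≥0∞) :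
    c * p.toOuterMeasure {a | c ≤ F a} ≤ expect p F := by
  rw [toOuterMeasure_eq_expect, ← expect_const_mul]
  refine expect_mono fun a => ?_
  by_cases h : c ≤ F a <;> simp [h]

/-- The law of a list of `m` independent variables with law `p`. -/
noncomputable def iidList (p : PMF α) : ℕ → PMF (List α)
  | 0 => PMF.pure []
  | m + 1 => (iidList p m).bind fun l => p.map fun a => a :: l

lemma expect_iidList_succ (p : PMF α) (m : ℕ) (F : List α → ℝ≥0∞) :
    expect (iidList p (m + 1)) F = expect (iidList p m) fun l => expect p fun a => F (a :: l) := by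
  simp only [iidList, expect_bind, expect_map]

lemma length_of_mem_support_iidList {p : PMF α} {m : ℕ} {l : List α}
    (h : l ∈ (iidList p m).support) : l.length = m := by
  induction m generalizing l with
  | zero => simp [iidList] at h; simp [h]
  | succ m ih =>
    simp only [iidList, PMF.mem_support_bind_iff, PMF.mem_support_map_iff] at h
    obtain ⟨l', hl', a, -, rfl⟩ := h
    simp [ih hl']

lemma iidList_cons (p : PMF α) (a : α) (l : List α) (m : ℕ) :
    iidList p (m + 1) (a :: l) = iidList p m l * p a := by
  classical
  rw [iidList, PMF.bind_apply, tsum_eq_single l]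
  · congr 1
    rw [PMF.map_apply, tsum_eq_single a]
    · simp
    · intro b hb; simp [hb.symm]
  · intro l' hl'
    rw [PMF.map_apply]
    simp [hl'.symm]

lemma expect_iidList_add (p : PMF α) (j k : ℕ) (F : List α → ℝ≥0∞) :
    expect (iidList p (j + k)) F =
      expect (iidList p k) fun l => expect (iidList p j) fun l' => F (l' ++ l) := by
  induction j generalizing F with
  | zero => simp [iidList, expect_pure]
  | succ j ih =>
    rw [add_right_comm, expect_iidList_succ, ih]
    simp only [expect_iidList_succ, List.cons_append]

lemma expect_iidList_sum (p : PMF α) (f : α → ℝ≥0∞) (m : ℕ) :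
    expect (iidList p m) (fun l => (l.map f).sum) = m * expect p f := by
  induction m with
  | zero => simp [iidList, expect_pure]
  | succ m ih =>
    rw [expect_iidList_succ]
    simp only [List.map_cons, List.sum_cons, expect_add, expect_const, ih]
    push_cast; ring

/-- A vector, as a list with the newest (last) entry first. -/
def revList {m : ℕ} (z : Fin m → α) : List α := (List.ofFn z).reverse

@[simp] lemma length_revList {m : ℕ} (z : Fin m → α) : (revList z).length = m := by
  simp [revList]

lemma revList_succ {m : ℕ} (z : Fin (m + 1) → α) :
    revList z = z (Fin.last m) :: revList fun i : Fin m => z i.castSucc := by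
  rw [revList, List.ofFn_succ', List.concat_eq_append, List.reverse_append]; rfl

lemma revList_injective {m : ℕ} : Function.Injective (revList : (Fin m → α) → List α) := by
  intro z z' h
  exact List.ofFn_injective (List.reverse_injective h)

lemma reverse_revList_getD {m : ℕ} (z : Fin m → α) (j : Fin m) (d : α) :
    (revList z).reverse.getD j d = z j := by
  simp [revList, List.getD_eq_getElem?_getD]

lemma revList_reverse_getD {m : ℕ} {l : List α} (d : α) (hl : l.length = m) :
    revList (fun j : Fin m => l.reverse.getD j d) = l := by
  subst hl
  rw [revList, ← List.reverse_inj, List.reverse_reverse]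
  apply List.ext_getElem
  · simp
  · intro i h1 h2
    simp at h1
    simp [List.getD_eq_getElem?_getD]

/-- The law of `m` independent entries, as a product measure and as a law of lists. -/
lemma lintegral_pi_revList [MeasurableSpace α] [Countable α] [DiscreteMeasurableSpace α]
    (p : PMF α) (m : ℕ) (F : List α → ℝ≥0∞) :
    ∫⁻ z, F (revList z) ∂(Measure.pi fun _ : Fin m => p.toMeasure) = expect (iidList p m) F := by
  induction m generalizing F with
  | zero =>
    simp [iidList, expect_pure, revList]
  | succ m ih =>
    have h := (measurePreserving_piFinSuccAbove (fun _ : Fin (m + 1) => p.toMeasure)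
      (Fin.last m)).symm
    rw [← h.lintegral_comp (Measurable.of_discrete), expect_iidList_succ, lintegral_prod_symm _
      (Measurable.of_discrete.aemeasurable)]
    rw [← ih]
    refine lintegral_congr fun z => ?_
    rw [lintegral_countable']
    refine tsum_congr fun a => ?_
    rw [PMF.toMeasure_apply_singleton _ _ (by measurability), mul_comm]
    congr 2
    rw [revList_succ]
    simp [MeasurableEquiv.piFinSuccAbove, Fin.insertNthEquiv]

/-- The mean of a real function under a probability mass function. -/
noncomputable def mean (p : PMF α) (f : α → ℝ) : ℝ := ∑' a, (p a).toReal * f a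

lemma summable_toReal (p : PMF α) : Summable fun a => (p a).toReal :=
  ENNReal.summable_toReal p.tsum_coe_ne_top

lemma tsum_toReal (p : PMF α) : ∑' a, (p a).toReal = 1 := by
  rw [← ENNReal.tsum_toReal_eq p.apply_ne_top, p.tsum_coe, ENNReal.toReal_one]

lemma summable_mul_of_bounded (p : PMF α) {f : α → ℝ} {c : ℝ} (hf : ∀ a, |f a| ≤ c) :
    Summable fun a => (p a).toReal * f a := by
  refine Summable.of_norm_bounded ((summable_toReal p).mul_right c) fun a => ?_
  rw [norm_mul, Real.norm_eq_abs, Real.norm_eq_abs, abs_of_nonneg ENNReal.toReal_nonneg]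
  exact mul_le_mul_of_nonneg_left (hf a) ENNReal.toReal_nonneg

lemma expect_ofReal {p : PMF α} {f : α → ℝ} (h0 : ∀ a, 0 ≤ f a)
    (hs : Summable fun a => (p a).toReal * f a) :
    expect p (fun a => ENNReal.ofReal (f a)) = ENNReal.ofReal (mean p f) := by
  rw [mean, ENNReal.ofReal_tsum_of_nonneg (fun a => mul_nonneg ENNReal.toReal_nonneg (h0 a)) hs]
  refine tsum_congr fun a => ?_
  rw [ENNReal.ofReal_mul ENNReal.toReal_nonneg, ENNReal.ofReal_toReal (p.apply_ne_top a)]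

lemma mean_nonneg (p : PMF α) {f : α → ℝ} (h0 : ∀ a, 0 ≤ f a) : 0 ≤ mean p f :=
  tsum_nonneg fun a => mul_nonneg ENNReal.toReal_nonneg (h0 a)

lemma mean_le_of_bounded (p : PMF α) {f : α → ℝ} {c : ℝ} (h0 : ∀ a, 0 ≤ f a)
    (hc : ∀ a, f a ≤ c) : mean p f ≤ c := by
  have hs := summable_mul_of_bounded p (f := f) (c := c)
    fun a => abs_le.2 ⟨by linarith [h0 a, hc a], hc a⟩
  calc mean p f ≤ ∑' a, (p a).toReal * c :=
        hs.tsum_le_tsum (fun a => mul_le_mul_of_nonneg_left (hc a) ENNReal.toReal_nonneg)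
          ((summable_toReal p).mul_right c)
    _ = c := by rw [tsum_mul_right, tsum_toReal, one_mul]

lemma expect_sq_add_le (p : PMF α) {f : α → ℝ} {c : ℝ} (h0 : ∀ a, 0 ≤ f a)
    (hc : ∀ a, f a ≤ c) (s : ℝ) :
    expect p (fun a => ENNReal.ofReal ((s + (f a - mean p f)) ^ 2)) ≤
      ENNReal.ofReal (s ^ 2) + ENNReal.ofReal (c ^ 2) := by
  set μ := mean p f with hμ
  have hμ0 : 0 ≤ μ := mean_nonneg p h0
  have hμc : μ ≤ c := mean_le_of_bounded p h0 hc
  have hd : ∀ a, |f a - μ| ≤ c := fun a => abs_le.2 ⟨by linarith [h0 a], by linarith [hc a]⟩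
  have hd2 : ∀ a, |(f a - μ) ^ 2| ≤ c ^ 2 := fun a => by
    rw [abs_pow]; exact pow_le_pow_left₀ (abs_nonneg _) (hd a) 2
  have hs0 := summable_toReal p
  have hs1 := summable_mul_of_bounded p hd
  have hs2 := summable_mul_of_bounded p hd2
  have hf := summable_mul_of_bounded p (f := f) (c := c)
    fun a => abs_le.2 ⟨by linarith [h0 a, hc a], hc a⟩
  have hz : ∑' a, (p a).toReal * (f a - μ) = 0 := by
    simp only [mul_sub]
    rw [hf.tsum_sub (hs0.mul_right μ), tsum_mul_right, tsum_toReal, one_mul, hμ, mean, sub_self]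
  have hexp : ∀ a, (p a).toReal * (s + (f a - μ)) ^ 2 =
      (p a).toReal * s ^ 2 + (2 * s) * ((p a).toReal * (f a - μ)) +
        (p a).toReal * (f a - μ) ^ 2 := fun a => by ring
  have hsum : Summable fun a => (p a).toReal * (s + (f a - μ)) ^ 2 := by
    simp only [hexp]
    exact ((hs0.mul_right _).add (hs1.mul_left _)).add hs2
  rw [expect_ofReal (fun a => sq_nonneg _) hsum, ← ENNReal.ofReal_add (sq_nonneg _) (sq_nonneg _)]
  apply ENNReal.ofReal_le_ofReal
  rw [mean]
  simp only [hexp]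
  rw [((hs0.mul_right _).add (hs1.mul_left _)).tsum_add hs2,
    (hs0.mul_right _).tsum_add (hs1.mul_left _), tsum_mul_left, hz, tsum_mul_right, tsum_toReal]
  have := mean_le_of_bounded p (f := fun a => (f a - μ) ^ 2) (fun a => sq_nonneg _)
    fun a => (le_abs_self _).trans (hd2 a)
  rw [mean] at this
  linarith

lemma expect_sum_sub_sq_le (p : PMF α) {f : α → ℝ} {c : ℝ} (h0 : ∀ a, 0 ≤ f a)
    (hc : ∀ a, f a ≤ c) (m : ℕ) :
    expect (iidList p m) (fun l => ENNReal.ofReal (((l.map f).sum - m * mean p f) ^ 2)) ≤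
      m * ENNReal.ofReal (c ^ 2) := by
  induction m with
  | zero => simp [iidList, expect_pure]
  | succ m ih =>
    rw [expect_iidList_succ]
    calc _ ≤ expect (iidList p m) (fun l =>
          ENNReal.ofReal (((l.map f).sum - m * mean p f) ^ 2) + ENNReal.ofReal (c ^ 2)) := by
          refine expect_mono fun l => le_trans (le_of_eq ?_)
            (expect_sq_add_le p h0 hc ((l.map f).sum - m * mean p f))
          congr 1; ext a; congr 2
          simp only [List.map_cons, List.sum_cons]
          push_cast; ring
      _ ≤ _ := by
          rw [expect_add, expect_const]
          push_cast
          rw [add_mul, one_mul]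
          gcongr

/-- Chebyshev's inequality for a sum of independent bounded variables. -/
lemma chebyshev_iidList (p : PMF α) {f : α → ℝ} {c : ℝ} (h0 : ∀ a, 0 ≤ f a)
    (hc : ∀ a, f a ≤ c) (m : ℕ) {t : ℝ} (ht : 0 < t) :
    (iidList p m).toOuterMeasure {l | t ≤ |(l.map f).sum - m * mean p f|} ≤
      ENNReal.ofReal (m * c ^ 2 / t ^ 2) := by
  have h1 := mul_toOuterMeasure_le_expect (iidList p m)
    (fun l => ENNReal.ofReal (((l.map f).sum - m * mean p f) ^ 2)) (ENNReal.ofReal (t ^ 2))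
  have h2 := h1.trans (expect_sum_sub_sq_le p h0 hc m)
  have ht2 : 0 < t ^ 2 := by positivity
  rw [ENNReal.ofReal_div_of_pos ht2, ENNReal.le_div_iff_mul_le (Or.inl (by simp [ht.ne'])) (Or.inl ENNReal.ofReal_ne_top), mul_comm,
    ENNReal.ofReal_mul (by positivity), ENNReal.ofReal_natCast]
  refine le_trans ?_ h2
  gcongr with l
  intro hl
  apply ENNReal.ofReal_le_ofReal
  rw [← sq_abs (_ - _)]
  exact pow_le_pow_left₀ ht.le hl 2

/-- The weak law of large numbers: a sum of `m` independent variables with mean less than `θ`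
is at most `θ * m` with high probability.  No moment beyond the first is needed. -/
lemma tendsto_iidList_sum_gt (p : PMF α) (f : α → ℕ) {θ : ℝ}
    (hθ : expect p (fun a => (f a : ℝ≥0∞)) < ENNReal.ofReal θ) :
    Tendsto (fun m : ℕ => (iidList p m).toOuterMeasure {l | θ * m < ((l.map f).sum : ℝ)})
      atTop (nhds 0) := by
  set E := expect p (fun a => (f a : ℝ≥0∞)) with hE
  have hEtop : E ≠ ∞ := (hθ.trans ENNReal.ofReal_lt_top).ne
  have hEr : E.toReal < θ := by
    by_contra! h
    have := ENNReal.ofReal_le_ofReal h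
    rw [ENNReal.ofReal_toReal hEtop] at this
    exact absurd this hθ.not_ge
  set θ' := (E.toReal + θ) / 2 with hθ'
  have h1 : E.toReal < θ' := by rw [hθ']; linarith
  have h2 : 0 < θ - θ' := by rw [hθ']; linarith
  rw [ENNReal.tendsto_nhds_zero]
  intro η hη
  obtain ⟨η', hη'0, hη'⟩ : ∃ η' : ℝ, 0 < η' ∧ ENNReal.ofReal η' + ENNReal.ofReal η' ≤ η := by
    rcases eq_or_ne η ∞ with rfl | hη2
    · exact ⟨1, one_pos, le_top⟩
    · refine ⟨η.toReal / 2, half_pos (ENNReal.toReal_pos hη.ne' hη2), ?_⟩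
      rw [← ENNReal.ofReal_add (by positivity) (by positivity), add_halves,
        ENNReal.ofReal_toReal hη2]
  -- Truncate `f` at a level above which it has almost no mass.
  obtain ⟨L, hL⟩ : ∃ L : ℕ, expect p (fun a => ((f a - L : ℕ) : ℝ≥0∞)) ≤
      ENNReal.ofReal (η' * (θ - θ')) := by
    have ht := ENNReal.tendsto_tsum_compl_atTop_zero (f := fun a => p a * (f a : ℝ≥0∞)) hEtop
    rw [ENNReal.tendsto_nhds_zero] at ht
    obtain ⟨s, hs⟩ := (ht (ENNReal.ofReal (η' * (θ - θ')))
      (ENNReal.ofReal_pos.2 (by positivity))).exists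
    refine ⟨s.sup f, le_trans ?_ hs⟩
    refine le_of_le_of_eq ?_ (tsum_subtype {x | x ∉ s} fun a => p a * (f a : ℝ≥0∞)).symm
    refine ENNReal.tsum_le_tsum fun a => ?_
    beta_reduce
    by_cases ha : a ∈ s
    · rw [Nat.sub_eq_zero_of_le (Finset.le_sup ha)]; simp
    · rw [Set.indicator_of_mem (by exact ha)]
      gcongr
      exact Nat.sub_le _ _
  set g : α → ℝ := fun a => ((min (f a) L : ℕ) : ℝ) with hg
  have hg0 : ∀ a, 0 ≤ g a := fun a => Nat.cast_nonneg _
  have hgL : ∀ a, g a ≤ L := fun a => Nat.cast_le.2 (min_le_right _ _)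
  have hgm : mean p g ≤ E.toReal := by
    rw [← ENNReal.ofReal_le_iff_le_toReal hEtop, ← expect_ofReal hg0
      (summable_mul_of_bounded p fun a => by rw [abs_of_nonneg (hg0 a)]; exact hgL a)]
    refine expect_mono fun a => ?_
    rw [hg, ENNReal.ofReal_natCast]
    exact_mod_cast min_le_left _ _
  have hd : 0 < θ' - mean p g := by linarith
  have hlim : Tendsto (fun m : ℕ => (L : ℝ) ^ 2 / (θ' - mean p g) ^ 2 / (m : ℝ)) atTop (nhds 0) :=
    tendsto_const_div_atTop_nhds_zero_nat _
  filter_upwards [hlim.eventually (ge_mem_nhds hη'0), eventually_gt_atTop 0] with m hm hm0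
  have hm0' : (0 : ℝ) < m := by exact_mod_cast hm0
  have hsplit : {l : List α | θ * m < ((l.map f).sum : ℝ)} ⊆
      {l | m * (θ' - mean p g) ≤ |(l.map g).sum - m * mean p g|} ∪
      {l | ENNReal.ofReal (m * (θ - θ')) ≤ (l.map fun a => ((f a - L : ℕ) : ℝ≥0∞)).sum} := by
    intro l hl
    simp only [Set.mem_ofPred_eq, Set.mem_union] at hl ⊢
    by_contra! hcon
    obtain ⟨hc1, hc2⟩ := hcon
    have hc2' : (l.map fun a => ((f a - L : ℕ) : ℝ)).sum < m * (θ - θ') := by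
      have : (l.map fun a => ((f a - L : ℕ) : ℝ≥0∞)).sum =
          ENNReal.ofReal (l.map fun a => ((f a - L : ℕ) : ℝ)).sum := by
        clear hl hc1 hc2
        induction l with
        | nil => simp
        | cons a l ih =>
          rw [List.map_cons, List.sum_cons, List.map_cons, List.sum_cons, ENNReal.ofReal_add
            (Nat.cast_nonneg _) (List.sum_nonneg (by simp)), ih, ENNReal.ofReal_natCast]
      rw [this] at hc2
      exact (ENNReal.ofReal_lt_ofReal_iff (by positivity)).1 hc2
    have hsum : ((l.map f).sum : ℝ) = (l.map g).sum + (l.map fun a => ((f a - L : ℕ) : ℝ)).sum := by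
      clear hl hc1 hc2 hc2'
      induction l with
      | nil => simp
      | cons a l ih =>
        simp only [List.map_cons, List.sum_cons]
        rw [Nat.cast_add, ih, hg]
        have : ((f a : ℕ) : ℝ) = ((min (f a) L : ℕ) : ℝ) + ((f a - L : ℕ) : ℝ) := by
          rw [← Nat.cast_add]; congr 1; omega
        rw [this]; ring
    have := (abs_lt.1 hc1).2
    nlinarith
  refine (measure_mono hsplit).trans ((measure_union_le _ _).trans (le_trans ?_ hη'))
  refine add_le_add ?_ ?_
  · refine (chebyshev_iidList p hg0 hgL m (by positivity)).trans (ENNReal.ofReal_le_ofReal ?_)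
    refine le_trans (le_of_eq ?_) hm
    field_simp
  · have h3 := mul_toOuterMeasure_le_expect (iidList p m)
      (fun l => (l.map fun a => ((f a - L : ℕ) : ℝ≥0∞)).sum) (ENNReal.ofReal (m * (θ - θ')))
    rw [expect_iidList_sum, mul_comm] at h3
    have hpos : 0 < (m : ℝ) * (θ - θ') := by positivity
    refine (ENNReal.le_div_iff_mul_le (Or.inl (ENNReal.ofReal_pos.2 hpos).ne')
      (Or.inl ENNReal.ofReal_ne_top)).2 h3
      |>.trans ?_
    refine ENNReal.div_le_of_le_mul ?_
    calc (m : ℝ≥0∞) * expect p (fun a => ((f a - L : ℕ) : ℝ≥0∞))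
        ≤ m * ENNReal.ofReal (η' * (θ - θ')) := by gcongr
      _ = ENNReal.ofReal η' * ENNReal.ofReal (m * (θ - θ')) := by
          rw [← ENNReal.ofReal_natCast m, ← ENNReal.ofReal_mul (by positivity),
            ← ENNReal.ofReal_mul (by positivity)]
          congr 1; ring

end Expectation

/-! ### Codes in terms of lists -/

/-- The law of the idle time until the next harvest. -/
noncomputable def geo (q : unitInterval) : PMF ℕ := (geometricMeasure q).toPMF

/-- The law of a single harvest. -/
noncomputable def harvest (q : unitInterval) : PMF Bool := (bernoulliMeasure true false q).toPMF

lemma geo_apply {q : unitInterval} (hq : 0 < q) (n : ℕ) :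
    geo q n = ENNReal.ofReal (1 - q) ^ n * ENNReal.ofReal q := by
  rw [geo, Measure.toPMF_apply, geometricMeasure_singleton hq.ne',
    ENNReal.ofReal_mul (pow_nonneg (by have := q.2.2; linarith) _),
    ENNReal.ofReal_pow (by have := q.2.2; linarith)]

lemma harvest_true (q : unitInterval) : harvest q true = ENNReal.ofReal q := by
  rw [harvest, Measure.toPMF_apply, bernoulliMeasure_apply_of_mem_of_notMem _ (by simp) (by simp)
    (by simp)]
  rw [ENNReal.ofReal, ENNReal.coe_inj]
  ext; simp [q.2.1]

lemma harvest_false (q : unitInterval) : harvest q false = ENNReal.ofReal (1 - q) := by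
  rw [harvest, Measure.toPMF_apply, bernoulliMeasure_apply_of_notMem_of_mem _ (by simp) (by simp)
    (by simp)]
  rw [ENNReal.ofReal, ENNReal.coe_inj]
  ext; simp [q.2.2]

section Messages

variable {W : Type} [Fintype W] [Nonempty W]

/-- The uniform law of the message. -/
noncomputable def unif (W : Type) [Fintype W] [Nonempty W] : PMF W := PMF.uniformOfFintype W

lemma expect_unif (F : W → ℝ≥0∞) : expect (unif W) F = (∑ w, F w) / Fintype.card W := by
  rw [expect, tsum_fintype, ENNReal.div_eq_inv_mul, Finset.mul_sum]
  simp [unif]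

lemma expect_unif_equiv {V : Type} [Fintype V] [Nonempty V] (e : V ≃ W) (F : W → ℝ≥0∞) :
    expect (unif V) (fun v => F (e v)) = expect (unif W) F := by
  rw [expect_unif, expect_unif, e.sum_comp, Fintype.card_congr e]

lemma ofReal_sum_real_div (P : W → ℝ≥0∞) (hP : ∀ w, P w ≤ 1) :
    ENNReal.ofReal ((∑ w, (P w).toReal) / Fintype.card W) = expect (unif W) P := by
  have hc : (0 : ℝ) < Fintype.card W := by exact_mod_cast Fintype.card_pos
  have hP' : ∀ w, P w ≠ ∞ := fun w => ((hP w).trans_lt ENNReal.one_lt_top).ne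
  rw [expect_unif, ENNReal.ofReal_div_of_pos hc, ENNReal.ofReal_natCast,
    ENNReal.ofReal_sum_of_nonneg fun _ _ => ENNReal.toReal_nonneg]
  simp [ENNReal.ofReal_toReal, hP']

end Messages

/-! ### The timing channel on lists -/

/-- The output of the timing channel for the encoding rule `r` and the states `l`, newest first:
`r (Z_k :: … :: Z_1)` is the input `V_k`. -/
def times (r : List ℕ → ℕ) : List ℕ → List ℕ
  | [] => []
  | z :: l => (r (z :: l) + z) :: times r l

@[simp] lemma length_times (r : List ℕ → ℕ) (l : List ℕ) : (times r l).length = l.length := by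
  induction l with
  | nil => rfl
  | cons z l ih => simp [times, ih]

lemma times_pos {r : List ℕ → ℕ} (hr : ∀ l, 1 ≤ r l) (l : List ℕ) : ∀ t ∈ times r l, 1 ≤ t := by
  induction l with
  | nil => simp [times]
  | cons z l ih =>
    simp only [times, List.mem_cons, forall_eq_or_imp]
    exact ⟨(hr _).trans (Nat.le_add_right _ _), ih⟩

lemma lintegral_idleLaw (q : unitInterval) (m : ℕ) (F : List ℕ → ℝ≥0∞) :
    ∫⁻ z, F (revList z) ∂(idleLaw q m) = expect (iidList (geo q) m) F := by
  rw [← lintegral_pi_revList, idleLaw, geo, Measure.toPMF_toMeasure]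

lemma idleLaw_apply (q : unitInterval) (m : ℕ) (s : Set (List ℕ)) :
    idleLaw q m {z | revList z ∈ s} = (iidList (geo q) m).toOuterMeasure s := by
  classical
  rw [toOuterMeasure_eq_expect, ← lintegral_idleLaw,
    ← lintegral_indicator_one (MeasurableSet.of_discrete)]
  refine lintegral_congr fun z => ?_
  by_cases h : revList z ∈ s <;> simp [h]

section TimingBridge

variable {m M : ℕ} (q : unitInterval) (c : TimingCode m M) {r : Fin M → List ℕ → ℕ}
  {d : List ℕ → Fin M}

lemma ofReal_timing_errorProb [NeZero M]
    (hr : ∀ w z, revList (c.output w z) = times (r w) (revList z))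
    (hd : ∀ t, c.dec t = d (revList t)) :
    ENNReal.ofReal (c.errorProb q) = expect (unif (Fin M)) fun w =>
      (iidList (geo q) m).toOuterMeasure {l | d (times (r w) l) ≠ w} := by
  rw [← ofReal_sum_real_div _ fun w => toOuterMeasure_le_one _ _, TimingCode.errorProb,
    Fintype.card_fin]
  congr 3
  ext w
  rw [← idleLaw_apply, Measure.real]
  congr 2
  ext z
  change c.dec (c.output w z) ≠ w ↔ d (times (r w) (revList z)) ≠ w
  rw [hd, hr]

lemma timing_expectedTime [NeZero M]
    (hr : ∀ w z, revList (c.output w z) = times (r w) (revList z)) :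
    c.expectedTime q = expect (unif (Fin M)) fun w =>
      expect (iidList (geo q) m) fun l => ((times (r w) l).sum : ℝ≥0∞) := by
  rw [expect_unif, TimingCode.expectedTime, Fintype.card_fin]
  congr 2
  ext w
  rw [← lintegral_idleLaw]
  refine lintegral_congr fun z => ?_
  rw [← hr, revList, List.sum_reverse, List.sum_ofFn]
  push_cast; rfl

end TimingBridge

/-- Every timing code with messages `Fin M` is given by encoding rules on lists. -/
lemma TimingCode.exists_rule {m M : ℕ} [NeZero M] (c : TimingCode m M) (q : unitInterval) :
    ∃ (r : Fin M → List ℕ → ℕ) (d : List ℕ → Fin M), (∀ w l, 1 ≤ r w l) ∧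
      ENNReal.ofReal (c.errorProb q) = expect (unif (Fin M)) (fun w =>
        (iidList (geo q) m).toOuterMeasure {l | d (times (r w) l) ≠ w}) ∧
      c.expectedTime q = expect (unif (Fin M)) fun w =>
        expect (iidList (geo q) m) fun l => ((times (r w) l).sum : ℝ≥0∞) := by
  let r : Fin M → List ℕ → ℕ := fun w l =>
    if h : l.length - 1 < m then c.enc w ⟨l.length - 1, h⟩ fun j => l.reverse.getD j 0 else 1
  let d : List ℕ → Fin M := fun l => c.dec fun j => l.reverse.getD j 0
  have hr : ∀ w z, revList (c.output w z) = times (r w) (revList z) := by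
    intro w z
    have aux : ∀ (f : ℕ → ℕ) (k k' : ℕ) (h : k < m) (h' : k' < m), k = k' →
        c.enc w ⟨k, h⟩ (fun j => f j) = c.enc w ⟨k', h'⟩ fun j => f j := by
      rintro f k _ h h' rfl; rfl
    have key : ∀ k (hk : k ≤ m), revList (fun j : Fin k => c.output w z (Fin.castLE hk j)) =
        times (r w) (revList fun j : Fin k => z (Fin.castLE hk j)) := by
      intro k
      induction k with
      | zero => intro hk; simp [revList, times]
      | succ k ih =>
        intro hk
        rw [revList_succ, revList_succ, times,
          ← revList_succ fun j : Fin (k + 1) => z (Fin.castLE hk j)]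
        congr 1
        · have hkm : k < m := hk
          simp only [r, length_revList, Nat.add_sub_cancel, hkm, dite_true, TimingCode.output]
          refine congrArg (· + _) ?_
          refine Eq.trans (congrArg (c.enc w ⟨k, hkm⟩) (funext fun j => ?_))
            (aux (fun j => (revList fun j : Fin (k + 1) => z (Fin.castLE hk j)).reverse.getD j 0)
              k _ hkm _ (by rw [length_revList]; rfl))
          rw [reverse_revList_getD (fun j : Fin (k + 1) => z (Fin.castLE hk j)) j 0]
        · exact ih (by omega)
    exact key m le_rfl
  have hd : ∀ t, c.dec t = d (revList t) := fun t => by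
    simp only [d, reverse_revList_getD]
  refine ⟨r, d, fun w l => ?_, ofReal_timing_errorProb q c hr hd, timing_expectedTime q c hr⟩
  simp only [r]
  split_ifs with h
  · exact c.enc_pos _ _ _
  · exact le_rfl

/-- Encoding rules on lists give a timing code. -/
lemma exists_timingCode {W : Type} [Fintype W] [Nonempty W] (q : unitInterval) (m : ℕ)
    (r : W → List ℕ → ℕ) (hr : ∀ w l, 1 ≤ r w l) (d : List ℕ → W) :
    ∃ c : TimingCode m (Fintype.card W),
      ENNReal.ofReal (c.errorProb q) = expect (unif W) (fun w =>
        (iidList (geo q) m).toOuterMeasure {l | d (times (r w) l) ≠ w}) ∧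
      c.expectedTime q = expect (unif W) fun w =>
        expect (iidList (geo q) m) fun l => ((times (r w) l).sum : ℝ≥0∞) := by
  have : NeZero (Fintype.card W) := ⟨Fintype.card_ne_zero⟩
  let e := (Fintype.equivFin W).symm
  let c : TimingCode m (Fintype.card W) :=
    { enc := fun w k z => r (e w) (revList z)
      enc_pos := fun w k z => hr _ _
      dec := fun t => e.symm (d (revList t)) }
  have hout : ∀ w z, revList (c.output w z) = times (r (e w)) (revList z) := by
    intro w z
    have key : ∀ k (hk : k ≤ m), revList (fun j : Fin k => c.output w z (Fin.castLE hk j)) =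
        times (r (e w)) (revList fun j : Fin k => z (Fin.castLE hk j)) := by
      intro k
      induction k with
      | zero => intro hk; simp [revList, times]
      | succ k ih =>
        intro hk
        rw [revList_succ, revList_succ, times,
          ← revList_succ fun j : Fin (k + 1) => z (Fin.castLE hk j)]
        congr 1
        exact ih (by omega)
    exact key m le_rfl
  refine ⟨c, ?_, ?_⟩
  · rw [ofReal_timing_errorProb q c (d := fun t => e.symm (d t)) hout fun t => rfl]
    rw [← expect_unif_equiv e]
    congr 1; ext w; congr 1; ext l
    change e.symm (d (times (r (e w)) l)) ≠ w ↔ d (times (r (e w)) l) ≠ e w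
    rw [Ne, Equiv.symm_apply_eq]
  · rw [timing_expectedTime q c hout]
    exact expect_unif_equiv e fun w =>
      expect (iidList (geo q) m) fun l => ((times (r w) l).sum : ℝ≥0∞)

/-! ### The energy harvesting channel on lists -/

/-- The law of the next battery state, given the past states `h` (newest first): the battery stays
full if it is full and nothing is sent, and otherwise the next harvest decides. -/
noncomputable def nextState (q : unitInterval) (x : List Bool → Bool) (h : List Bool) : PMF Bool :=
  if h.headD false && !x h then PMF.pure true else harvest q

/-- The law of the first `n` battery states, newest first, under the strategy `x`. -/
noncomputable def stateLaw (q : unitInterval) (x : List Bool → Bool) : ℕ → PMF (List Bool)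
  | 0 => PMF.pure []
  | n + 1 => (stateLaw q x n).bind fun h => (nextState q x h).map fun s => s :: h

/-- The channel outputs, newest first, as a function of the battery states. -/
def outputs (x : List Bool → Bool) : List Bool → List Bool
  | [] => []
  | s :: h => x (s :: h) :: outputs x h

@[simp] lemma length_outputs (x : List Bool → Bool) (h : List Bool) :
    (outputs x h).length = h.length := by
  induction h with
  | nil => rfl
  | cons s h ih => simp [outputs, ih]

lemma outputs_drop (x : List Bool → Bool) (h : List Bool) (k : ℕ) :
    outputs x (h.drop k) = (outputs x h).drop k := by
  induction h generalizing k with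
  | nil => simp [outputs]
  | cons s h ih =>
    cases k with
    | zero => rfl
    | succ k => simp [outputs, ih]

/-- The battery states as a function of the harvests (both newest first). -/
def statesOf (x : List Bool → Bool) : List Bool → List Bool
  | [] => []
  | e :: l => (((statesOf x l).headD false && !x (statesOf x l)) || e) :: statesOf x l

lemma expect_statesOf (q : unitInterval) (x : List Bool → Bool) (n : ℕ)
    (F : List Bool → ℝ≥0∞) :
    expect (iidList (harvest q) n) (fun l => F (statesOf x l)) = expect (stateLaw q x n) F := by
  induction n generalizing F with
  | zero => simp [iidList, stateLaw, expect_pure, statesOf]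
  | succ n ih =>
    rw [expect_iidList_succ, stateLaw, expect_bind, ← ih]
    congr 1; ext l
    rw [expect_map, nextState]
    simp only [statesOf]
    cases (statesOf x l).headD false && !x (statesOf x l)
    · simp
    · simp [expect_pure, expect_const]

lemma statesOf_revList (x : List Bool → Bool) (e : ℕ → Bool) (k : ℕ) :
    statesOf x (revList fun i : Fin (k + 1) => e i) = stateHistory x e k := by
  induction k with
  | zero => simp [revList, statesOf, stateHistory]
  | succ k ih =>
    rw [revList_succ, statesOf]
    have : (revList fun i : Fin (k + 1) => e (i.castSucc : Fin (k + 2))) =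
      revList fun i : Fin (k + 1) => e i := rfl
    rw [this, ih, stateHistory]
    simp

lemma outputs_statesOf_revList (x : List Bool → Bool) (e : ℕ → Bool) (k : ℕ) :
    outputs x (statesOf x (revList fun i : Fin k => e i)) =
      revList fun i : Fin k => x (stateHistory x e i) := by
  induction k with
  | zero => simp [revList, statesOf, outputs]
  | succ k ih =>
    have h := statesOf_revList x e k
    rw [revList_succ, statesOf] at h ⊢
    rw [outputs, h, revList_succ]
    congr 1

lemma harvestLaw_apply (q : unitInterval) (x : List Bool → Bool) (n : ℕ) (s : Set (List Bool)) :
    harvestLaw q n {e | statesOf x (revList e) ∈ s} = (stateLaw q x n).toOuterMeasure s := by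
  classical
  rw [toOuterMeasure_eq_expect, ← expect_statesOf, ← lintegral_pi_revList, harvest,
    Measure.toPMF_toMeasure, ← lintegral_indicator_one (MeasurableSet.of_discrete), harvestLaw]
  refine lintegral_congr fun e => ?_
  by_cases h : statesOf x (revList e) ∈ s <;> simp [h]

lemma ofReal_errorProb {n M : ℕ} [NeZero M] (q : unitInterval) (c : Code n M)
    {d : List Bool → Fin M} (hd : ∀ y, c.dec y = d (revList y)) :
    ENNReal.ofReal (c.errorProb q) = expect (unif (Fin M)) fun w =>
      (stateLaw q (c.enc w) n).toOuterMeasure {h | d (outputs (c.enc w) h) ≠ w} := by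
  rw [← ofReal_sum_real_div _ fun w => toOuterMeasure_le_one _ _, Code.errorProb,
    Fintype.card_fin]
  congr 3
  ext w
  rw [← harvestLaw_apply, Measure.real]
  congr 2
  ext e
  change c.dec (c.output w e) ≠ w ↔ d (outputs (c.enc w) (statesOf (c.enc w) (revList e))) ≠ w
  have h : revList e = revList fun i : Fin n => extendHarvests e i := by
    congr 1; ext i; simp [extendHarvests]
  rw [h, outputs_statesOf_revList, hd]
  rfl

/-- The decoder of a code for the binary channel can be taken to act on lists. -/
lemma Code.exists_list_decoder {n M : ℕ} [NeZero M] (c : Code n M) (q : unitInterval) :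
    ∃ d : List Bool → Fin M, ENNReal.ofReal (c.errorProb q) = expect (unif (Fin M)) fun w =>
      (stateLaw q (c.enc w) n).toOuterMeasure {h | d (outputs (c.enc w) h) ≠ w} :=
  ⟨fun l => c.dec fun j => l.reverse.getD j false,
    ofReal_errorProb q c (d := fun l => c.dec fun j => l.reverse.getD j false) fun y => by
      simp only [reverse_revList_getD]⟩

/-- Strategies and a decoder on lists give a code for the binary channel. -/
lemma exists_code {W : Type} [Fintype W] [Nonempty W] (q : unitInterval) (n : ℕ)
    (x : W → List Bool → Bool) (hx : ∀ w h, x w (false :: h) = false) (d : List Bool → W) :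
    ∃ c : Code n (Fintype.card W),
      ENNReal.ofReal (c.errorProb q) = expect (unif W) fun w =>
        (stateLaw q (x w) n).toOuterMeasure {h | d (outputs (x w) h) ≠ w} := by
  have : NeZero (Fintype.card W) := ⟨Fintype.card_ne_zero⟩
  let e := (Fintype.equivFin W).symm
  let c : Code n (Fintype.card W) :=
    { enc := fun w => x (e w)
      enc_empty := fun w => hx _
      dec := fun t => e.symm (d (revList t)) }
  refine ⟨c, ?_⟩
  rw [ofReal_errorProb q c (d := fun t => e.symm (d t)) fun t => rfl]
  rw [← expect_unif_equiv e]
  congr 1; ext w; congr 1; ext l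
  change e.symm (d (outputs (x (e w)) l)) ≠ w ↔ d (outputs (x (e w)) l) ≠ e w
  rw [Ne, Equiv.symm_apply_eq]

/-! ### The correspondence between the two channels -/

/-- The battery states, newest first, seen by a transmitter that follows the rule `r` while the
idle times are `l`: after each pulse the battery is empty for `z` slots, and the pulse is sent in
the last of the following `r (z :: l)` slots. -/
def stateTrain (r : List ℕ → ℕ) : List ℕ → List Bool
  | [] => []
  | z :: l => List.replicate (r (z :: l)) true ++ (List.replicate z false ++ stateTrain r l)

/-- The channel output, newest first, with pulses separated by the times `t`. -/
def train : List ℕ → List Bool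
  | [] => []
  | t :: ts => true :: (List.replicate (t - 1) false ++ train ts)

/-- The strategy `x` for the binary channel realizes the rule `r` for the timing channel. -/
structure Follows (x : List Bool → Bool) (r : List ℕ → ℕ) : Prop where
  pos : ∀ l, 1 ≤ r l
  empty : ∀ h, x (false :: h) = false
  on : ∀ z l j, 1 ≤ j → j ≤ r (z :: l) →
    x (List.replicate j true ++ (List.replicate z false ++ stateTrain r l)) =
      decide (j = r (z :: l))

lemma length_stateTrain (r : List ℕ → ℕ) (l : List ℕ) :
    (stateTrain r l).length = (times r l).sum := by
  induction l with
  | nil => rfl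
  | cons z l ih => simp [stateTrain, times, ih, add_assoc]

lemma count_train (ts : List ℕ) : (train ts).count true = ts.length := by
  induction ts with
  | nil => rfl
  | cons t ts ih => simp [train, ih, List.count_replicate]

lemma length_train {ts : List ℕ} (h : ∀ t ∈ ts, 1 ≤ t) : (train ts).length = ts.sum := by
  induction ts with
  | nil => rfl
  | cons t ts ih =>
    simp only [List.mem_cons, forall_eq_or_imp] at h
    simp [train, ih h.2]; omega

/-- A train of pulses is determined, within a longer output, by its number of pulses. -/
lemma train_suffix_unique {ts ts' : List ℕ} {y : List Bool} (hl : ts.length = ts'.length)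
    (hts : ∀ t ∈ ts, 1 ≤ t) (hts' : ∀ t ∈ ts', 1 ≤ t) (h : train ts <:+ y)
    (h' : train ts' <:+ y) : ts = ts' := by
  induction ts generalizing ts' with
  | nil => exact (List.eq_nil_of_length_eq_zero (by simpa using hl.symm)).symm
  | cons t ts ih =>
    cases ts' with
    | nil => simp at hl
    | cons t' ts' =>
      have haux : ∀ a as b bs, as.length = bs.length → train (a :: as) <:+ train (b :: bs) →
          train (a :: as) = train (b :: bs) := by
        rintro a as b bs hlen ⟨pre, hpre⟩
        cases pre with
        | nil => simpa using hpre
        | cons c pre =>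
          exfalso
          have hc : c = true := by
            have := congrArg List.head? hpre
            simpa [train] using this
          have h2 := congrArg (List.count true) hpre
          rw [List.count_append, count_train, count_train, hc] at h2
          simp [hlen] at h2
      have hl' : ts.length = ts'.length := by simpa using hl
      have heq : train (t :: ts) = train (t' :: ts') := by
        rcases List.suffix_or_suffix_of_suffix h h' with h1 | h1
        · exact haux _ _ _ _ hl' h1
        · exact (haux _ _ _ _ hl'.symm h1).symm
      simp only [List.mem_cons, forall_eq_or_imp] at hts hts'
      have hsuf : ∀ a as, train as <:+ train (a :: as) := fun a as =>
        (List.suffix_append _ _).trans (List.suffix_cons _ _)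
      have htl := ih hl' hts.2 hts'.2 ((hsuf t ts).trans h) ((hsuf t' ts').trans h')
      subst htl
      have := congrArg List.length heq
      simp [train] at this
      congr 1; omega

section FollowsLemmas

variable {x : List Bool → Bool} {r : List ℕ → ℕ}

lemma Follows.emptied (h : Follows x r) (l : List ℕ) :
    ((stateTrain r l).headD false && !x (stateTrain r l)) = false := by
  cases l with
  | nil => rfl
  | cons z l =>
    rw [stateTrain, h.on z l _ (h.pos _) le_rfl]
    simp

lemma outputs_replicate_false (h : ∀ h, x (false :: h) = false) (z : ℕ) (g : List Bool) :
    outputs x (List.replicate z false ++ g) = List.replicate z false ++ outputs x g := by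
  induction z with
  | zero => rfl
  | succ z ih => simp [List.replicate_succ, outputs, h, ih]

lemma Follows.outputs_stateTrain (h : Follows x r) (l : List ℕ) :
    outputs x (stateTrain r l) = train (times r l) := by
  induction l with
  | nil => rfl
  | cons z l ih =>
    have key : ∀ j, j < r (z :: l) → outputs x (List.replicate j true ++
        (List.replicate z false ++ stateTrain r l)) =
          List.replicate (j + z) false ++ train (times r l) := by
      intro j
      induction j with
      | zero => intro _; simp [outputs_replicate_false h.empty, ih]
      | succ j ihj =>
        intro hj
        have hx := h.on z l (j + 1) (by omega) hj.le
        rw [List.replicate_succ, List.cons_append] at hx ⊢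
        rw [outputs, ihj (by omega), hx, decide_eq_false hj.ne, add_right_comm,
          List.replicate_succ, List.cons_append]
    obtain ⟨v, hv⟩ : ∃ v, r (z :: l) = v + 1 := ⟨r (z :: l) - 1, by have := h.pos (z :: l); omega⟩
    have hx := h.on z l (v + 1) (by omega) hv.ge
    rw [List.replicate_succ, List.cons_append, hv] at hx
    rw [stateTrain, times, train, hv, List.replicate_succ, List.cons_append, outputs,
      key v (by omega), hx]
    simp [add_right_comm]

lemma stateLaw_cons (q : unitInterval) (x : List Bool → Bool) (n : ℕ) (s : Bool)
    (h : List Bool) : stateLaw q x (n + 1) (s :: h) = stateLaw q x n h * nextState q x h s := by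
  classical
  rw [stateLaw, PMF.bind_apply, tsum_eq_single h]
  · congr 1
    rw [PMF.map_apply, tsum_eq_single s]
    · simp
    · intro b hb; simp [hb.symm]
  · intro l' hl'
    rw [PMF.map_apply]
    simp [hl'.symm]

lemma length_of_mem_support_stateLaw {q : unitInterval} {x : List Bool → Bool} {n : ℕ}
    {h : List Bool} (hh : h ∈ (stateLaw q x n).support) : h.length = n := by
  induction n generalizing h with
  | zero => simp [stateLaw] at hh; simp [hh]
  | succ m ih =>
    simp only [stateLaw, PMF.mem_support_bind_iff, PMF.mem_support_map_iff] at hh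
    obtain ⟨l', hl', a, -, rfl⟩ := hh
    simp [ih hl']

lemma expect_stateLaw_drop (q : unitInterval) (x : List Bool → Bool) (j k : ℕ)
    (F : List Bool → ℝ≥0∞) :
    expect (stateLaw q x (j + k)) (fun h => F (h.drop j)) = expect (stateLaw q x k) F := by
  induction j with
  | zero => simp
  | succ j ih =>
    rw [add_right_comm, stateLaw, expect_bind]
    simp only [expect_map, List.drop_succ_cons, expect_const]
    exact ih

/-- The probability that the battery states follow the idle times `l` is the probability of
these idle times. -/
lemma Follows.stateLaw_stateTrain (h : Follows x r) {q : unitInterval} (hq : 0 < q) (l : List ℕ) :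
    stateLaw q x (times r l).sum (stateTrain r l) = iidList (geo q) l.length l := by
  induction l with
  | nil => simp [times, stateTrain, stateLaw, iidList]
  | cons z l ih =>
    rw [List.length_cons, iidList_cons, ← ih, geo_apply hq]
    set k := (times r l).sum with hk
    set g := stateTrain r l with hg
    have hfalse : ∀ i, stateLaw q x (i + k) (List.replicate i false ++ g) =
        stateLaw q x k g * ENNReal.ofReal (1 - q) ^ i := by
      intro i
      induction i with
      | zero => simp
      | succ i ihi =>
        have hn : nextState q x (List.replicate i false ++ g) = harvest q := by
          rw [nextState]
          cases i with
          | zero => rw [List.replicate_zero, List.nil_append, hg, h.emptied]; rfl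
          | succ i => simp [List.replicate_succ]
        rw [add_right_comm, List.replicate_succ, List.cons_append, stateLaw_cons, ihi, hn,
          harvest_false, pow_succ, mul_assoc]
    have htrue : ∀ i, i < r (z :: l) → stateLaw q x (i + 1 + (z + k))
        (List.replicate (i + 1) true ++ (List.replicate z false ++ g)) =
          stateLaw q x k g * (ENNReal.ofReal (1 - q) ^ z * ENNReal.ofReal q) := by
      intro i
      induction i with
      | zero =>
        intro _
        have hn : nextState q x (List.replicate z false ++ g) = harvest q := by
          rw [nextState]
          cases z with
          | zero => rw [List.replicate_zero, List.nil_append, hg, h.emptied]; rfl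
          | succ i => simp [List.replicate_succ]
        rw [zero_add, add_comm 1, List.replicate_one, List.singleton_append, stateLaw_cons,
          hfalse, hn, harvest_true, mul_assoc]
      | succ i ihi =>
        intro hi
        have hx := h.on z l (i + 1) (by omega) hi.le
        have hn : nextState q x (List.replicate (i + 1) true ++ (List.replicate z false ++ g)) =
            PMF.pure true := by
          rw [nextState, hx, decide_eq_false hi.ne]
          simp [List.replicate_succ]
        rw [List.replicate_succ, List.cons_append, add_right_comm (i + 1), stateLaw_cons,
          ihi (by omega), hn]
        simp
    obtain ⟨v, hv⟩ : ∃ v, r (z :: l) = v + 1 := ⟨r (z :: l) - 1, by have := h.pos (z :: l); omega⟩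
    rw [times, stateTrain, List.sum_cons, hv, add_assoc]
    exact htrue v (by omega)

/-- Different sequences of equally many idle times belong to disjoint sets of state histories. -/
lemma Follows.unique (h : Follows x r) {l l' : List ℕ} {g : List Bool}
    (hl : l.length = l'.length) (h1 : stateTrain r l <:+ g) (h2 : stateTrain r l' <:+ g) :
    l = l' := by
  induction l generalizing l' with
  | nil => exact (List.eq_nil_of_length_eq_zero (by simpa using hl.symm)).symm
  | cons z l ih =>
    cases l' with
    | nil => simp at hl
    | cons z' l' =>
      have hsuf : ∀ a as, stateTrain r as <:+ stateTrain r (a :: as) := fun a as =>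
        (List.suffix_append _ _).trans (List.suffix_append _ _)
      have htl := ih (by simpa using hl) ((hsuf _ _).trans h1) ((hsuf _ _).trans h2)
      subst htl
      have hout : ∀ as, stateTrain r as <:+ g → train (times r as) <:+ outputs x g := by
        intro as has
        rw [← h.outputs_stateTrain, List.suffix_iff_eq_drop.1 has, outputs_drop]
        exact List.drop_suffix _ _
      have ht := train_suffix_unique (by simp) (times_pos h.pos _) (times_pos h.pos _)
        (hout _ h1) (hout _ h2)
      have hlen : (stateTrain r (z :: l)).length = (stateTrain r (z' :: l)).length := by
        rw [length_stateTrain, length_stateTrain, ht]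
      have heq : stateTrain r (z :: l) = stateTrain r (z' :: l) := by
        rw [List.suffix_iff_eq_drop.1 h1, List.suffix_iff_eq_drop.1 h2, hlen]
      have hc := congrArg (List.count false) heq
      simp [stateTrain, List.count_replicate] at hc
      rw [hc]

/-- The idle times of the timing channel embed into the battery states of the binary channel. -/
lemma Follows.coupling (h : Follows x r) {q : unitInterval} (hq : 0 < q) (A : Set (List ℕ))
    (m n : ℕ) :
    (iidList (geo q) m).toOuterMeasure {l | l ∈ A ∧ (times r l).sum ≤ n} ≤
      (stateLaw q x n).toOuterMeasure {g | ∃ l ∈ A, l.length = m ∧ stateTrain r l <:+ g} := by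
  classical
  set B : Set (List ℕ) := {l | l ∈ A ∧ l.length = m ∧ (times r l).sum ≤ n} with hB
  have hsuf : ∀ l ∈ B, iidList (geo q) m l =
      expect (stateLaw q x n) ({g | stateTrain r l <:+ g}.indicator fun _ => 1) := by
    rintro l ⟨-, hl, hn⟩
    obtain ⟨j, rfl⟩ : ∃ j, n = j + (times r l).sum := ⟨n - (times r l).sum, by omega⟩
    rw [← hl, ← h.stateLaw_stateTrain hq, ← PMF.toOuterMeasure_apply_singleton,
      toOuterMeasure_eq_expect, ← expect_stateLaw_drop q x j]
    refine expect_congr_of_support fun g hg => ?_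
    have hlen := length_of_mem_support_stateLaw hg
    have : g.drop j = stateTrain r l ↔ stateTrain r l <:+ g := by
      rw [List.suffix_iff_eq_drop, length_stateTrain, hlen, Nat.add_sub_cancel]
      exact eq_comm
    by_cases h' : stateTrain r l <:+ g
    · rw [Set.indicator_of_mem (by exact this.2 h'), Set.indicator_of_mem (by exact h')]
    · rw [Set.indicator_of_notMem (by exact fun hh => h' (this.1 hh)),
        Set.indicator_of_notMem (by exact h')]
  have h1 : (iidList (geo q) m).toOuterMeasure {l | l ∈ A ∧ (times r l).sum ≤ n} ≤
      ∑' l, B.indicator (iidList (geo q) m) l := by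
    rw [PMF.toOuterMeasure_apply]
    refine ENNReal.tsum_le_tsum fun l => ?_
    by_cases hl : l ∈ (iidList (geo q) m).support
    · by_cases hA : l ∈ A ∧ (times r l).sum ≤ n
      · rw [Set.indicator_of_mem (by exact hA), Set.indicator_of_mem
          (by exact ⟨hA.1, length_of_mem_support_iidList hl, hA.2⟩)]
      · rw [Set.indicator_of_notMem (by exact hA)]; exact zero_le
    · rw [Set.indicator_apply, (PMF.apply_eq_zero_iff _ _).2 hl]; simp
  refine h1.trans ?_
  have h2 : ∀ l, B.indicator (iidList (geo q) m) l = ∑' g, stateLaw q x n g *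
      (if l ∈ B ∧ stateTrain r l <:+ g then 1 else 0) := by
    intro l
    by_cases hl : l ∈ B
    · rw [Set.indicator_of_mem hl, hsuf l hl, expect]
      refine tsum_congr fun g => ?_
      by_cases h' : stateTrain r l <:+ g <;> simp [hl, h']
    · rw [Set.indicator_of_notMem hl]; simp [hl]
  simp only [h2]
  rw [ENNReal.tsum_comm, toOuterMeasure_eq_expect, expect]
  refine ENNReal.tsum_le_tsum fun g => ?_
  rw [ENNReal.tsum_mul_left]
  gcongr
  by_cases hg : ∃ l, l ∈ B ∧ stateTrain r l <:+ g
  · obtain ⟨l, hl, hlg⟩ := hg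
    rw [tsum_eq_single l, Set.indicator_of_mem (by exact ⟨l, hl.1, hl.2.1, hlg⟩)]
    · split_ifs <;> simp
    · intro l' hl'
      rw [if_neg]
      rintro ⟨hl'B, hl'g⟩
      exact hl' (h.unique (hl'B.2.1.trans hl.2.1.symm) hl'g hlg)
  · push Not at hg
    rw [ENNReal.tsum_eq_zero.2]
    · exact zero_le
    · intro l
      rw [if_neg]
      rintro ⟨h1, h2⟩
      exact hg l h1 h2

end FollowsLemmas

/-! ### Realizing a timing code over the binary channel -/

/-- The idle times of the completed pulses, the number of idle slots and the number of waiting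
slots since the last pulse, computed from the battery states (newest first). -/
def parse (r : List ℕ → ℕ) : List Bool → List ℕ × ℕ × ℕ
  | [] => ([], 0, 0)
  | false :: h => ((parse r h).1, (parse r h).2.1 + 1, (parse r h).2.2)
  | true :: h =>
    if (parse r h).2.2 + 1 = r ((parse r h).2.1 :: (parse r h).1) then
      ((parse r h).2.1 :: (parse r h).1, 0, 0)
    else ((parse r h).1, (parse r h).2.1, (parse r h).2.2 + 1)

/-- The strategy for the binary channel that realizes the rule `r` for the timing channel. -/
def pulseStrategy (r : List ℕ → ℕ) : List Bool → Bool
  | [] => false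
  | false :: _ => false
  | true :: h => decide ((parse r h).2.2 + 1 = r ((parse r h).2.1 :: (parse r h).1))

lemma parse_replicate_false (r : List ℕ → ℕ) {h : List Bool} {l : List ℕ}
    (hh : parse r h = (l, 0, 0)) (z : ℕ) :
    parse r (List.replicate z false ++ h) = (l, z, 0) := by
  induction z with
  | zero => simpa using hh
  | succ z ih => simp [List.replicate_succ, parse, ih]

lemma parse_replicate_true (r : List ℕ → ℕ) {h : List Bool} {l : List ℕ} {z : ℕ}
    (hh : parse r h = (l, z, 0)) {j : ℕ} (hj : j < r (z :: l)) :
    parse r (List.replicate j true ++ h) = (l, z, j) := by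
  induction j with
  | zero => simpa using hh
  | succ j ih => simp [List.replicate_succ, parse, ih (by omega), hj.ne]

lemma parse_stateTrain {r : List ℕ → ℕ} (hr : ∀ l, 1 ≤ r l) (l : List ℕ) :
    parse r (stateTrain r l) = (l, 0, 0) := by
  induction l with
  | nil => rfl
  | cons z l ih =>
    obtain ⟨v, hv⟩ : ∃ v, r (z :: l) = v + 1 := ⟨r (z :: l) - 1, by have := hr (z :: l); omega⟩
    have h := parse_replicate_true r (parse_replicate_false r ih z) (j := v) (by omega)
    rw [stateTrain, hv, List.replicate_succ, List.cons_append, parse, h]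
    simp [hv]

lemma follows_pulseStrategy {r : List ℕ → ℕ} (hr : ∀ l, 1 ≤ r l) :
    Follows (pulseStrategy r) r where
  pos := hr
  empty _ := rfl
  on z l j hj hjr := by
    obtain ⟨v, rfl⟩ : ∃ v, j = v + 1 := ⟨j - 1, by omega⟩
    have h := parse_replicate_true r (parse_replicate_false r (parse_stateTrain hr l) z) (j := v)
      (by omega)
    rw [List.replicate_succ, List.cons_append, pulseStrategy, h]

/-- A timing code is realized over `n` uses of the binary channel, up to an additional decoding
error if the timing code takes more than `n` slots. -/
lemma exists_code_of_timing {W : Type} [Fintype W] [Nonempty W] {q : unitInterval} (hq : 0 < q)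
    (m n : ℕ) (r : W → List ℕ → ℕ) (hr : ∀ w l, 1 ≤ r w l) (d : List ℕ → W) :
    ∃ c : Code n (Fintype.card W), ENNReal.ofReal (c.errorProb q) ≤ expect (unif W) fun w =>
      (iidList (geo q) m).toOuterMeasure
        {l | d (times (r w) l) ≠ w ∨ n < (times (r w) l).sum} := by
  classical
  let dec : List Bool → W := fun y =>
    if h : ∃ ts : List ℕ, ts.length = m ∧ (∀ t ∈ ts, 1 ≤ t) ∧ train ts <:+ y then d h.choose
    else Classical.arbitrary W
  obtain ⟨c, hc⟩ := exists_code q n (fun w => pulseStrategy (r w)) (fun _ _ => rfl) dec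
  refine ⟨c, hc ▸ expect_mono fun w => ?_⟩
  have hF := follows_pulseStrategy (hr w)
  set x := pulseStrategy (r w)
  set P := stateLaw q x n
  set A : Set (List ℕ) := {l | d (times (r w) l) = w} with hA
  set E : Set (List Bool) := {g | ∃ l ∈ A, l.length = m ∧ stateTrain (r w) l <:+ g} with hE
  set G : Set (List ℕ) := {l | l ∈ A ∧ (times (r w) l).sum ≤ n} with hG
  have hcoup : (iidList (geo q) m).toOuterMeasure G ≤ P.toOuterMeasure E := hF.coupling hq A m n
  have hsub : {h | dec (outputs x h) ≠ w} ⊆ Eᶜ := by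
    rintro g hg ⟨l, hl, hlm, hlg⟩
    apply hg
    have htr : train (times (r w) l) <:+ outputs x g := by
      rw [← hF.outputs_stateTrain, List.suffix_iff_eq_drop.1 hlg, outputs_drop]
      exact List.drop_suffix _ _
    have hex : ∃ ts : List ℕ, ts.length = m ∧ (∀ t ∈ ts, 1 ≤ t) ∧ train ts <:+ outputs x g :=
      ⟨_, by simpa using hlm, times_pos (hr w) l, htr⟩
    simp only [dec]
    rw [dif_pos hex]
    obtain ⟨h1, h2, h3⟩ := hex.choose_spec
    rw [train_suffix_unique (by rw [h1, length_times, hlm]) h2 (times_pos (hr w) l) h3 htr]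
    exact hl
  have hGc : Gᶜ = {l | d (times (r w) l) ≠ w ∨ n < (times (r w) l).sum} := by
    ext l
    change ¬ (d (times (r w) l) = w ∧ (times (r w) l).sum ≤ n) ↔ _ ∨ _
    rw [not_and_or, not_le]
  rw [← hGc]
  refine (measure_mono hsub).trans ?_
  have h1 := toOuterMeasure_add_compl P E
  have h2 := toOuterMeasure_add_compl (iidList (geo q) m) G
  have hGt : (iidList (geo q) m).toOuterMeasure G ≠ ∞ :=
    ((toOuterMeasure_le_one _ _).trans_lt ENNReal.one_lt_top).ne
  refine (ENNReal.add_le_add_iff_left hGt).1 ?_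
  rw [h2, ← h1]
  gcongr

/-! ### Concatenation in blocks -/

section Blocks

variable {α β W : Type}

/-- Use `a` for the first `k` letters of a history (newest first); then use `b`, as a function of
the later letters and the first `k` letters. -/
def andThen (k : ℕ) (a : List α → β) (b : List α → List α → β) (l : List α) : β :=
  if l.length ≤ k then a l else b (l.take (l.length - k)) (l.drop (l.length - k))

lemma andThen_of_le {k : ℕ} (a : List α → β) (b : List α → List α → β) {l : List α}
    (h : l.length ≤ k) : andThen k a b l = a l := if_pos h

lemma andThen_append {k : ℕ} (a : List α → β) (b : List α → List α → β) {l l₀ : List α}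
    (h₀ : l₀.length = k) (h : l ≠ []) : andThen k a b (l ++ l₀) = b l l₀ := by
  have : 0 < l.length := List.length_pos_iff.2 h
  rw [andThen, if_neg (by rw [List.length_append]; omega), List.length_append, h₀,
    Nat.add_sub_cancel, List.take_left, List.drop_left]

/-- The strategy that serves the messages `ws` (newest first) one after the other, with `r w` for
`k` letters for each message `w`. -/
def blocks (k : ℕ) (r : W → List α → β) (b : β) : List W → List α → β
  | [] => fun _ => b
  | w :: ws => andThen (ws.length * k) (blocks k r b ws) fun l _ => r w l

lemma times_congr {r r' : List ℕ → ℕ} {k : ℕ} (h : ∀ l, l.length ≤ k → r l = r' l) (l : List ℕ)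
    (hl : l.length ≤ k) : times r l = times r' l := by
  induction l with
  | nil => rfl
  | cons z l ih =>
    rw [times, times, h _ hl, ih (by simp at hl; omega)]

lemma times_andThen {k : ℕ} (a : List ℕ → ℕ) (b : List ℕ → List ℕ → ℕ) (l : List ℕ)
    {l₀ : List ℕ} (h₀ : l₀.length = k) :
    times (andThen k a b) (l ++ l₀) = times (fun l => b l l₀) l ++ times a l₀ := by
  induction l with
  | nil =>
    rw [List.nil_append, times, List.nil_append]
    exact times_congr (fun l hl => andThen_of_le a b hl) l₀ h₀.le
  | cons z l ih =>
    have h := andThen_append a b h₀ (List.cons_ne_nil z l)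
    rw [List.cons_append] at h
    rw [List.cons_append, times, times, ih, h, List.cons_append]

/-- Independent messages and the random responses to them, block by block. -/
noncomputable def blockLaw (u : PMF W) (K : W → PMF (List α)) : PMF (W × List α) :=
  u.bind fun w => (K w).map fun l => (w, l)

lemma expect_blockLaw (u : PMF W) (K : W → PMF (List α)) (F : W × List α → ℝ≥0∞) :
    expect (blockLaw u K) F = expect u fun w => expect (K w) fun l => F (w, l) := by
  simp only [blockLaw, expect_bind, expect_map]

/-- If the response to a list of messages is made of independent responses to its members, then
random messages with their responses form a sequence of independent blocks. -/
lemma expect_blocks (u : PMF W) (K : W → PMF (List α)) (L : List W → PMF (List α))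
    (h0 : L [] = PMF.pure [])
    (hL : ∀ w ws, L (w :: ws) = (L ws).bind fun l₀ => (K w).map fun l => l ++ l₀)
    (B : ℕ) (G : List W → List α → ℝ≥0∞) :
    expect (iidList u B) (fun ws => expect (L ws) (G ws)) =
      expect (iidList (blockLaw u K) B) fun bl => G (bl.map Prod.fst) (bl.map Prod.snd).flatten := by
  induction B generalizing G with
  | zero => simp [iidList, expect_pure, h0]
  | succ B ih =>
    rw [expect_iidList_succ, expect_iidList_succ]
    simp only [hL, expect_bind, expect_map, expect_blockLaw, List.map_cons, List.flatten_cons]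
    rw [← ih fun ws l₀ => expect u fun w => expect (K w) fun l => G (w :: ws) (l ++ l₀)]
    congr 1; ext ws
    rw [expect_comm]

lemma expect_unif_revList [Fintype W] [Nonempty W] (B : ℕ) (F : List W → ℝ≥0∞) :
    expect (unif (Fin B → W)) (fun w => F (revList w)) = expect (iidList (unif W) B) F := by
  let _ : MeasurableSpace W := ⊤
  rw [← lintegral_pi_revList, lintegral_fintype, expect, tsum_fintype]
  refine Finset.sum_congr rfl fun w _ => ?_
  rw [mul_comm, Measure.pi_singleton]
  congr 1
  have h : ∀ i, (unif W).toMeasure {w i} = (Fintype.card W : ℝ≥0∞)⁻¹ := fun i => by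
    rw [PMF.toMeasure_apply_singleton _ _ (by trivial), unif, PMF.uniformOfFintype_apply]
  rw [Finset.prod_congr rfl fun i _ => h i]
  simp [unif, ENNReal.inv_pow]

end Blocks

/-! ### The mean idle time -/

/-- The mean excess over a level: the geometric distribution has no memory. -/
lemma expect_geo_sub {q : unitInterval} (hq : 0 < q) (d : ℕ) :
    expect (geo q) (fun z => ((z + 1 - d : ℕ) : ℝ≥0∞)) =
      ENNReal.ofReal (1 / q) * expect (geo q) fun z => if d ≤ z then 1 else 0 := by
  set x := ENNReal.ofReal (1 - q) with hx
  set y := ENNReal.ofReal q with hy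
  have hq0 : (0 : ℝ) < q := hq
  have hq1 : (q : ℝ) ≤ 1 := q.2.2
  have hshift : ∀ F : ℕ → ℝ≥0∞, (∀ z < d, F z = 0) →
      expect (geo q) F = x ^ d * ∑' j, x ^ j * y * F (j + d) := by
    intro F hF
    rw [expect, ← ENNReal.summable.sum_add_tsum_nat_add' (k := d), Finset.sum_eq_zero, zero_add,
      ← ENNReal.tsum_mul_left]
    · refine tsum_congr fun j => ?_
      rw [geo_apply hq, pow_add]; ring
    · intro z hz; rw [hF z (Finset.mem_range.1 hz), mul_zero]
  rw [hshift, hshift (fun z => if d ≤ z then 1 else 0)]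
  · have h1 : ∑' j, x ^ j * y * (if d ≤ j + d then (1 : ℝ≥0∞) else 0) = 1 := by
      refine Eq.trans (tsum_congr fun j => ?_) (geo q).tsum_coe
      rw [if_pos (Nat.le_add_left _ _), mul_one, geo_apply hq]
    have h2 : ∑' j : ℕ, x ^ j * y * ((j + d + 1 - d : ℕ) : ℝ≥0∞) = ENNReal.ofReal (1 / q) := by
      have hr : ‖(1 - q : ℝ)‖ < 1 := by
        rw [Real.norm_eq_abs, abs_lt]; constructor <;> linarith
      have hs := ((hasSum_coe_mul_geometric_of_norm_lt_one hr).add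
        (hasSum_geometric_of_norm_lt_one hr)).mul_right (q : ℝ)
      have he : ((1 - q) / (1 - (1 - q)) ^ 2 + (1 - (1 - q : ℝ))⁻¹) * q = 1 / q := by
        rw [sub_sub_cancel]; field_simp; ring
      rw [he] at hs
      rw [← hs.tsum_eq, ENNReal.ofReal_tsum_of_nonneg _ hs.summable]
      · refine tsum_congr fun j => ?_
        rw [show j + d + 1 - d = j + 1 by omega, hx, hy, ← ENNReal.ofReal_pow (by linarith),
          ← ENNReal.ofReal_natCast (j + 1), ← ENNReal.ofReal_mul (by positivity),
          ← ENNReal.ofReal_mul (by have : (0:ℝ) ≤ 1 - q := by linarith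
                                   positivity)]
        congr 1; push_cast; ring
      · intro j
        have : (0:ℝ) ≤ 1 - q := by linarith
        positivity
    rw [h1, h2]; ring
  · intro z hz; rw [if_neg (by omega)]
  · intro z hz; rw [Nat.sub_eq_zero_of_le (by omega)]; simp

lemma expect_geo_add_one {q : unitInterval} (hq : 0 < q) :
    expect (geo q) (fun z => ((z + 1 : ℕ) : ℝ≥0∞)) = ENNReal.ofReal (1 / q) := by
  have h := expect_geo_sub hq 0
  simpa [expect_const] using h

/-! ### Correcting decoding errors -/

/-- The bits that tell a receiver with the estimate `v` the messages `w`: for each entry one bit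
says whether the estimate is right, and if not the message follows. -/
def correction {M : ℕ} (bits : Fin M → List Bool) : List (Fin M) → List (Fin M) → List Bool
  | v :: vs, w :: ws =>
    if v = w then false :: correction bits vs ws else true :: (bits w ++ correction bits vs ws)
  | _, _ => []

lemma correction_unique {M L : ℕ} {bits : Fin M → List Bool} (hL : ∀ w, (bits w).length = L)
    (hinj : Function.Injective bits) {vs ws ws' : List (Fin M)} {a : List Bool}
    (h1 : ws.length = vs.length) (h2 : ws'.length = vs.length)
    (h : correction bits vs ws <+: a) (h' : correction bits vs ws' <+: a) : ws = ws' := by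
  induction vs generalizing ws ws' a with
  | nil =>
    rw [List.eq_nil_of_length_eq_zero h1, List.eq_nil_of_length_eq_zero h2]
  | cons v vs ih =>
    cases ws with
    | nil => simp at h1
    | cons w ws =>
      cases ws' with
      | nil => simp at h2
      | cons w' ws' =>
        simp only [List.length_cons, Nat.add_right_cancel_iff] at h1 h2
        simp only [correction] at h h'
        obtain ⟨b, hb⟩ := h
        obtain ⟨b', hb'⟩ := h'
        subst hb
        split_ifs at hb' with e e' e'
        · simp only [List.cons_append, List.cons.injEq, true_and] at hb'
          rw [← e, ← e', ih h1 h2 (List.prefix_append _ _) ⟨_, hb'⟩]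
        · simp at hb'
        · simp at hb'
        · simp only [List.cons_append, List.cons.injEq, true_and, List.append_assoc] at hb'
          obtain ⟨hbits, hrest⟩ := List.append_inj hb' (by rw [hL, hL])
          rw [hinj hbits, ih h1 h2 (List.prefix_append _ _) ⟨_, hrest⟩]

lemma length_correction {M L : ℕ} {bits : Fin M → List Bool} (hL : ∀ w, (bits w).length = L)
    {β : Type} (bl : List (Fin M × β)) (e : Fin M × β → Fin M) :
    (correction bits (bl.map e) (bl.map Prod.fst)).length =
      bl.length + L * (bl.map fun b => if e b ≠ b.1 then 1 else 0).sum := by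
  induction bl with
  | nil => rfl
  | cons b bl ih =>
    simp only [List.map_cons, correction, List.sum_cons, List.length_cons]
    split_ifs with h1 h2
    · exact absurd h1 h2
    · simp [ih]; omega
    · simp [ih, hL, mul_add]; omega

/-- The encoding rule that makes the parities of the successive output times equal to the given
bits. -/
def parityRule (a : List Bool) : List ℕ → ℕ
  | [] => 1
  | z :: l => if (z + 1) % 2 = (a.getD l.length false).toNat then 1 else 2

lemma parityRule_pos (a : List Bool) (l : List ℕ) : 1 ≤ parityRule a l := by
  cases l with
  | nil => exact le_rfl
  | cons z l => rw [parityRule]; split_ifs <;> norm_num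

lemma sum_times_parityRule (a : List Bool) (l : List ℕ) :
    (times (parityRule a) l).sum ≤ (l.map fun z => z + 2).sum := by
  induction l with
  | nil => exact le_rfl
  | cons z l ih =>
    simp only [times, List.sum_cons, List.map_cons]
    have : parityRule a (z :: l) ≤ 2 := by rw [parityRule]; split_ifs <;> norm_num
    omega

/-- The receiver's reading of the parities, in the order of transmission. -/
def parities (ts : List ℕ) : List Bool := (ts.map fun t => decide (t % 2 = 1)).reverse

lemma prefix_parities {a : List Bool} {l : List ℕ} (h : a.length ≤ l.length) :
    a <+: parities (times (parityRule a) l) := by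
  have key : parities (times (parityRule a) l) =
      (List.range l.length).map fun j => a.getD j false := by
    clear h
    induction l with
    | nil => rfl
    | cons z l ih =>
      rw [List.length_cons, List.range_succ, List.map_append, ← ih, times, parities,
        List.map_cons, List.reverse_cons, parities]
      congr 1
      simp only [List.map_cons, List.map_nil, parityRule]
      congr 1
      have hpar : ∀ b : Bool, decide (((if (z + 1) % 2 = b.toNat then 1 else 2) + z) % 2 = 1) = b := by
        intro b
        cases b <;> split_ifs with h1 <;> simp at h1 ⊢ <;> omega
      exact hpar _
  rw [key, List.prefix_iff_eq_take]
  apply List.ext_getElem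
  · simp [h]
  · intro i h1 h2
    simp [List.getD_eq_getElem?_getD, h1]

/-- The receiver's estimates of the messages, block by block. -/
def blockDecode {α W : Type} (k : ℕ) (d : List α → W) : ℕ → List α → List W
  | 0, _ => []
  | B + 1, ts => d (ts.take k) :: blockDecode k d B (ts.drop k)

lemma length_blockDecode {α W : Type} (k : ℕ) (d : List α → W) (B : ℕ) (ts : List α) :
    (blockDecode k d B ts).length = B := by
  induction B generalizing ts with
  | zero => rfl
  | succ B ih => simp [blockDecode, ih]

lemma times_blocks {M k : ℕ} (r : Fin M → List ℕ → ℕ) (bl : List (Fin M × List ℕ))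
    (hbl : ∀ b ∈ bl, b.2.length = k) :
    (bl.map Prod.snd).flatten.length = bl.length * k ∧
    times (blocks k r 1 (bl.map Prod.fst)) (bl.map Prod.snd).flatten =
      (bl.map fun b => times (r b.1) b.2).flatten := by
  induction bl with
  | nil => exact ⟨by simp, rfl⟩
  | cons b bl ih =>
    simp only [List.mem_cons, forall_eq_or_imp] at hbl
    obtain ⟨h1, h2⟩ := ih hbl.2
    simp only [List.map_cons, List.flatten_cons]
    refine ⟨by rw [List.length_append, h1, hbl.1, List.length_cons]; ring, ?_⟩
    rw [blocks, times_andThen _ _ _ (by simpa using h1), h2]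

lemma blockDecode_flatten {α β W : Type} {k : ℕ} (d : List α → W) (f : β → List α)
    (bl : List β) (hbl : ∀ b ∈ bl, (f b).length = k) :
    blockDecode k d bl.length (bl.map f).flatten = bl.map fun b => d (f b) := by
  induction bl with
  | nil => rfl
  | cons b bl ih =>
    simp only [List.mem_cons, forall_eq_or_imp] at hbl
    simp only [List.map_cons, List.flatten_cons, List.length_cons, blockDecode]
    rw [List.take_left' hbl.1, List.drop_left' hbl.1, ih hbl.2]

lemma blocks_pos {M k : ℕ} {r : Fin M → List ℕ → ℕ} (hr : ∀ w l, 1 ≤ r w l) (ws : List (Fin M))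
    (l : List ℕ) : 1 ≤ blocks k r 1 ws l := by
  induction ws with
  | nil => exact le_rfl
  | cons w ws ih =>
    rw [blocks, andThen]
    split_ifs
    · exact ih
    · exact hr _ _

/-! ### Repetition of a timing code with corrections -/

lemma mem_support_of_mem_iidList {α : Type} {p : PMF α} {m : ℕ} {l : List α}
    (h : l ∈ (iidList p m).support) : ∀ a ∈ l, a ∈ p.support := by
  induction m generalizing l with
  | zero => simp [iidList] at h; simp [h]
  | succ m ih =>
    simp only [iidList, PMF.mem_support_bind_iff, PMF.mem_support_map_iff] at h
    obtain ⟨l', hl', a, ha, rfl⟩ := h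
    simp only [List.mem_cons, forall_eq_or_imp]
    exact ⟨ha, ih hl'⟩

lemma mem_support_blockLaw {α W : Type} {u : PMF W} {K : W → PMF (List α)} {b : W × List α}
    (h : b ∈ (blockLaw u K).support) : b.2 ∈ (K b.1).support := by
  simp only [blockLaw, PMF.mem_support_bind_iff, PMF.mem_support_map_iff] at h
  obtain ⟨w, -, l, hl, rfl⟩ := h
  exact hl

lemma ext_of_expect {α : Type} {p p' : PMF α} (h : ∀ F, expect p F = expect p' F) : p = p' := by
  ext a
  rw [← PMF.toOuterMeasure_apply_singleton, ← PMF.toOuterMeasure_apply_singleton,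
    toOuterMeasure_eq_expect, toOuterMeasure_eq_expect, h]

lemma iidList_add {α : Type} (p : PMF α) (j k : ℕ) :
    iidList p (j + k) = (iidList p k).bind fun l₀ => (iidList p j).map fun l => l ++ l₀ :=
  ext_of_expect fun F => by simp only [expect_iidList_add, expect_bind, expect_map]

/-- The bound on the failure probability for a random message that is behind both simulations:
the average over messages of the probability of an event on sequences is bounded by the
probability of an event on independent blocks. -/
lemma expect_blocks_le {α W : Type} (u : PMF W) (K : W → PMF (List α)) (L : List W → PMF (List α))
    (h0 : L [] = PMF.pure [])
    (hL : ∀ w ws, L (w :: ws) = (L ws).bind fun l₀ => (K w).map fun l => l ++ l₀)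
    (B : ℕ) (S : List W → Set (List α)) (T : Set (List (W × List α)))
    (hST : ∀ bl : List (W × List α), bl.length = B → (∀ b ∈ bl, b.2 ∈ (K b.1).support) →
      (bl.map Prod.snd).flatten ∈ S (bl.map Prod.fst) → bl ∈ T) :
    expect (iidList u B) (fun ws => (L ws).toOuterMeasure (S ws)) ≤
      (iidList (blockLaw u K) B).toOuterMeasure T := by
  simp only [toOuterMeasure_eq_expect]
  rw [expect_blocks u K L h0 hL B fun ws => (S ws).indicator fun _ => 1]
  refine expect_mono_of_support fun bl hbl => ?_
  by_cases h : (bl.map Prod.snd).flatten ∈ S (bl.map Prod.fst)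
  · rw [Set.indicator_of_mem h, Set.indicator_of_mem (hST bl (length_of_mem_support_iidList hbl)
      (fun b hb => mem_support_blockLaw (mem_support_of_mem_iidList hbl b hb)) h)]
  · rw [Set.indicator_of_notMem h]; exact zero_le

section Amplify

variable {m₀ M L : ℕ} [NeZero M] (r : Fin M → List ℕ → ℕ) (d : List ℕ → Fin M)
  (bits : Fin M → List Bool)

/-- The rule that serves the messages `ws` in `B` blocks and then transmits, through the parities
of the output times, the correction of the receiver's estimates. -/
def correctedRule (m₀ B : ℕ) (ws : List (Fin M)) : List ℕ → ℕ :=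
  andThen (B * m₀) (blocks m₀ r 1 ws) fun l l₀ =>
    parityRule (correction bits (blockDecode m₀ d B (times (blocks m₀ r 1 ws) l₀)) ws) l

open Classical in
/-- The decoder that corrects its estimates with the help of the last `k` output times. -/
noncomputable def correctedDecode (m₀ B k : ℕ) (ts : List ℕ) : Fin B → Fin M :=
  if h : ∃ w : Fin B → Fin M,
    correction bits (blockDecode m₀ d B (ts.drop k)) (revList w) <+: parities (ts.take k)
  then h.choose else Classical.arbitrary _

variable {r bits}

lemma correctedDecode_eq (hL : ∀ w, (bits w).length = L) (hinj : Function.Injective bits)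
    {B k : ℕ} (w : Fin B → Fin M) {l₁ l₂ : List ℕ} (h1 : l₁.length = B * m₀) (h2 : l₂.length = k)
    (hk : (correction bits (blockDecode m₀ d B (times (blocks m₀ r 1 (revList w)) l₁))
      (revList w)).length ≤ k) :
    correctedDecode d bits m₀ B k (times (correctedRule r d bits m₀ B (revList w)) (l₂ ++ l₁))
      = w := by
  rw [correctedRule, times_andThen _ _ _ h1, correctedDecode]
  have hlen : ∀ r', (times r' l₂).length = k := fun r' => by rw [length_times, h2]
  rw [List.drop_left' (hlen _), List.take_left' (hlen _)]
  have hex : ∃ w' : Fin B → Fin M,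
      correction bits (blockDecode m₀ d B (times (blocks m₀ r 1 (revList w)) l₁)) (revList w') <+:
        parities (times (parityRule (correction bits (blockDecode m₀ d B
          (times (blocks m₀ r 1 (revList w)) l₁)) (revList w))) l₂) :=
    ⟨w, prefix_parities (by rw [h2]; exact hk)⟩
  rw [dif_pos hex]
  refine revList_injective (correction_unique hL hinj ?_ ?_ hex.choose_spec
    (prefix_parities (by rw [h2]; exact hk)))
  · rw [length_revList, length_blockDecode]
  · rw [length_revList, length_blockDecode]

/-- Many repetitions of a timing code, followed by the correction of the few blocks in error, fit
with high probability into a number of slots a little above the expected time. -/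
lemma eventually_exists_code {q : unitInterval} (hq : 0 < q) (hr : ∀ w l, 1 ≤ r w l)
    (hL : ∀ w, (bits w).length = L) (hinj : Function.Injective bits) {θ₁ θ₂ φ : ℝ} {ρ : ℕ}
    (hθ₁ : expect (unif (Fin M)) (fun w => expect (iidList (geo q) m₀) fun l =>
      ((times (r w) l).sum : ℝ≥0∞)) < ENNReal.ofReal θ₁)
    (hθ₂ : 1 / q + 1 < θ₂)
    (hφ : expect (unif (Fin M)) (fun w =>
      (iidList (geo q) m₀).toOuterMeasure {l | d (times (r w) l) ≠ w}) < ENNReal.ofReal φ)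
    (hρ : 1 + φ * L ≤ ρ) {ε : ℝ} (hε : 0 < ε) :
    ∀ᶠ B : ℕ in atTop, ∀ n : ℕ, B * (θ₁ + ρ * θ₂) ≤ n →
      ∃ c : Code n (M ^ B), c.errorProb q ≤ ε := by
  classical
  have hq0 : (0 : ℝ) < q := hq
  have hφ0 : 0 < φ := by
    by_contra! h; rw [ENNReal.ofReal_of_nonpos h] at hφ; exact not_lt_zero hφ
  have hρ1 : 1 ≤ ρ := by
    have : (1 : ℝ) ≤ ρ := le_trans (by nlinarith [(Nat.cast_nonneg L : (0 : ℝ) ≤ L)]) hρ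
    exact_mod_cast this
  set u := unif (Fin M)
  set K : Fin M → PMF (List ℕ) := fun _ => iidList (geo q) m₀ with hK
  set p := blockLaw u K with hp
  -- the three typical events
  have t1 := tendsto_iidList_sum_gt p (fun b => (times (r b.1) b.2).sum) (θ := θ₁) (by
    rw [hp, expect_blockLaw]; exact hθ₁)
  have t2 := tendsto_iidList_sum_gt p (fun b => if d (times (r b.1) b.2) ≠ b.1 then 1 else 0)
    (θ := φ) (by
      refine lt_of_eq_of_lt ?_ hφ
      rw [hp, expect_blockLaw]
      congr 1; ext w
      rw [toOuterMeasure_eq_expect]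
      congr 1; ext l
      by_cases h : d (times (r w) l) = w <;> simp [h])
  have t3 := tendsto_iidList_sum_gt (geo q) (fun z => z + 2) (θ := θ₂) (by
    have : ∀ z : ℕ, ((z + 2 : ℕ) : ℝ≥0∞) = ((z + 1 : ℕ) : ℝ≥0∞) + 1 := fun z => by
      push_cast; rw [add_assoc]; norm_num
    simp only [this]
    rw [expect_add, expect_geo_add_one hq, expect_const, ← ENNReal.ofReal_one,
      ← ENNReal.ofReal_add (by positivity) (by norm_num)]
    exact (ENNReal.ofReal_lt_ofReal_iff (lt_trans (by positivity) hθ₂)).2 hθ₂)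
  have t3' := t3.comp (tendsto_atTop_mono (fun B => Nat.le_mul_of_pos_right B hρ1) tendsto_id)
  have tsum := (t1.add t2).add t3'
  rw [add_zero, add_zero] at tsum
  filter_upwards [(ENNReal.tendsto_nhds_zero.1 tsum) (ENNReal.ofReal ε) (ENNReal.ofReal_pos.2 hε)]
    with B hB n hn
  obtain ⟨c, hc⟩ := exists_code_of_timing (W := Fin B → Fin M) hq (B * ρ + B * m₀) n
    (fun w => correctedRule r d bits m₀ B (revList w))
    (fun w l => by
      rw [correctedRule, andThen]
      split_ifs
      · exact blocks_pos hr _ _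
      · exact parityRule_pos _ _)
    (correctedDecode d bits m₀ B (B * ρ))
  have hcard : Fintype.card (Fin B → Fin M) = M ^ B := by simp
  rw [← hcard]
  refine ⟨c, (ENNReal.ofReal_le_ofReal_iff hε.le).1 (hc.trans (le_trans ?_ hB))⟩
  -- failures of the decoder or of the timing, in terms of the blocks and of the parity phase
  set S : List (Fin M) → Set (List ℕ) := fun ws => {l₁ |
    B * ρ < (correction bits (blockDecode m₀ d B (times (blocks m₀ r 1 ws) l₁)) ws).length ∨
      θ₁ * B < ((times (blocks m₀ r 1 ws) l₁).sum : ℝ)} with hS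
  set S₃ : Set (List ℕ) := {l₂ | θ₂ * (B * ρ : ℕ) < ((l₂.map fun z => z + 2).sum : ℕ)} with hS₃
  have hfail : ∀ w : Fin B → Fin M, (iidList (geo q) (B * ρ + B * m₀)).toOuterMeasure
      {l | correctedDecode d bits m₀ B (B * ρ)
        (times (correctedRule r d bits m₀ B (revList w)) l) ≠ w ∨
          n < (times (correctedRule r d bits m₀ B (revList w)) l).sum} ≤
      (iidList (geo q) (B * m₀)).toOuterMeasure (S (revList w)) +
        (iidList (geo q) (B * ρ)).toOuterMeasure S₃ := by
    intro w
    rw [toOuterMeasure_eq_expect, expect_iidList_add, toOuterMeasure_eq_expect,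
      toOuterMeasure_eq_expect, ← expect_const (iidList (geo q) (B * m₀))
        (expect (iidList (geo q) (B * ρ)) _), ← expect_add]
    refine expect_mono_of_support fun l₁ hl₁ => ?_
    rw [← expect_const (iidList (geo q) (B * ρ)) ((S (revList w)).indicator (fun _ => 1) l₁),
      ← expect_add]
    refine expect_mono_of_support fun l₂ hl₂ => ?_
    have hl₁' := length_of_mem_support_iidList hl₁
    have hl₂' := length_of_mem_support_iidList hl₂
    by_cases hS1 : l₁ ∈ S (revList w)
    · rw [Set.indicator_of_mem hS1]
      exact (Set.indicator_le_self' (fun _ _ => zero_le) _).trans le_self_add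
    by_cases hS2 : l₂ ∈ S₃
    · rw [Set.indicator_of_mem hS2]
      exact (Set.indicator_le_self' (fun _ _ => zero_le) _).trans le_add_self
    rw [Set.indicator_of_notMem]
    · exact zero_le
    rintro (h | h)
    · exact h (correctedDecode_eq d hL hinj w hl₁' hl₂' (not_lt.1 fun hh => hS1 (Or.inl hh)))
    · have h1 : ((times (blocks m₀ r 1 (revList w)) l₁).sum : ℝ) ≤ θ₁ * B :=
        not_lt.1 fun hh => hS1 (Or.inr hh)
      have h2 : (((l₂.map fun z => z + 2).sum : ℕ) : ℝ) ≤ θ₂ * (B * ρ : ℕ) := not_lt.1 hS2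
      rw [correctedRule, times_andThen _ _ _ hl₁', List.sum_append] at h
      have h3 := sum_times_parityRule (correction bits
        (blockDecode m₀ d B (times (blocks m₀ r 1 (revList w)) l₁)) (revList w)) l₂
      have h4 : (n : ℝ) < (((l₂.map fun z => z + 2).sum +
          (times (blocks m₀ r 1 (revList w)) l₁).sum : ℕ) : ℝ) :=
        Nat.cast_lt.2 (h.trans_le (Nat.add_le_add_right h3 _))
      rw [Nat.cast_add] at h4
      rw [Nat.cast_mul] at h2
      nlinarith
  refine (expect_mono hfail).trans ?_
  rw [expect_add, expect_const]
  refine add_le_add ?_ ?_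
  · rw [expect_unif_revList B fun ws => (iidList (geo q) (B * m₀)).toOuterMeasure (S ws)]
    rw [expect_congr_of_support (G := fun ws =>
      (iidList (geo q) (ws.length * m₀)).toOuterMeasure (S ws)) fun ws hws => by
        rw [length_of_mem_support_iidList hws]]
    refine (expect_blocks_le u K (fun ws => iidList (geo q) (ws.length * m₀)) (by simp [iidList])
      (fun w ws => by
        rw [List.length_cons, add_mul, one_mul, add_comm, iidList_add]) B S
      ({bl | θ₁ * B < ((bl.map fun b => (times (r b.1) b.2).sum).sum : ℝ)} ∪
        {bl | φ * B < ((bl.map fun b => if d (times (r b.1) b.2) ≠ b.1 then 1 else 0).sum : ℕ)})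
      ?_).trans (measure_union_le _ _)
    intro bl hbl hsupp hmem
    have hlen : ∀ b ∈ bl, b.2.length = m₀ := fun b hb =>
      length_of_mem_support_iidList (hsupp b hb)
    obtain ⟨-, htimes⟩ := times_blocks r bl hlen
    rcases hmem with h | h
    · right
      rw [htimes, ← hbl, blockDecode_flatten d (fun b : Fin M × List ℕ => times (r b.1) b.2) bl
          (fun b hb => by rw [length_times, hlen b hb]),
        length_correction hL bl fun b => d (times (r b.1) b.2)] at h
      change φ * B < _
      by_contra! hcon
      rw [← hbl] at hcon
      set F := (bl.map fun b => if d (times (r b.1) b.2) ≠ b.1 then 1 else 0).sum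
      have h' : ((bl.length * ρ : ℕ) : ℝ) < ((bl.length + L * F : ℕ) : ℝ) := by exact_mod_cast h
      push_cast at h'
      have hL0 : (0 : ℝ) ≤ L := Nat.cast_nonneg L
      have h5 := mul_le_mul_of_nonneg_left hcon hL0
      have h6 := mul_le_mul_of_nonneg_left hρ (Nat.cast_nonneg bl.length : (0 : ℝ) ≤ bl.length)
      nlinarith
    · left
      change θ₁ * B < _
      change θ₁ * B < _ at h
      rw [htimes, List.sum_flatten, List.map_map] at h
      exact h
  · exact le_rfl

end Amplify

/-! ### Achievable rates, from the timing channel to the binary channel -/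

lemma timing_expectedTime_ge {m M : ℕ} [NeZero M] (q : unitInterval) {r : Fin M → List ℕ → ℕ}
    (hr : ∀ w l, 1 ≤ r w l) :
    (m : ℝ≥0∞) ≤ expect (unif (Fin M)) fun w =>
      expect (iidList (geo q) m) fun l => ((times (r w) l).sum : ℝ≥0∞) := by
  rw [← expect_const (unif (Fin M)) (m : ℝ≥0∞)]
  refine expect_mono fun w => ?_
  rw [← expect_const (iidList (geo q) m) (m : ℝ≥0∞)]
  refine expect_mono_of_support fun l hl => ?_
  have h : (times (r w) l).length ≤ (times (r w) l).sum :=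
    List.length_le_sum_of_one_le _ (times_pos (hr w) l)
  rw [length_times, length_of_mem_support_iidList hl] at h
  exact_mod_cast h

lemma exists_bits (M : ℕ) : ∃ bits : Fin M → List Bool,
    (∀ w, (bits w).length = Nat.clog 2 M) ∧ Function.Injective bits := by
  have hcard : Fintype.card (Fin M) ≤ Fintype.card (Fin (Nat.clog 2 M) → Bool) := by
    simp [Nat.le_pow_clog one_lt_two M]
  obtain ⟨f⟩ := Function.Embedding.nonempty_of_card_le hcard
  exact ⟨fun w => revList (f w), fun w => length_revList _,
    fun w w' h => f.injective (revList_injective h)⟩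

lemma clog_le_logb {M : ℕ} (hM : 0 < M) : (Nat.clog 2 M : ℝ) ≤ Real.logb 2 M + 1 := by
  rcases Nat.lt_or_ge 1 M with h | h
  · have h1 : Nat.clog 2 M - 1 < Nat.clog 2 M :=
      Nat.sub_lt (Nat.clog_pos one_lt_two h) one_pos
    have h2 : 2 ^ (Nat.clog 2 M - 1) < M := (Nat.lt_clog_iff_pow_lt one_lt_two).1 h1
    have h3 : ((Nat.clog 2 M - 1 : ℕ) : ℝ) ≤ Real.logb 2 M := by
      rw [Real.le_logb_iff_rpow_le one_lt_two (by exact_mod_cast hM), Real.rpow_natCast]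
      exact_mod_cast h2.le
    rw [Nat.cast_sub (Nat.clog_pos one_lt_two h)] at h3
    push_cast at h3
    linarith
  · have : M = 1 := by omega
    subst this; simp

lemma achievable_of_nonpos (q : unitInterval) {R : ℝ} (hR : R ≤ 0) : Achievable q R := by
  intro ε hε
  refine Eventually.of_forall fun n => ⟨1, one_pos,
    ⟨fun _ _ => false, fun _ _ => rfl, fun _ => 0⟩, ?_, ?_⟩
  · simpa using mul_nonpos_of_nonpos_of_nonneg hR (Nat.cast_nonneg n)
  · refine le_trans (le_of_eq ?_) hε.le
    simp [Code.errorProb]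

lemma timingAchievable_of_nonpos (q : unitInterval) {R : ℝ} (hR : R ≤ 0) :
    TimingAchievable q R := by
  intro ε hε
  refine Eventually.of_forall fun n => ⟨1, one_pos,
    ⟨fun _ _ _ => 1, fun _ _ _ => le_rfl, fun _ => 0⟩, ?_, ?_⟩
  · simp [ENNReal.ofReal_of_nonpos hR]
  · refine le_trans (le_of_eq ?_) hε.le
    simp [TimingCode.errorProb]

/-- A timing code of error probability `φ / 2` is repeated in `B` blocks; the corrections take
`B * ρ` further pulses, where `ρ` is small in comparison with the number of bits per block. -/
lemma achievable_of_timingAchievable {q : unitInterval} (hq : 0 < q) {R R' : ℝ}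
    (hR : TimingAchievable q R) (hR' : 0 < R') (hRR : R' < R) : Achievable q R' := by
  have hq0 : (0 : ℝ) < q := hq
  have hR0 : 0 < R := hR'.trans hRR
  -- the loss in rate, and the parameters that keep it in bounds
  set κ : ℝ := 1 - R' / R with hκ
  have hκ0 : 0 < κ := by rw [hκ, sub_pos, div_lt_one hR0]; exact hRR
  have hκ1 : κ < 1 := by rw [hκ]; have : 0 < R' / R := by positivity
                         linarith
  set θ₂ : ℝ := 1 / q + 2 with hθ₂
  have hθ₂0 : 0 < θ₂ := by positivity
  set φ : ℝ := κ / (4 * R' * θ₂) with hφ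
  have hφ0 : 0 < φ := by positivity
  set c₁ : ℝ := 1 + θ₂ * (2 + φ) with hc₁
  have hc₁0 : 0 < c₁ := by positivity
  intro ε hε
  have hev := hR (φ / 2) (by positivity)
  obtain ⟨m₀, ⟨M, hM, c, hrate, herr⟩, hm₀⟩ :=
    (hev.and (eventually_gt_atTop ⌈4 * R' * c₁ / (κ * R)⌉₊)).exists
  have : NeZero M := ⟨hM.ne'⟩
  have hm₀' : 4 * R' * c₁ / (κ * R) < m₀ := (Nat.le_ceil _).trans_lt (by exact_mod_cast hm₀)
  obtain ⟨r, d, hr, he, ht⟩ := c.exists_rule q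
  obtain ⟨bits, hL, hinj⟩ := exists_bits M
  have hlog0 : 0 ≤ Real.logb 2 M := Real.logb_nonneg one_lt_two (by exact_mod_cast hM)
  set ℓ := Real.logb 2 M with hℓ
  have hTtop : c.expectedTime q ≠ ∞ := by
    intro htop
    rw [htop, ENNReal.mul_top (by simpa using hR0)] at hrate
    exact absurd hrate (by simp)
  set τ := (c.expectedTime q).toReal with hτ
  have hτe : c.expectedTime q = ENNReal.ofReal τ := (ENNReal.ofReal_toReal hTtop).symm
  have hτm : (m₀ : ℝ) ≤ τ := by
    have := timing_expectedTime_ge (m := m₀) q hr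
    rw [← ht, hτe, ← ENNReal.ofReal_natCast, ENNReal.ofReal_le_ofReal_iff ENNReal.toReal_nonneg]
      at this
    exact this
  have hRτ : R * τ ≤ ℓ := by
    rw [hτe, ← ENNReal.ofReal_mul hR0.le, ENNReal.ofReal_le_ofReal_iff hlog0] at hrate
    exact hrate
  set L := Nat.clog 2 M with hLdef
  have hLℓ : (L : ℝ) ≤ ℓ + 1 := clog_le_logb hM
  set ρ := ⌈1 + φ * L⌉₊ with hρ
  have hρ1 : 1 + φ * L ≤ ρ := Nat.le_ceil _
  have hρ2 : (ρ : ℝ) ≤ 2 + φ + φ * ℓ := by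
    have h1 := (Nat.ceil_lt_add_one (by positivity : (0 : ℝ) ≤ 1 + φ * L)).le
    have h2 := mul_le_mul_of_nonneg_left hLℓ hφ0.le
    rw [← hρ] at h1
    linarith
  set θ : ℝ := (τ + 1) + ρ * θ₂ with hθ
  have hm₀0 : (0 : ℝ) ≤ m₀ := Nat.cast_nonneg _
  have hθ0 : 0 < θ := by positivity
  have hθle : R' * θ < ℓ := by
    have h1 : θ ≤ τ + c₁ + θ₂ * φ * ℓ := by
      have := mul_le_mul_of_nonneg_right hρ2 hθ₂0.le
      rw [hθ, hc₁]; linarith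
    have h2 : R' * τ ≤ (1 - κ) * ℓ := by
      have : R' = (1 - κ) * R := by rw [hκ]; field_simp; ring
      rw [this, mul_assoc]
      exact mul_le_mul_of_nonneg_left hRτ (by linarith)
    have h3 : R' * (θ₂ * φ * ℓ) = κ / 4 * ℓ := by rw [hφ]; field_simp
    have h4 : R' * c₁ < κ / 4 * ℓ := by
      rw [div_lt_iff₀ (by positivity)] at hm₀'
      have h5 : R * m₀ ≤ ℓ := (mul_le_mul_of_nonneg_left hτm hR0.le).trans hRτ
      have h6 := mul_le_mul_of_nonneg_left h5 hκ0.le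
      linarith
    have h7 : 0 < ℓ := by
      by_contra! h
      have : κ / 4 * ℓ ≤ 0 := mul_nonpos_of_nonneg_of_nonpos (by positivity) h
      have : 0 < R' * c₁ := by positivity
      linarith
    have h8 : R' * θ ≤ R' * (τ + c₁ + θ₂ * φ * ℓ) := mul_le_mul_of_nonneg_left h1 hR'.le
    have : 0 < κ * ℓ := by positivity
    linarith
  have hcode := eventually_exists_code d hq hr hL hinj (θ₁ := τ + 1) (θ₂ := θ₂) (φ := φ) (ρ := ρ)
    (by rw [← ht, hτe]; exact (ENNReal.ofReal_lt_ofReal_iff (by positivity)).2 (by linarith))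
    (by rw [hθ₂]; linarith)
    (by
      rw [← he]
      refine (ENNReal.ofReal_lt_ofReal_iff hφ0).2 (by linarith)) hρ1 hε
  have hBlim : Tendsto (fun n : ℕ => ⌊(n : ℝ) / θ⌋₊) atTop atTop :=
    tendsto_nat_floor_atTop.comp (tendsto_natCast_atTop_atTop.atTop_div_const hθ0)
  have hslack : 0 < ℓ / θ - R' := by rw [sub_pos, lt_div_iff₀ hθ0]; exact hθle
  filter_upwards [hBlim.eventually hcode, eventually_ge_atTop ⌈ℓ / (ℓ / θ - R')⌉₊] with n hn hn2
  obtain ⟨c', hc'⟩ := hn n (by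
    have := Nat.floor_le (by positivity : (0 : ℝ) ≤ n / θ)
    rw [le_div_iff₀ hθ0] at this
    exact this)
  refine ⟨M ^ ⌊(n : ℝ) / θ⌋₊, by positivity, c', ?_, hc'⟩
  have h1 : ℓ / (ℓ / θ - R') ≤ n := (Nat.le_ceil _).trans (by exact_mod_cast hn2)
  rw [div_le_iff₀ hslack] at h1
  push_cast
  rw [Real.logb_pow, ← hℓ]
  have h2 := (Nat.lt_floor_add_one ((n : ℝ) / θ)).le
  have h3 := mul_le_mul_of_nonneg_right h2 hlog0
  have h4 : (n : ℝ) / θ * ℓ = n * (ℓ / θ) := by ring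
  rw [h4] at h3
  linarith

lemma le_of_forall_pos_lt {R : ℝ} {C : EReal} (h0 : 0 ≤ C)
    (h : ∀ R' : ℝ, 0 < R' → R' < R → (R' : EReal) ≤ C) : (R : EReal) ≤ C := by
  refine le_of_forall_lt fun a ha => ?_
  obtain ⟨b, hab, hbR⟩ := EReal.lt_iff_exists_real_btwn.1 ha
  rcases le_or_gt b 0 with hb | hb
  · exact (hab.trans_le (by exact_mod_cast hb)).trans_le h0
  · exact hab.trans_le (h b hb (by exact_mod_cast hbR))

lemma capacity_nonneg (q : unitInterval) : 0 ≤ capacity q :=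
  le_iSup₂_of_le (0 : ℝ) (achievable_of_nonpos q le_rfl) (by simp)

lemma timingCapacity_nonneg (q : unitInterval) : 0 ≤ timingCapacity q :=
  le_iSup₂_of_le (0 : ℝ) (timingAchievable_of_nonpos q le_rfl) (by simp)

theorem timingCapacity_le_capacity {q : unitInterval} (hq : 0 < q) :
    timingCapacity q ≤ capacity q :=
  iSup₂_le fun _ hR => le_of_forall_pos_lt (capacity_nonneg q) fun R' h0 hlt =>
    le_iSup₂_of_le R' (achievable_of_timingAchievable hq hR h0 hlt) le_rfl

/-! ### Realizing a code for the binary channel over the timing channel -/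

/-- Use the strategy `x` for `n` slots, and afterwards send a pulse whenever possible. -/
def thenPulse (n : ℕ) (x : List Bool → Bool) (h : List Bool) : Bool :=
  if h.length ≤ n then x h else h.headD false

lemma thenPulse_empty {n : ℕ} {x : List Bool → Bool} (hx : ∀ h, x (false :: h) = false)
    (h : List Bool) : thenPulse n x (false :: h) = false := by
  rw [thenPulse]; split_ifs <;> simp [hx]

lemma thenPulse_of_le {n : ℕ} (x : List Bool → Bool) {h : List Bool} (hh : h.length ≤ n) :
    thenPulse n x h = x h := if_pos hh

/-- The number of slots that the strategy `x` waits with a full battery, after the history `h`,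
up to and including the slot of the pulse. -/
noncomputable def waitTime (x : List Bool → Bool) (h : List Bool) : ℕ :=
  sInf {j | 1 ≤ j ∧ x (List.replicate j true ++ h) = true}

/-- The battery states under the strategy `x` when the idle times are `l`. -/
noncomputable def waitTrain (x : List Bool → Bool) : List ℕ → List Bool
  | [] => []
  | z :: l => List.replicate (waitTime x (List.replicate z false ++ waitTrain x l)) true ++
      (List.replicate z false ++ waitTrain x l)

/-- The rule for the timing channel that corresponds to the strategy `x`. -/
noncomputable def waitRule (x : List Bool → Bool) : List ℕ → ℕ
  | [] => 1
  | z :: l => waitTime x (List.replicate z false ++ waitTrain x l)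

lemma stateTrain_waitRule (x : List Bool → Bool) (l : List ℕ) :
    stateTrain (waitRule x) l = waitTrain x l := by
  induction l with
  | nil => rfl
  | cons z l ih => rw [stateTrain, waitTrain, waitRule, ih]

lemma waitTime_thenPulse (n : ℕ) (x : List Bool → Bool) (h : List Bool) :
    (1 ≤ waitTime (thenPulse n x) h ∧
      thenPulse n x (List.replicate (waitTime (thenPulse n x) h) true ++ h) = true) ∧
    waitTime (thenPulse n x) h ≤ max 1 (n + 1 - h.length) := by
  have hmem : max 1 (n + 1 - h.length) ∈
      {j | 1 ≤ j ∧ thenPulse n x (List.replicate j true ++ h) = true} := by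
    refine ⟨le_max_left _ _, ?_⟩
    obtain ⟨v, hv⟩ : ∃ v, max 1 (n + 1 - h.length) = v + 1 :=
      ⟨max 1 (n + 1 - h.length) - 1, by omega⟩
    rw [thenPulse, if_neg, hv]
    · simp [List.replicate_succ]
    · rw [List.length_append, List.length_replicate]; omega
  exact ⟨Nat.sInf_mem ⟨_, hmem⟩, Nat.sInf_le hmem⟩

lemma follows_waitRule (n : ℕ) {x : List Bool → Bool} (hx : ∀ h, x (false :: h) = false) :
    Follows (thenPulse n x) (waitRule (thenPulse n x)) where
  pos l := by
    cases l with
    | nil => exact le_rfl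
    | cons z l => exact (waitTime_thenPulse n x _).1.1
  empty := thenPulse_empty hx
  on z l j hj hjr := by
    rw [stateTrain_waitRule, waitRule] at *
    rcases hjr.lt_or_eq with h | h
    · rw [decide_eq_false h.ne]
      have := Nat.notMem_of_lt_sInf h
      by_contra hcon
      exact this ⟨hj, by simpa using hcon⟩
    · rw [decide_eq_true h, h]
      exact (waitTime_thenPulse n x _).1.2

/-- The first `n` entries of a list with newest entry first. -/
def oldest {α : Type} (n : ℕ) (y : List α) : List α := y.drop (y.length - n)

lemma oldest_of_le {α : Type} {n : ℕ} {y : List α} (h : y.length ≤ n) : oldest n y = y := by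
  rw [oldest, Nat.sub_eq_zero_of_le h, List.drop_zero]

lemma oldest_append {α : Type} {n : ℕ} (a : List α) {y : List α} (h : n ≤ y.length) :
    oldest n (a ++ y) = oldest n y := by
  rw [oldest, oldest, List.length_append, Nat.add_sub_assoc h, List.drop_append]
  simp

lemma count_oldest_replicate (n k : ℕ) (y : List Bool) :
    (oldest n (List.replicate k false ++ y)).count true = (oldest n y).count true := by
  induction k with
  | zero => rfl
  | succ k ih =>
    rw [List.replicate_succ, List.cons_append]
    rcases le_or_gt (List.replicate k false ++ y).length n with h | h
    · rw [← ih, oldest_of_le h]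
      rcases h.lt_or_eq with h' | h'
      · rw [oldest_of_le (by simpa using h')]; simp
      · rw [← List.singleton_append, oldest_append _ h'.ge, oldest_of_le h]
    · rw [← ih, ← List.singleton_append, oldest_append _ h.le]

/-- The number of pulses for which the energy arrives after the first `n` slots and the next
one. -/
def late (n : ℕ) (r : List ℕ → ℕ) : List ℕ → ℕ
  | [] => 0
  | z :: l => late n r l + if n < (times r l).sum + z then 1 else 0

lemma late_add_count_le (n : ℕ) {r : List ℕ → ℕ} (hr : ∀ l, 1 ≤ r l) (l : List ℕ) :
    late n r l + (oldest n (train (times r l))).count true ≤ l.length := by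
  induction l with
  | nil => simp [late, times, train, oldest]
  | cons z l ih =>
    have hlen := length_train (times_pos hr l)
    have hlen' := length_train (times_pos hr (z :: l))
    have hpos := hr (z :: l)
    rw [times, List.sum_cons] at hlen'
    rw [late, times, List.length_cons]
    rcases le_or_gt (r (z :: l) + z + (times r l).sum) n with h | h
    · rw [if_neg (by omega), oldest_of_le (by omega), count_train]
      rw [oldest_of_le (by omega), count_train] at ih
      simp only [List.length_cons, length_times] at ih ⊢
      omega
    · have hc : (oldest n (train ((r (z :: l) + z) :: times r l))).count true =
          (oldest n (train (times r l))).count true := by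
        rw [train] at hlen' ⊢
        rw [List.length_cons] at hlen'
        rw [← List.singleton_append, oldest_append _ (by omega), count_oldest_replicate]
      rw [hc]
      split_ifs <;> omega

lemma late_le_length (n : ℕ) {r : List ℕ → ℕ} (hr : ∀ l, 1 ≤ r l) (l : List ℕ) :
    late n r l ≤ l.length := le_trans (Nat.le_add_right _ _) (late_add_count_le n hr l)

/-- After the slot `n + 1` each pulse takes the mean harvesting time, by the lack of memory of the
geometric distribution. -/
lemma expect_time_le {q : unitInterval} (hq : 0 < q) {n : ℕ} {r : List ℕ → ℕ}
    (hr : ∀ z l, r (z :: l) ≤ max 1 (n + 1 - (z + (times r l).sum))) (m : ℕ) :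
    expect (iidList (geo q) m) (fun l => ((times r l).sum : ℝ≥0∞)) ≤
      (n + 1 : ℕ) + ENNReal.ofReal (1 / q) *
        expect (iidList (geo q) m) fun l => (late n r l : ℝ≥0∞) := by
  have key : expect (iidList (geo q) m) (fun l => ((max (n + 1) (times r l).sum : ℕ) : ℝ≥0∞)) ≤
      (n + 1 : ℕ) + ENNReal.ofReal (1 / q) *
        expect (iidList (geo q) m) fun l => (late n r l : ℝ≥0∞) := by
    induction m with
    | zero => simp [iidList, expect_pure, times]
    | succ m ih =>
      rw [expect_iidList_succ, expect_iidList_succ]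
      have h1 : ∀ l, expect (geo q) (fun z => ((max (n + 1) (times r (z :: l)).sum : ℕ) : ℝ≥0∞)) ≤
          ((max (n + 1) (times r l).sum : ℕ) : ℝ≥0∞) + ENNReal.ofReal (1 / q) *
            expect (geo q) fun z => if n + 1 - (times r l).sum ≤ z then 1 else 0 := by
        intro l
        rw [← expect_geo_sub hq, ← expect_const (geo q)
          ((max (n + 1) (times r l).sum : ℕ) : ℝ≥0∞), ← expect_add]
        refine expect_mono fun z => ?_
        rw [← Nat.cast_add, Nat.cast_le, times, List.sum_cons]
        have := hr z l
        omega
      have h2 : ∀ l, expect (geo q) (fun z => (late n r (z :: l) : ℝ≥0∞)) =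
          (late n r l : ℝ≥0∞) + expect (geo q) fun z =>
            if n + 1 - (times r l).sum ≤ z then 1 else 0 := by
        intro l
        rw [← expect_const (geo q) (late n r l : ℝ≥0∞), ← expect_add]
        congr 1; ext z
        rw [late, Nat.cast_add]
        congr 1
        by_cases h : n < (times r l).sum + z
        · rw [if_pos h, if_pos (by omega), Nat.cast_one]
        · rw [if_neg h, if_neg (by omega), Nat.cast_zero]
      simp only [h2]
      refine (expect_mono h1).trans ?_
      rw [expect_add, expect_add, expect_const_mul, mul_add, ← add_assoc]
      gcongr
  refine le_trans (expect_mono fun l => ?_) key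
  exact_mod_cast le_max_right _ _

lemma stateLaw_congr (q : unitInterval) {x x' : List Bool → Bool} {n : ℕ}
    (h : ∀ g : List Bool, g.length ≤ n → x g = x' g) : stateLaw q x n = stateLaw q x' n := by
  induction n with
  | zero => rfl
  | succ n ih =>
    refine ext_of_expect fun F => ?_
    rw [stateLaw, stateLaw, expect_bind, expect_bind, ih fun g hg => h g (by omega)]
    refine expect_congr_of_support fun g hg => ?_
    have := length_of_mem_support_stateLaw hg
    rw [nextState, nextState, h g (by omega)]

lemma outputs_congr {x x' : List Bool → Bool} {n : ℕ}
    (h : ∀ g : List Bool, g.length ≤ n → x g = x' g) {g : List Bool} (hg : g.length ≤ n) :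
    outputs x g = outputs x' g := by
  induction g with
  | nil => rfl
  | cons s g ih =>
    rw [outputs, outputs, h _ hg, ih (by simp at hg; omega)]

/-- An event for the idle times is at most as likely as an event for the first `n` battery states
that it implies. -/
lemma toOuterMeasure_le_stateLaw {q : unitInterval} (hq : 0 < q) {x : List Bool → Bool}
    (hx : ∀ h, x (false :: h) = false) (n m : ℕ) (A : Set (List ℕ)) (S : Set (List Bool))
    (hAS : ∀ l ∈ A, l.length = m → ∀ g : List Bool,
      stateTrain (waitRule (thenPulse n x)) l <:+ g → n ≤ g.length → oldest n g ∈ S) :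
    (iidList (geo q) m).toOuterMeasure A ≤ (stateLaw q x n).toOuterMeasure S := by
  classical
  have hF := follows_waitRule n hx
  set x' := thenPulse n x
  set r := waitRule x'
  rw [PMF.toOuterMeasure_apply, ENNReal.tsum_eq_iSup_sum]
  refine iSup_le fun s => ?_
  set N := max n (s.sup fun l => (times r l).sum) with hN
  have h1 : ∑ l ∈ s, A.indicator (iidList (geo q) m) l ≤
      (iidList (geo q) m).toOuterMeasure {l | l ∈ A ∧ (times r l).sum ≤ N} := by
    rw [PMF.toOuterMeasure_apply]
    refine le_trans (Finset.sum_le_sum fun l hl => ?_) (ENNReal.sum_le_tsum s)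
    by_cases hA : l ∈ A
    · rw [Set.indicator_of_mem hA, Set.indicator_of_mem]
      exact ⟨hA, (Finset.le_sup (f := fun l => (times r l).sum) hl).trans (le_max_right _ _)⟩
    · rw [Set.indicator_of_notMem hA]; exact zero_le
  refine h1.trans ((hF.coupling hq A m N).trans ?_)
  rw [stateLaw_congr q (x := x) (x' := x') fun g hg => (thenPulse_of_le x hg).symm]
  obtain ⟨j, hj⟩ : ∃ j, N = j + n := ⟨N - n, by omega⟩
  rw [toOuterMeasure_eq_expect _ S, ← expect_stateLaw_drop q x' j, ← hj,
    toOuterMeasure_eq_expect]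
  refine expect_mono_of_support fun g hg => ?_
  have hlen := length_of_mem_support_stateLaw hg
  by_cases h : ∃ l ∈ A, l.length = m ∧ stateTrain r l <:+ g
  · obtain ⟨l, hl, hlm, hlg⟩ := h
    rw [Set.indicator_of_mem (by exact ⟨l, hl, hlm, hlg⟩), Set.indicator_of_mem]
    have := hAS l hl hlm g hlg (by omega)
    rwa [oldest, hlen, hj, Nat.add_sub_cancel] at this
  · rw [Set.indicator_of_notMem (by exact h)]; exact zero_le

/-- A code for `n` uses of the binary channel is realized with `m` pulses of the timing channel, up
to an additional decoding error if it sends `m` or more pulses; few slots beyond the first `n` are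
needed if it is unlikely to send much less than `m` pulses. -/
lemma exists_timingCode_of_code {W : Type} [Fintype W] [Nonempty W] {q : unitInterval}
    (hq : 0 < q) (m n a : ℕ) (x : W → List Bool → Bool) (hx : ∀ w h, x w (false :: h) = false)
    (d : List Bool → W) :
    ∃ c : TimingCode m (Fintype.card W),
      ENNReal.ofReal (c.errorProb q) ≤ expect (unif W) (fun w => (stateLaw q (x w) n).toOuterMeasure
        {h | d (outputs (x w) h) ≠ w ∨ m ≤ (outputs (x w) h).count true}) ∧
      c.expectedTime q ≤ (n + 1 : ℕ) + ENNReal.ofReal (1 / q) * (a + m *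
        expect (unif W) fun w => (stateLaw q (x w) n).toOuterMeasure
          {h | (outputs (x w) h).count true + a < m}) := by
  classical
  set r : W → List ℕ → ℕ := fun w => waitRule (thenPulse n (x w)) with hr
  have hF : ∀ w, Follows (thenPulse n (x w)) (r w) := fun w => follows_waitRule n (hx w)
  obtain ⟨c, hc1, hc2⟩ := exists_timingCode q m r (fun w => (hF w).pos)
    fun ts => d (oldest n (train ts))
  -- the outputs in the first `n` slots, compared with the train of the first `m` pulses
  have hout : ∀ w (l : List ℕ) (g : List Bool), stateTrain (r w) l <:+ g → n ≤ g.length →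
      ∃ y, outputs (x w) (oldest n g) = oldest n (y ++ train (times (r w) l)) ∧
        n ≤ (y ++ train (times (r w) l)).length := by
    intro w l g hlg hng
    obtain ⟨g', rfl⟩ := hlg
    have htr : train (times (r w) l) <:+
        outputs (thenPulse n (x w)) (g' ++ stateTrain (r w) l) := by
      have h1 := outputs_drop (thenPulse n (x w)) (g' ++ stateTrain (r w) l) g'.length
      rw [List.drop_left, (hF w).outputs_stateTrain] at h1
      rw [h1]
      exact List.drop_suffix _ _
    obtain ⟨y, hy⟩ := htr
    refine ⟨y, ?_, by rw [hy, length_outputs]; exact hng⟩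
    rw [hy, oldest, oldest, length_outputs, ← outputs_drop]
    refine outputs_congr (n := n) (fun g hg => (thenPulse_of_le _ hg).symm) ?_
    rw [List.length_drop]; omega
  refine ⟨c, ?_, ?_⟩
  · rw [hc1]
    refine expect_mono fun w => toOuterMeasure_le_stateLaw hq (hx w) n m _ _ ?_
    intro l hl hlm g hlg hng
    obtain ⟨y, hy, hny⟩ := hout w l g hlg hng
    change d (outputs (x w) (oldest n g)) ≠ w ∨ m ≤ (outputs (x w) (oldest n g)).count true
    rw [hy]
    rcases le_or_gt n (train (times (r w) l)).length with h | h
    · left; rw [oldest_append _ h]; exact hl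
    · right
      have hct := count_train (times (r w) l)
      rw [length_times, hlm] at hct
      rw [← hct, oldest]
      rw [List.length_append] at hny
      rw [List.drop_append_of_le_length (by rw [List.length_append]; omega), List.count_append]
      exact Nat.le_add_left _ _
  · rw [hc2]
    have hbound : ∀ w, expect (iidList (geo q) m) (fun l => (late n (r w) l : ℝ≥0∞)) ≤
        a + m * (stateLaw q (x w) n).toOuterMeasure
          {h | (outputs (x w) h).count true + a < m} := by
      intro w
      have h1 : (iidList (geo q) m).toOuterMeasure {l | a < late n (r w) l} ≤
          (stateLaw q (x w) n).toOuterMeasure {h | (outputs (x w) h).count true + a < m} := by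
        refine toOuterMeasure_le_stateLaw hq (hx w) n m _ _ ?_
        intro l hl hlm g hlg hng
        obtain ⟨y, hy, hny⟩ := hout w l g hlg hng
        change (outputs (x w) (oldest n g)).count true + a < m
        change a < late n (r w) l at hl
        have hlate := late_add_count_le n (hF w).pos l
        rw [hy]
        rcases le_or_gt n (train (times (r w) l)).length with h | h
        · rw [oldest_append _ h]; omega
        · rw [oldest_of_le h.le, count_train, length_times] at hlate
          omega
      refine le_trans ?_ (add_le_add_right (mul_le_mul_right h1 _) _)
      rw [toOuterMeasure_eq_expect, ← expect_const_mul, ← expect_const (iidList (geo q) m) (a : ℝ≥0∞),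
        ← expect_add]
      refine expect_mono_of_support fun l hl => ?_
      have hlm := length_of_mem_support_iidList hl
      by_cases h : a < late n (r w) l
      · rw [Set.indicator_of_mem (by exact h), mul_one]
        have := late_le_length n (hF w).pos l
        rw [hlm] at this
        exact le_add_left (by exact_mod_cast this)
      · rw [Set.indicator_of_notMem (by exact h), mul_zero, add_zero]
        exact_mod_cast not_lt.1 h
    have htime : ∀ w, expect (iidList (geo q) m) (fun l => ((times (r w) l).sum : ℝ≥0∞)) ≤
        (n + 1 : ℕ) + ENNReal.ofReal (1 / q) * (a + m * (stateLaw q (x w) n).toOuterMeasure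
          {h | (outputs (x w) h).count true + a < m}) := by
      intro w
      refine (expect_time_le hq (n := n) (fun z l => ?_) m).trans ?_
      · have := (waitTime_thenPulse n (x w)
          (List.replicate z false ++ waitTrain (thenPulse n (x w)) l)).2
        have hl : (waitTrain (thenPulse n (x w)) l).length = (times (r w) l).sum := by
          rw [← stateTrain_waitRule, length_stateTrain]
        rw [List.length_append, List.length_replicate, hl] at this
        exact this
      · gcongr
        exact hbound w
    refine (expect_mono htime).trans (le_of_eq ?_)
    rw [expect_add, expect_const, expect_const_mul, expect_add, expect_const, expect_const_mul]

/-! ### Blocks that leave the battery empty -/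

section BinaryBlocks

/-- If the strategy `a` leaves the battery empty after `k` slots, then a strategy that is used
from there on starts afresh. -/
lemma expect_stateLaw_andThen (q : unitInterval) {k : ℕ} {a : List Bool → Bool}
    (b : List Bool → Bool)
    (ha : ∀ h : List Bool, h.length = k → (h.headD false && !a h) = false) (j : ℕ)
    (F : List Bool → ℝ≥0∞) :
    expect (stateLaw q (andThen k a fun h _ => b h) (j + k)) F =
      expect (stateLaw q a k) fun h₀ => expect (stateLaw q b j) fun h => F (h ++ h₀) := by
  induction j generalizing F with
  | zero =>
    rw [Nat.zero_add, stateLaw_congr q (x' := a) fun g hg => andThen_of_le _ _ hg]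
    simp [stateLaw, expect_pure]
  | succ j ih =>
    rw [Nat.succ_add, stateLaw, stateLaw, expect_bind, ih]
    refine expect_congr_of_support fun h₀ hh₀ => ?_
    have hl₀ := length_of_mem_support_stateLaw hh₀
    rw [expect_bind]
    congr 1; ext h
    have hnext : nextState q (andThen k a fun h _ => b h) (h ++ h₀) = nextState q b h := by
      rcases h with _ | ⟨s, h⟩
      · rw [List.nil_append, nextState, nextState, andThen_of_le _ _ hl₀.le, ha h₀ hl₀]
        rfl
      · rw [nextState, nextState, andThen_append _ _ hl₀ (List.cons_ne_nil s h)]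
        rfl
    rw [hnext, expect_map, expect_map]
    rfl

lemma outputs_andThen {k : ℕ} (a b : List Bool → Bool) (h : List Bool) {h₀ : List Bool}
    (hl₀ : h₀.length = k) :
    outputs (andThen k a fun h _ => b h) (h ++ h₀) = outputs b h ++ outputs a h₀ := by
  induction h with
  | nil => exact outputs_congr (fun l hl => andThen_of_le a _ hl) hl₀.le
  | cons s h ih =>
    have h1 := andThen_append a (fun h _ => b h) hl₀ (List.cons_ne_nil s h)
    rw [List.cons_append] at h1
    rw [List.cons_append, outputs, outputs, ih, h1, List.cons_append]

variable {W : Type} (n : ℕ) (x : W → List Bool → Bool)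

/-- The strategy that serves the messages `ws` (newest first) in blocks of `n + 1` slots each,
whose last slot is used to empty the battery. -/
def emptyingBlocks (ws : List W) : List Bool → Bool :=
  blocks (n + 1) (fun w => thenPulse n (x w)) false ws

variable {n x}

lemma emptyingBlocks_empty (hx : ∀ w h, x w (false :: h) = false) (ws : List W) (h : List Bool) :
    emptyingBlocks n x ws (false :: h) = false := by
  induction ws with
  | nil => rfl
  | cons w ws ih =>
    rw [emptyingBlocks, blocks, andThen]
    split_ifs with hle
    · exact ih
    · obtain ⟨i, hi⟩ : ∃ i, (false :: h).length - ws.length * (n + 1) = i + 1 :=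
        ⟨(false :: h).length - ws.length * (n + 1) - 1, by omega⟩
      rw [hi, List.take_succ_cons]
      exact thenPulse_empty (hx w) _

lemma emptyingBlocks_emptied (ws : List W) {h : List Bool} (hl : h.length = ws.length * (n + 1)) :
    (h.headD false && !emptyingBlocks n x ws h) = false := by
  rcases ws with _ | ⟨w, ws⟩
  · obtain rfl : h = [] := List.eq_nil_of_length_eq_zero (by simpa using hl)
    rfl
  · rw [List.length_cons, add_mul, one_mul] at hl
    rw [emptyingBlocks, blocks, andThen, if_neg (by omega), hl, Nat.add_sub_cancel_left, thenPulse,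
      if_neg (by rw [List.length_take]; omega)]
    rcases h with _ | ⟨s, h⟩
    · rfl
    · simp

lemma stateLaw_emptyingBlocks (q : unitInterval) (w : W) (ws : List W) :
    stateLaw q (emptyingBlocks n x (w :: ws)) ((w :: ws).length * (n + 1)) =
      (stateLaw q (emptyingBlocks n x ws) (ws.length * (n + 1))).bind fun h₀ =>
        (stateLaw q (thenPulse n (x w)) (n + 1)).map fun h => h ++ h₀ := by
  refine ext_of_expect fun F => ?_
  rw [List.length_cons, add_mul, one_mul, add_comm, expect_bind]
  simp only [expect_map]
  exact expect_stateLaw_andThen q _ (fun h hl => emptyingBlocks_emptied ws hl) _ F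

lemma outputs_emptyingBlocks (bl : List (W × List Bool)) (hbl : ∀ b ∈ bl, b.2.length = n + 1) :
    (bl.map Prod.snd).flatten.length = bl.length * (n + 1) ∧
    outputs (emptyingBlocks n x (bl.map Prod.fst)) (bl.map Prod.snd).flatten =
      (bl.map fun b => outputs (thenPulse n (x b.1)) b.2).flatten := by
  induction bl with
  | nil => exact ⟨by simp, rfl⟩
  | cons b bl ih =>
    simp only [List.mem_cons, forall_eq_or_imp] at hbl
    obtain ⟨h1, h2⟩ := ih hbl.2
    refine ⟨?_, ?_⟩
    · rw [List.map_cons, List.flatten_cons, List.length_append, h1, hbl.1, List.length_cons]; ring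
    · rw [List.map_cons, List.map_cons, List.flatten_cons, List.map_cons, List.flatten_cons, ← h2,
        emptyingBlocks, blocks, outputs_andThen _ _ _ (by rw [h1, List.length_map])]
      rfl

/-- Many blocks of a code for the binary channel, over the timing channel with `m` pulses: the
failure probabilities are those of sequences of independent blocks. -/
lemma exists_timingCode_of_blocks [Fintype W] [Nonempty W] {q : unitInterval} (hq : 0 < q)
    (hx : ∀ w h, x w (false :: h) = false) (d : List Bool → W) (B m a : ℕ)
    {μ t : ℝ} (hμ : μ = mean (blockLaw (unif W) fun w => stateLaw q (thenPulse n (x w)) (n + 1))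
      fun b => ((min ((outputs (thenPulse n (x b.1)) b.2).count true) (n + 1) : ℕ) : ℝ))
    (ht : 0 < t) (hm : B * μ + t ≤ m) (ha : m - B * μ + t ≤ a) :
    ∃ c : TimingCode m (Fintype.card W ^ B),
      ENNReal.ofReal (c.errorProb q) ≤ B * expect (unif W) (fun w =>
        (stateLaw q (x w) n).toOuterMeasure {h | d (outputs (x w) h) ≠ w}) +
          ENNReal.ofReal (B * ((n + 1 : ℕ) : ℝ) ^ 2 / t ^ 2) ∧
      c.expectedTime q ≤ (B * (n + 1) + 1 : ℕ) + ENNReal.ofReal (1 / q) * (a + m *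
        ENNReal.ofReal (B * ((n + 1 : ℕ) : ℝ) ^ 2 / t ^ 2)) := by
  classical
  set K : W → PMF (List Bool) := fun w => stateLaw q (thenPulse n (x w)) (n + 1) with hK
  set p := blockLaw (unif W) K with hp
  set f : W × List Bool → ℝ :=
    fun b => ((min ((outputs (thenPulse n (x b.1)) b.2).count true) (n + 1) : ℕ) : ℝ) with hf
  set η := ENNReal.ofReal (B * ((n + 1 : ℕ) : ℝ) ^ 2 / t ^ 2) with hη
  set T : Set (List (W × List Bool)) := {l | t ≤ |(l.map f).sum - B * mean p f|} with hT
  have hcheb : (iidList p B).toOuterMeasure T ≤ η :=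
    chebyshev_iidList p (fun b => Nat.cast_nonneg _) (c := ((n + 1 : ℕ) : ℝ))
      (fun b => Nat.cast_le.2 (min_le_right _ _)) B ht
  set d₁ : List Bool → W := fun y => d (y.drop 1) with hd₁
  set X : (Fin B → W) → List Bool → Bool := fun w => emptyingBlocks n x (revList w) with hX
  set D : List Bool → Fin B → W := fun y j =>
    (blockDecode (n + 1) d₁ B y).reverse.getD j (Classical.arbitrary W) with hD
  obtain ⟨c, hc1, hc2⟩ := exists_timingCode_of_code (W := Fin B → W) hq m (B * (n + 1)) a X
    (fun w h => emptyingBlocks_empty hx _ h) D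
  have hcard : Fintype.card (Fin B → W) = Fintype.card W ^ B := by simp
  rw [← hcard]
  have hD' : ∀ (y : List Bool) (w : Fin B → W), D y ≠ w → blockDecode (n + 1) d₁ B y ≠ revList w := by
    intro y w h1 h2
    refine h1 (revList_injective ?_)
    rw [hD, revList_reverse_getD _ (length_blockDecode _ _ _ _), h2]
  -- transfer of events to independent blocks
  have htrans : ∀ (S : List W → Set (List Bool)) (U : Set (List (W × List Bool))),
      (∀ bl : List (W × List Bool), bl.length = B → (∀ b ∈ bl, b.2.length = n + 1) →
        (bl.map Prod.snd).flatten ∈ S (bl.map Prod.fst) → bl ∈ U) →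
      expect (unif (Fin B → W)) (fun w => (stateLaw q (X w) (B * (n + 1))).toOuterMeasure
        (S (revList w))) ≤ (iidList p B).toOuterMeasure U := by
    intro S U hSU
    rw [expect_unif_revList B fun ws => (stateLaw q (emptyingBlocks n x ws)
      (B * (n + 1))).toOuterMeasure (S ws)]
    rw [expect_congr_of_support (G := fun ws => (stateLaw q (emptyingBlocks n x ws)
      (ws.length * (n + 1))).toOuterMeasure (S ws)) fun ws hws => by
        rw [length_of_mem_support_iidList hws]]
    refine expect_blocks_le (unif W) K (fun ws => stateLaw q (emptyingBlocks n x ws)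
      (ws.length * (n + 1))) (by simp [stateLaw]) (fun w ws => stateLaw_emptyingBlocks q w ws)
      B S U fun bl hbl hsupp hmem => hSU bl hbl
        (fun b hb => length_of_mem_support_stateLaw (hsupp b hb)) hmem
  -- the number of pulses
  have hcount : ∀ bl : List (W × List Bool), (∀ b ∈ bl, b.2.length = n + 1) →
      (((outputs (emptyingBlocks n x (bl.map Prod.fst)) (bl.map Prod.snd).flatten).count true : ℕ)
        : ℝ) = (bl.map f).sum := by
    intro bl hlen
    rw [(outputs_emptyingBlocks bl hlen).2]
    clear_value D
    induction bl with
    | nil => simp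
    | cons b bl ih =>
      simp only [List.mem_cons, forall_eq_or_imp] at hlen
      have hb : min ((outputs (thenPulse n (x b.1)) b.2).count true) (n + 1) =
          (outputs (thenPulse n (x b.1)) b.2).count true :=
        min_eq_left (List.count_le_length.trans (by rw [length_outputs, hlen.1]))
      rw [List.map_cons, List.flatten_cons, List.count_append, Nat.cast_add, ih hlen.2,
        List.map_cons, List.sum_cons]
      congr 1
      rw [hf]; exact congrArg _ hb.symm
  refine ⟨c, ?_, ?_⟩
  · set err : W × List Bool → ℝ≥0∞ := fun b =>
      if d₁ (outputs (thenPulse n (x b.1)) b.2) ≠ b.1 then 1 else 0 with herr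
    have h1 := htrans (fun ws => {h | blockDecode (n + 1) d₁ B (outputs (emptyingBlocks n x ws) h)
        ≠ ws ∨ m ≤ (outputs (emptyingBlocks n x ws) h).count true})
      ({l | 1 ≤ (l.map err).sum} ∪ T) (by
        intro bl hbl hlen hmem
        rcases hmem with h | h
        · left
          rw [(outputs_emptyingBlocks bl hlen).2] at h
          rw [← hbl, blockDecode_flatten d₁ (fun b : W × List Bool =>
            outputs (thenPulse n (x b.1)) b.2) bl
            (fun b hb => by rw [length_outputs, hlen b hb])] at h
          change 1 ≤ (bl.map err).sum
          obtain ⟨b, hb, hbe⟩ : ∃ b ∈ bl, d₁ (outputs (thenPulse n (x b.1)) b.2) ≠ b.1 := by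
            by_contra! hcon
            exact h (List.map_congr_left hcon)
          refine le_trans ?_ (List.single_le_sum (fun _ _ => zero_le) _
            (List.mem_map.2 ⟨b, hb, rfl⟩))
          rw [herr]
          exact (if_pos hbe).ge
        · right
          have h' : (m : ℝ) ≤ (((outputs (emptyingBlocks n x (bl.map Prod.fst))
            (bl.map Prod.snd).flatten).count true : ℕ) : ℝ) := Nat.cast_le.2 h
          rw [hcount bl hlen] at h'
          change t ≤ |(bl.map f).sum - B * mean p f|
          rw [← hμ]
          exact le_trans (by linarith) (le_abs_self _))
    refine hc1.trans ((expect_mono fun w => measure_mono ?_).trans (h1.trans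
      ((measure_union_le _ _).trans (add_le_add ?_ hcheb))))
    · rintro h (h' | h')
      · exact Or.inl (hD' _ w h')
      · exact Or.inr h'
    · have h2 := mul_toOuterMeasure_le_expect (iidList p B) (fun l => (l.map err).sum) 1
      rw [one_mul, expect_iidList_sum] at h2
      refine h2.trans (le_of_eq ?_)
      congr 1
      rw [hp, expect_blockLaw]
      congr 1; ext w
      rw [toOuterMeasure_eq_expect, ← stateLaw_congr q (x := thenPulse n (x w)) (x' := x w)
        (n := n) fun g hg => thenPulse_of_le _ hg]
      rw [← expect_stateLaw_drop q (thenPulse n (x w)) 1 n, add_comm 1 n]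
      refine expect_congr_of_support fun h hh => ?_
      have hl := length_of_mem_support_stateLaw hh
      have hout : outputs (x w) (h.drop 1) = (outputs (thenPulse n (x w)) h).drop 1 := by
        rw [← outputs_drop]
        exact outputs_congr (n := n) (fun g hg => (thenPulse_of_le _ hg).symm)
          (by rw [List.length_drop]; omega)
      by_cases hd : d (outputs (x w) (h.drop 1)) = w
      · rw [Set.indicator_of_notMem (by exact not_not.2 hd), herr]
        exact if_neg (by rw [hd₁]; simpa [← hout] using hd)
      · rw [Set.indicator_of_mem (by exact hd), herr]
        exact if_pos (by rw [hd₁]; simpa [← hout] using hd)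
  · refine hc2.trans ?_
    gcongr
    refine (htrans (fun ws => {h | (outputs (emptyingBlocks n x ws) h).count true + a < m}) T
      ?_).trans hcheb
    intro bl hbl hlen hmem
    have h' : ((((outputs (emptyingBlocks n x (bl.map Prod.fst))
      (bl.map Prod.snd).flatten).count true + a : ℕ)) : ℝ) < m := Nat.cast_lt.2 hmem
    rw [Nat.cast_add, hcount bl hlen] at h'
    change t ≤ |(bl.map f).sum - B * mean p f|
    rw [← hμ]
    exact le_trans (by linarith) (neg_le_abs _)

end BinaryBlocks

/-! ### Achievable rates, from the binary channel to the timing channel -/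

/-- The duration of `B` blocks of `N` slots with `m` pulses, if `m` exceeds the typical number
`B * μ` of pulses by little. -/
lemma time_le_of_many_blocks {q s κ B N μ m a : ℝ} (hq : 0 < q) (hs : 0 < s) (hκ : 0 < κ)
    (hsκ : s ≤ κ * q / 4) (hB : 1 ≤ B) (hN : 1 ≤ N) (hμ : 0 ≤ μ)
    (h2 : m < (B + 1) * (μ + s * N)) (hω : μ + s * N ≤ 2 * N)
    (ha : a ≤ m - B * μ + s * (B * N) + 1)
    (hB' : 2 * (1 + (3 + 4 / s ^ 2) / q) / κ ≤ B) :
    B * N + 1 + 1 / q * (a + m * (1 / (s ^ 2 * B))) ≤ (1 + κ) * (B * N) := by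
  have hB0 : 0 < B := by linarith
  have hN0 : 0 < N := by linarith
  have h3 : a ≤ 3 * N + 2 * (s * (B * N)) := by linarith
  have h4 : m * (1 / (s ^ 2 * B)) ≤ 4 / s ^ 2 * N := by
    have h5 : m ≤ 4 * (B * N) := by
      have : (B + 1) * (μ + s * N) ≤ (2 * B) * (2 * N) :=
        mul_le_mul (by linarith) hω (by positivity) (by linarith)
      linarith
    refine (mul_le_mul_of_nonneg_right h5 (by positivity)).trans (le_of_eq ?_)
    field_simp
  have h5 : 1 / q * (2 * (s * (B * N))) ≤ κ / 2 * (B * N) := by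
    have := mul_le_mul_of_nonneg_right hsκ (by positivity : 0 ≤ 2 * (B * N) / q)
    refine le_trans (le_of_eq (by ring)) (this.trans (le_of_eq ?_))
    field_simp; ring
  have h6 : (1 + (3 + 4 / s ^ 2) / q) * N ≤ κ / 2 * (B * N) := by
    rw [div_le_iff₀ hκ] at hB'
    have := mul_le_mul_of_nonneg_right hB' hN0.le
    linarith
  have h7 : 1 / q * (a + m * (1 / (s ^ 2 * B))) ≤
      1 / q * (3 * N + 2 * (s * (B * N)) + 4 / s ^ 2 * N) :=
    mul_le_mul_of_nonneg_left (by linarith) (by positivity)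
  have h8 : 1 / q * (3 * N + 2 * (s * (B * N)) + 4 / s ^ 2 * N) + N =
      1 / q * (2 * (s * (B * N))) + (1 + (3 + 4 / s ^ 2) / q) * N := by field_simp; ring
  linarith

/-- A code for about `δ * m` slots is used in the largest number `B` of blocks for which the typical
number `B * (μ + s * N)` of pulses does not exceed `m`; `δ` is so small that `B` exceeds the
constant `B₀`, and `B` stays bounded because the margin `s * N` is proportional to `m`. -/
lemma timingAchievable_of_achievable {q : unitInterval} (hq : 0 < q) {R R' : ℝ}
    (hR : Achievable q R) (hR' : 0 < R') (hRR : R' < R) : TimingAchievable q R' := by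
  have hq0 : (0 : ℝ) < q := hq
  have hR0 : 0 < R := hR'.trans hRR
  intro ε hε
  -- the loss in rate, the margin for the number of pulses, and the relative length of a block
  set κ : ℝ := (R - R') / (2 * R') with hκ
  have hκ0 : 0 < κ := div_pos (by linarith) (by linarith)
  have hRκ : R' * (1 + κ) = (R + R') / 2 := by rw [hκ]; field_simp; ring
  set s : ℝ := min 1 (κ * q / 4) with hs
  have hs0 : 0 < s := lt_min one_pos (by positivity)
  have hs1 : s ≤ 1 := min_le_left _ _
  have hsκ : s ≤ κ * q / 4 := min_le_right _ _
  set c₀ : ℝ := 1 + (3 + 4 / s ^ 2) / q with hc₀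
  have hc₀0 : 0 < c₀ := by positivity
  set B₀ : ℝ := 2 / (ε * s ^ 2) + 2 * c₀ / κ + 1 with hB₀
  have hB₀1 : 1 ≤ B₀ := by rw [hB₀]; linarith [(by positivity : 0 ≤ 2 / (ε * s ^ 2) + 2 * c₀ / κ)]
  have hB₀2 : 2 / (ε * s ^ 2) ≤ B₀ := by
    rw [hB₀]; linarith [(by positivity : 0 ≤ 2 * c₀ / κ)]
  have hB₀3 : 2 * c₀ / κ ≤ B₀ := by
    rw [hB₀]; linarith [(by positivity : 0 ≤ 2 / (ε * s ^ 2))]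
  set δ : ℝ := 1 / (4 * (B₀ + 1)) with hδ
  have hδ0 : 0 < δ := by positivity
  have hlim : Tendsto (fun m : ℕ => ⌊δ * m⌋₊) atTop atTop :=
    tendsto_nat_floor_atTop.comp (tendsto_natCast_atTop_atTop.const_mul_atTop hδ0)
  filter_upwards [hlim.eventually (hR (ε * s * δ / 2) (by positivity)),
    hlim.eventually (eventually_ge_atTop ⌈(R + R') / (R - R')⌉₊),
    eventually_ge_atTop ⌈4 * (B₀ + 1)⌉₊] with m hcode hn hm
  obtain ⟨n, hn_def⟩ : ∃ n, n = ⌊δ * m⌋₊ := ⟨_, rfl⟩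
  rw [← hn_def] at hcode hn
  obtain ⟨M, hM, c, hrate, herr⟩ := hcode
  have : NeZero M := ⟨hM.ne'⟩
  have hm' : 4 * (B₀ + 1) ≤ m := (Nat.le_ceil _).trans (by exact_mod_cast hm)
  have hm0 : (0 : ℝ) < m := by linarith
  obtain ⟨d, hd⟩ := c.exists_list_decoder q
  set μ := mean (blockLaw (unif (Fin M)) fun w => stateLaw q (thenPulse n (c.enc w)) (n + 1))
      fun b => ((min ((outputs (thenPulse n (c.enc b.1)) b.2).count true) (n + 1) : ℕ) : ℝ) with hμ
  set N : ℝ := ((n + 1 : ℕ) : ℝ) with hN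
  have hN1 : 1 ≤ N := by rw [hN]; push_cast; linarith [(Nat.cast_nonneg n : (0 : ℝ) ≤ n)]
  have hNn : N = n + 1 := by rw [hN]; push_cast; ring
  have hμ0 : 0 ≤ μ := mean_nonneg _ fun _ => Nat.cast_nonneg _
  have hμN : μ ≤ N := mean_le_of_bounded _ (fun _ => Nat.cast_nonneg _)
    fun _ => Nat.cast_le.2 (min_le_right _ _)
  have hNδ : δ * m ≤ N := by rw [hNn, hn_def]; exact (Nat.lt_floor_add_one _).le
  have hNδ' : N ≤ δ * m + 1 := by
    rw [hNn, hn_def]; linarith [Nat.floor_le (by positivity : 0 ≤ δ * (m : ℝ))]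
  set ω := μ + s * N with hω
  have hsN : 0 < s * N := by positivity
  have hω0 : 0 < ω := by linarith
  have hωN : ω ≤ 2 * N := by
    have := mul_le_mul_of_nonneg_right hs1 (by linarith : 0 ≤ N)
    linarith
  -- the number of blocks
  set B := ⌊m / ω⌋₊ with hB
  have hB1 : B * ω ≤ m := by
    have := Nat.floor_le (by positivity : 0 ≤ m / ω)
    rwa [le_div_iff₀ hω0] at this
  have hB2 : (m : ℝ) < (B + 1) * ω := by
    have := Nat.lt_floor_add_one (m / ω)
    rwa [div_lt_iff₀ hω0] at this
  have hB3 : B₀ ≤ B := by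
    have h1 : (B₀ + 1) * ω ≤ m := by
      have h2 : ω ≤ 2 * (δ * m + 1) := by linarith
      have h3 : (B₀ + 1) * (δ * m) = m / 4 := by rw [hδ]; field_simp
      have h4 := mul_le_mul_of_nonneg_left h2 (by linarith : 0 ≤ B₀ + 1)
      linarith
    have h5 : (B₀ + 1) * ω < (B + 1) * ω := h1.trans_lt hB2
    have := lt_of_mul_lt_mul_right h5 hω0.le
    linarith
  have hB0 : (0 : ℝ) < B := by linarith
  have hB4 : B * (s * δ) ≤ 1 := by
    have h1 : B * (s * (δ * m)) ≤ m :=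
      le_trans (mul_le_mul_of_nonneg_left
        (by have := mul_le_mul_of_nonneg_left hNδ hs0.le; linarith) hB0.le) hB1
    by_contra! hcon
    have := mul_lt_mul_of_pos_right hcon hm0
    linarith
  have ht : 0 < s * (B * N) := by positivity
  have hslack : 0 ≤ m - B * μ + s * (B * N) := by
    have : B * ω = B * μ + s * (B * N) := by rw [hω]; ring
    linarith
  have hex := exists_timingCode_of_blocks hq (fun w h => c.enc_empty w h) d B m
    ⌈m - B * μ + s * (B * N)⌉₊ hμ ht (by
      have : B * ω = B * μ + s * (B * N) := by rw [hω]; ring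
      linarith) (Nat.le_ceil _)
  rw [Fintype.card_fin] at hex
  obtain ⟨c', hc1, hc2⟩ := hex
  have hη : B * N ^ 2 / (s * (B * N)) ^ 2 = 1 / (s ^ 2 * B) := by field_simp
  rw [← hN, hη] at hc1 hc2
  refine ⟨M ^ B, by positivity, c', ?_, ?_⟩
  · have ha := (Nat.ceil_lt_add_one hslack).le
    set a := ⌈m - B * μ + s * (B * N)⌉₊
    have htime : c'.expectedTime q ≤
        ENNReal.ofReal (B * N + 1 + 1 / q * (a + m * (1 / (s ^ 2 * B)))) := by
      refine hc2.trans (le_of_eq ?_)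
      have h1 : ((B * (n + 1) + 1 : ℕ) : ℝ≥0∞) = ENNReal.ofReal (B * N + 1) := by
        rw [← ENNReal.ofReal_natCast, hNn]; congr 1; push_cast; ring
      rw [h1, ← ENNReal.ofReal_natCast a, ← ENNReal.ofReal_natCast m,
        ← ENNReal.ofReal_mul (by positivity), ← ENNReal.ofReal_add (by positivity) (by positivity),
        ← ENNReal.ofReal_mul (by positivity), ← ENNReal.ofReal_add (by positivity) (by positivity)]
    have hle := time_le_of_many_blocks hq0 hs0 hκ0 hsκ (by linarith) hN1 hμ0 hB2 hωN ha
      (hB₀3.trans hB3)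
    refine (mul_le_mul_right htime _).trans ?_
    rw [← ENNReal.ofReal_mul hR'.le]
    refine ENNReal.ofReal_le_ofReal ?_
    push_cast
    rw [Real.logb_pow]
    have h1 := mul_le_mul_of_nonneg_left hle hR'.le
    have h2 := mul_le_mul_of_nonneg_left hrate hB0.le
    have h3 : (R + R') / 2 * N ≤ R * n := by
      have : (R + R') / (R - R') ≤ n := (Nat.le_ceil _).trans (by exact_mod_cast hn)
      rw [div_le_iff₀ (by linarith)] at this
      rw [hNn]; linarith
    have h4 := mul_le_mul_of_nonneg_left h3 hB0.le
    have h5 : R' * ((1 + κ) * (B * N)) = B * ((R + R') / 2 * N) := by rw [← hRκ]; ring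
    linarith
  · rw [← hd] at hc1
    refine (ENNReal.ofReal_le_ofReal_iff hε.le).1 (hc1.trans ?_)
    have h1 : (B : ℝ≥0∞) * ENNReal.ofReal (c.errorProb q) ≤ ENNReal.ofReal (ε / 2) := by
      rw [← ENNReal.ofReal_natCast, ← ENNReal.ofReal_mul hB0.le]
      refine ENNReal.ofReal_le_ofReal ?_
      refine (mul_le_mul_of_nonneg_left herr hB0.le).trans ?_
      have := mul_le_mul_of_nonneg_left hB4 hε.le
      linarith
    have h2 : 1 / (s ^ 2 * B) ≤ ε / 2 := by
      have := hB₀2.trans hB3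
      rw [div_le_iff₀ (by positivity)] at this
      rw [div_le_iff₀ (by positivity)]
      linarith
    refine (add_le_add h1 (ENNReal.ofReal_le_ofReal h2)).trans (le_of_eq ?_)
    rw [← ENNReal.ofReal_add (by positivity) (by positivity), add_halves]

theorem capacity_le_timingCapacity {q : unitInterval} (hq : 0 < q) :
    capacity q ≤ timingCapacity q :=
  iSup₂_le fun _ hR => le_of_forall_pos_lt (timingCapacity_nonneg q) fun R' h0 hlt =>
    le_iSup₂_of_le R' (timingAchievable_of_achievable hq hR h0 hlt) le_rfl

/-! ### Entropy in nats -/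

/-- The surprisal `-log x`, in nats, of an event of probability `x`; it is `0` for `x = 0`. -/
noncomputable def surprisal (x : ℝ≥0∞) : ℝ≥0∞ := ENNReal.ofReal (-Real.log x.toReal)

/-- The entropy, in nats, of a discrete distribution; it may be infinite. -/
noncomputable def natEntropy {α : Type} (p : PMF α) : ℝ≥0∞ := expect p fun a => surprisal (p a)

lemma surprisal_mul {x y : ℝ≥0∞} (hx : x ≤ 1) (hy : y ≤ 1) (hx0 : x ≠ 0) (hy0 : y ≠ 0) :
    surprisal (x * y) = surprisal x + surprisal y := by
  have h1 : x ≠ ∞ := (hx.trans_lt ENNReal.one_lt_top).ne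
  have h2 : y ≠ ∞ := (hy.trans_lt ENNReal.one_lt_top).ne
  have hx' : x.toReal ≤ 1 := ENNReal.toReal_le_of_le_ofReal zero_le_one (by simpa using hx)
  have hy' : y.toReal ≤ 1 := ENNReal.toReal_le_of_le_ofReal zero_le_one (by simpa using hy)
  rw [surprisal, surprisal, surprisal, ENNReal.toReal_mul,
    Real.log_mul (ENNReal.toReal_ne_zero.2 ⟨hx0, h1⟩) (ENNReal.toReal_ne_zero.2 ⟨hy0, h2⟩), neg_add,
    ENNReal.ofReal_add]
  · have := Real.log_nonpos ENNReal.toReal_nonneg hx'; linarith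
  · have := Real.log_nonpos ENNReal.toReal_nonneg hy'; linarith

lemma surprisal_mul_le {x y : ℝ≥0∞} (hx : x ≤ 1) (hy : y ≤ 1) :
    surprisal (x * y) ≤ surprisal x + surprisal y := by
  by_cases hx0 : x = 0
  · simp [hx0, surprisal]
  by_cases hy0 : y = 0
  · simp [hy0, surprisal]
  exact (surprisal_mul hx hy hx0 hy0).le

/-- Gibbs' inequality. -/
lemma natEntropy_le_expect {α : Type} (p : PMF α) {f : α → ℝ≥0∞} (hf : ∑' a, f a ≤ 1)
    (h0 : ∀ a, p a ≠ 0 → f a ≠ 0) : natEntropy p ≤ expect p fun a => surprisal (f a) := by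
  have key : ∀ a, p a * surprisal (p a) + p a ≤ p a * surprisal (f a) + f a := by
    intro a
    by_cases ha : p a = 0
    · simp [ha]
    have hf1 : f a ≤ 1 := (ENNReal.le_tsum a).trans hf
    have hft : f a ≠ ∞ := (hf1.trans_lt ENNReal.one_lt_top).ne
    have hpt := p.apply_ne_top a
    have hf0 := h0 a ha
    obtain ⟨x, hx, hpx⟩ : ∃ x : ℝ, 0 ≤ x ∧ p a = ENNReal.ofReal x :=
      ⟨_, ENNReal.toReal_nonneg, (ENNReal.ofReal_toReal hpt).symm⟩
    obtain ⟨y, hy, hfy⟩ : ∃ y : ℝ, 0 ≤ y ∧ f a = ENNReal.ofReal y :=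
      ⟨_, ENNReal.toReal_nonneg, (ENNReal.ofReal_toReal hft).symm⟩
    have hp1 := p.coe_le_one a
    rw [hpx] at ha hp1
    rw [hfy] at hf0 hf1
    rw [ENNReal.ofReal_le_one] at hp1 hf1
    rw [Ne, ENNReal.ofReal_eq_zero, not_le] at hf0
    rw [ENNReal.ofReal_eq_zero, not_le] at ha
    have hl1 := Real.log_nonpos hx hp1
    have hl2 := Real.log_nonpos hy hf1
    rw [surprisal, surprisal, hpx, hfy, ENNReal.toReal_ofReal hx, ENNReal.toReal_ofReal hy,
      ← ENNReal.ofReal_mul hx, ← ENNReal.ofReal_mul hx,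
      ← ENNReal.ofReal_add (mul_nonneg hx (by linarith)) hx,
      ← ENNReal.ofReal_add (mul_nonneg hx (by linarith)) hy]
    refine ENNReal.ofReal_le_ofReal ?_
    have h1 := Real.log_le_sub_one_of_pos (div_pos hf0 ha)
    rw [Real.log_div hf0.ne' ha.ne'] at h1
    have h2 := mul_le_mul_of_nonneg_left h1 hx
    have h3 : x * (y / x - 1) = y - x := by field_simp
    linarith
  have hsum := ENNReal.tsum_le_tsum key
  rw [ENNReal.tsum_add, ENNReal.tsum_add, p.tsum_coe] at hsum
  exact (ENNReal.add_le_add_iff_right ENNReal.one_ne_top).1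
    (hsum.trans (add_le_add_right hf _))

lemma bind_map_cons_apply {α : Type} (p : PMF (List α)) (K : List α → PMF α) (a : α) (l : List α) :
    (p.bind fun l => (K l).map fun a => a :: l) (a :: l) = p l * K l a := by
  classical
  rw [PMF.bind_apply, tsum_eq_single l]
  · congr 1
    rw [PMF.map_apply, tsum_eq_single a]
    · simp
    · intro b hb; simp [hb.symm]
  · intro l' hl'
    rw [PMF.map_apply, ENNReal.tsum_eq_zero.2, mul_zero]
    intro b; simp [hl'.symm]

/-- Conditioning on more reduces the entropy: an entry `t`, drawn given `a`, that is put in front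
of the list `f a`, adds at least its conditional entropy given `a`. -/
lemma add_natEntropy_le {α γ : Type} (p : PMF α) (f : α → List γ) (K : α → PMF γ) :
    natEntropy (p.map f) + expect p (fun a => natEntropy (K a)) ≤
      natEntropy (p.bind fun a => (K a).map fun t => t :: f a) := by
  classical
  set P := p.map f with hP
  set J := p.bind fun a => (K a).map fun t => t :: f a with hJ
  have hJle : ∀ l, ∑' t, J (t :: l) = P l := by
    intro l
    rw [← PMF.toOuterMeasure_apply_singleton P l, toOuterMeasure_eq_expect, hP, expect_map]
    simp only [hJ, PMF.bind_apply, expect]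
    rw [ENNReal.tsum_comm]
    refine tsum_congr fun a => ?_
    rw [ENNReal.tsum_mul_left]
    congr 1
    by_cases hl : f a = l
    · rw [Set.indicator_of_mem (by exact hl), ← (K a).tsum_coe]
      refine tsum_congr fun t => ?_
      rw [PMF.map_apply, tsum_eq_single t]
      · simp [hl]
      · intro s hs; simp [hs.symm]
    · rw [Set.indicator_of_notMem (by exact hl)]
      refine ENNReal.tsum_eq_zero.2 fun t => ?_
      rw [PMF.map_apply]
      refine ENNReal.tsum_eq_zero.2 fun s => ?_
      rw [if_neg]
      intro h
      exact hl (List.cons.inj h).2.symm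
  have hPa : ∀ a ∈ p.support, P (f a) ≠ 0 := by
    intro a ha
    rw [← PMF.mem_support_iff, hP, PMF.mem_support_map_iff]
    exact ⟨a, ha, rfl⟩
  have hJa : ∀ a ∈ p.support, ∀ t, K a t ≠ 0 → J (t :: f a) ≠ 0 := by
    intro a ha t ht
    rw [← PMF.mem_support_iff, hJ, PMF.mem_support_bind_iff]
    refine ⟨a, ha, ?_⟩
    rw [PMF.mem_support_map_iff]
    exact ⟨t, ht, rfl⟩
  have h1 : natEntropy J = expect p fun a => expect (K a) fun t => surprisal (J (t :: f a)) := by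
    rw [natEntropy]
    nth_rewrite 1 [hJ]
    rw [expect_bind]
    simp only [expect_map]
  have h2 : natEntropy P = expect p fun a => surprisal (P (f a)) := by
    rw [natEntropy]
    nth_rewrite 1 [hP]
    rw [expect_map]
  rw [h1, h2, ← expect_add]
  refine expect_mono_of_support fun a ha => ?_
  have hP0 := hPa a ha
  have hPt := P.apply_ne_top (f a)
  -- the conditional law of the new entry given the list
  have hρ : ∑' t, J (t :: f a) / P (f a) = 1 := by
    simp only [div_eq_mul_inv]
    rw [ENNReal.tsum_mul_right, hJle, ENNReal.mul_inv_cancel hP0 hPt]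
  have hρ0 : ∀ t, K a t ≠ 0 → J (t :: f a) / P (f a) ≠ 0 := fun t ht =>
    (ENNReal.div_pos (hJa a ha t ht) hPt).ne'
  refine (add_le_add_right (natEntropy_le_expect (K a) hρ.le hρ0) _).trans (le_of_eq ?_)
  rw [← expect_const (K a) (surprisal (P (f a))), ← expect_add]
  refine expect_congr_of_support fun t ht => ?_
  rw [← surprisal_mul (P.coe_le_one _) ((ENNReal.le_tsum t).trans hρ.le) hP0 (hρ0 t ht),
    ENNReal.mul_div_cancel hP0 hPt]

/-! ### Ranks in a set of geometric weights -/

section Rank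

/-- The number of elements of `A` below `a`. -/
def rank (A : Finset ℕ) (a : ℕ) : ℕ := (A.filter (· < a)).card

lemma rank_insert_of_lt {A : Finset ℕ} {a b : ℕ} (h : a < b) : rank (insert b A) a = rank A a := by
  rw [rank, rank, Finset.filter_insert, if_neg (by omega)]

lemma rank_insert_self {A : Finset ℕ} {b : ℕ} (h : ∀ a ∈ A, a < b) :
    rank (insert b A) b = A.card := by
  rw [rank, Finset.filter_insert, if_neg (lt_irrefl b), Finset.filter_true_of_mem h]

variable {x : ℝ}

lemma sum_pow_rank (A : Finset ℕ) : ∑ a ∈ A, x ^ rank A a = ∑ i ∈ Finset.range A.card, x ^ i := by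
  induction A using Finset.induction_on_max with
  | empty => simp
  | insert b A hA ih =>
    have hb : b ∉ A := fun h => lt_irrefl b (hA b h)
    rw [Finset.sum_insert hb, rank_insert_self hA, Finset.card_insert_of_notMem hb,
      Finset.sum_range_succ, ← ih, add_comm]
    congr 1
    exact Finset.sum_congr rfl fun a ha => by rw [rank_insert_of_lt (hA a ha)]

/-- Among the sets of `k` exponents below `b`, the last `k` of them have the least total weight. -/
lemma pow_mul_sum_le (hx0 : 0 ≤ x) (hx1 : x ≤ 1) (A : Finset ℕ) {b : ℕ} (hb : ∀ a ∈ A, a < b) :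
    x ^ b * ∑ i ∈ Finset.range A.card, x ^ i ≤ x ^ A.card * ∑ a ∈ A, x ^ a := by
  induction A using Finset.induction_on_max generalizing b with
  | empty => simp
  | insert c A hA ih =>
    have hc : c ∉ A := fun h => lt_irrefl c (hA c h)
    rw [Finset.sum_insert hc, Finset.card_insert_of_notMem hc, Finset.sum_range_succ]
    have h1 := ih hA
    have h2 : x ^ b ≤ x ^ (c + 1) :=
      pow_le_pow_of_le_one hx0 hx1 (hb c (Finset.mem_insert_self _ _))
    have h3 : 0 ≤ ∑ i ∈ Finset.range A.card, x ^ i + x ^ A.card := by positivity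
    have h4 := mul_le_mul_of_nonneg_right h2 h3
    have h5 := mul_le_mul_of_nonneg_left h1 hx0
    rw [pow_succ] at h4 ⊢
    nlinarith

lemma sum_mul_pow_le_mul_sum (hx0 : 0 ≤ x) (k : ℕ) :
    ∑ i ∈ Finset.range k, (i : ℝ) * x ^ i ≤ k * ∑ i ∈ Finset.range k, x ^ i := by
  rw [Finset.mul_sum]
  refine Finset.sum_le_sum fun i hi => mul_le_mul_of_nonneg_right ?_ (pow_nonneg hx0 i)
  exact_mod_cast (Finset.mem_range.1 hi).le

lemma sum_range_pow_pos (hx0 : 0 ≤ x) {k : ℕ} (hk : 0 < k) :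
    0 < ∑ i ∈ Finset.range k, x ^ i := by
  obtain ⟨j, rfl⟩ : ∃ j, k = j + 1 := ⟨k - 1, by omega⟩
  rw [Finset.sum_range_succ', pow_zero]
  exact add_pos_of_nonneg_of_pos (Finset.sum_nonneg fun i _ => pow_nonneg hx0 _) one_pos

lemma mean_range_mono (hx0 : 0 ≤ x) {k t : ℕ} (hkt : k ≤ t) :
    (∑ i ∈ Finset.range k, (i : ℝ) * x ^ i) * ∑ i ∈ Finset.range t, x ^ i ≤
      (∑ i ∈ Finset.range t, (i : ℝ) * x ^ i) * ∑ i ∈ Finset.range k, x ^ i := by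
  induction t, hkt using Nat.le_induction with
  | base => exact le_rfl
  | succ t hkt ih =>
    rw [Finset.sum_range_succ (fun i => (i : ℝ) * x ^ i), Finset.sum_range_succ (fun i => x ^ i),
      mul_add, add_mul]
    have h1 := sum_mul_pow_le_mul_sum hx0 k
    have h2 : (k : ℝ) * ∑ i ∈ Finset.range k, x ^ i ≤ t * ∑ i ∈ Finset.range k, x ^ i :=
      mul_le_mul_of_nonneg_right (by exact_mod_cast hkt)
        (Finset.sum_nonneg fun i _ => pow_nonneg hx0 _)
    have h3 := mul_le_mul_of_nonneg_right (h1.trans h2) (pow_nonneg hx0 t)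
    linarith

lemma mean_rank_le_card (hx0 : 0 ≤ x) (hx1 : x ≤ 1) (A : Finset ℕ) :
    (∑ a ∈ A, (rank A a : ℝ) * x ^ a) * ∑ i ∈ Finset.range A.card, x ^ i ≤
      (∑ a ∈ A, x ^ a) * ∑ i ∈ Finset.range A.card, (i : ℝ) * x ^ i := by
  induction A using Finset.induction_on_max with
  | empty => simp
  | insert b A hA ih =>
    have hb : b ∉ A := fun h => lt_irrefl b (hA b h)
    rw [Finset.sum_insert hb, Finset.sum_insert hb, rank_insert_self hA,
      Finset.card_insert_of_notMem hb, Finset.sum_range_succ, Finset.sum_range_succ]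
    have hR : ∑ a ∈ A, (rank (insert b A) a : ℝ) * x ^ a = ∑ a ∈ A, (rank A a : ℝ) * x ^ a :=
      Finset.sum_congr rfl fun a ha => by rw [rank_insert_of_lt (hA a ha)]
    rw [hR]
    have hkey := pow_mul_sum_le hx0 hx1 A hA
    have hV := sum_mul_pow_le_mul_sum hx0 A.card
    rcases A.eq_empty_or_nonempty with rfl | hne
    · simp
    have hW := sum_range_pow_pos hx0 (Finset.card_pos.2 hne)
    have hy : 0 ≤ x ^ A.card := pow_nonneg hx0 _
    set S := ∑ a ∈ A, x ^ a
    set R := ∑ a ∈ A, (rank A a : ℝ) * x ^ a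
    set W := ∑ i ∈ Finset.range A.card, x ^ i
    set V := ∑ i ∈ Finset.range A.card, (i : ℝ) * x ^ i
    set k : ℝ := (A.card : ℝ)
    set y := x ^ A.card
    set w := x ^ b
    -- after multiplication by `W`, the share of the new maximum is the only loss
    have h1 : 0 ≤ W * (y * (k * S - R) - w * (k * W - V)) := by
      have h2 := mul_le_mul_of_nonneg_left ih hy
      have h3 := mul_le_mul_of_nonneg_right hkey (sub_nonneg.2 hV)
      nlinarith
    have h4 := nonneg_of_mul_nonneg_right h1 hW
    nlinarith

/-- The mean rank in a set of numbers below `t`, with geometric weights, is largest if all numbers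
below `t` are in the set. -/
lemma mean_rank_le (hx0 : 0 ≤ x) (hx1 : x ≤ 1) {t : ℕ} {A : Finset ℕ} (hA : ∀ a ∈ A, a < t) :
    (∑ a ∈ A, (rank A a : ℝ) * x ^ a) * ∑ i ∈ Finset.range t, x ^ i ≤
      (∑ a ∈ A, x ^ a) * ∑ i ∈ Finset.range t, (i : ℝ) * x ^ i := by
  rcases A.eq_empty_or_nonempty with rfl | hne
  · simp
  have hcard : A.card ≤ t := by
    have := Finset.card_le_card fun a ha => Finset.mem_range.2 (hA a ha)
    rwa [Finset.card_range] at this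
  have hW := sum_range_pow_pos hx0 (Finset.card_pos.2 hne)
  have hWt : 0 ≤ ∑ i ∈ Finset.range t, x ^ i := Finset.sum_nonneg fun i _ => pow_nonneg hx0 _
  have hS : 0 ≤ ∑ a ∈ A, x ^ a := Finset.sum_nonneg fun i _ => pow_nonneg hx0 _
  have h1 := mul_le_mul_of_nonneg_right (mean_rank_le_card hx0 hx1 A) hWt
  have h2 := mul_le_mul_of_nonneg_left (mean_range_mono hx0 hcard) hS
  refine le_of_mul_le_mul_right ?_ hW
  linarith

lemma sum_mul_pow_mul (x : ℝ) (t : ℕ) :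
    (∑ i ∈ Finset.range t, (i : ℝ) * x ^ i) * (1 - x) =
      x * (∑ i ∈ Finset.range t, x ^ i) - t * x ^ t := by
  induction t with
  | zero => simp
  | succ t ih =>
    rw [Finset.sum_range_succ, Finset.sum_range_succ, add_mul, ih]
    push_cast; ring

/-- The entropy, in nats, of the geometric distribution, conditioned on values below `t`. -/
noncomputable def truncatedEntropy (x : ℝ) (t : ℕ) : ℝ :=
  Real.log (∑ i ∈ Finset.range t, x ^ i) + -Real.log x *
    ((∑ i ∈ Finset.range t, (i : ℝ) * x ^ i) / ∑ i ∈ Finset.range t, x ^ i)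

/-- The leakage term `H₂((1 - q)^t) / (1 - (1 - q)^t)`, in nats, with `x = 1 - q`. -/
noncomputable def leakage (x : ℝ) (t : ℕ) : ℝ := Real.binEntropy (x ^ t) / (1 - x ^ t)

lemma leakage_nonneg (hx0 : 0 ≤ x) (hx1 : x ≤ 1) (t : ℕ) : 0 ≤ leakage x t :=
  div_nonneg (Real.binEntropy_nonneg (pow_nonneg hx0 _) (pow_le_one₀ hx0 hx1))
    (sub_nonneg.2 (pow_le_one₀ hx0 hx1))

lemma truncatedEntropy_nonneg (hx0 : 0 ≤ x) (hx1 : x ≤ 1) {t : ℕ} (ht : 0 < t) :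
    0 ≤ truncatedEntropy x t := by
  have h1 : 1 ≤ ∑ i ∈ Finset.range t, x ^ i := by
    obtain ⟨j, rfl⟩ : ∃ j, t = j + 1 := ⟨t - 1, by omega⟩
    rw [Finset.sum_range_succ', pow_zero]
    have := Finset.sum_nonneg fun i (_ : i ∈ Finset.range j) => pow_nonneg hx0 (i + 1)
    linarith
  refine add_nonneg (Real.log_nonneg h1) (mul_nonneg ?_ (div_nonneg ?_ (by linarith)))
  · have := Real.log_nonpos hx0 hx1; linarith
  · exact Finset.sum_nonneg fun i _ => mul_nonneg (Nat.cast_nonneg i) (pow_nonneg hx0 _)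

/-- The leakage term is the information on the geometric variable that is revealed by whether it
is below `t`, per probability that it is. -/
lemma leakage_add_truncatedEntropy (hx0 : 0 < x) (hx1 : x < 1) {t : ℕ} (ht : 0 < t) :
    leakage x t + truncatedEntropy x t = -Real.log (1 - x) + -Real.log x * (x / (1 - x)) := by
  have hq : 0 < 1 - x := by linarith
  have hxt : 0 < 1 - x ^ t := sub_pos.2 (pow_lt_one₀ hx0.le hx1 ht.ne')
  have hW : ∑ i ∈ Finset.range t, x ^ i = (1 - x ^ t) / (1 - x) := by
    rw [geom_sum_eq hx1.ne, ← neg_div_neg_eq, neg_sub, neg_sub]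
  have hV : (∑ i ∈ Finset.range t, (i : ℝ) * x ^ i) = (x * ((1 - x ^ t) / (1 - x)) - t * x ^ t) /
      (1 - x) := by
    rw [eq_div_iff hq.ne', sum_mul_pow_mul, hW]
  rw [leakage, truncatedEntropy, hV, hW, Real.log_div hxt.ne' hq.ne',
    Real.binEntropy_eq_negMulLog_add_negMulLog_one_sub, Real.negMulLog, Real.negMulLog,
    Real.log_pow]
  field_simp
  ring

end Rank

/-! ### The entropy of a single output of the timing channel -/

lemma tsum_fibers {y : ℕ → ℕ} (hy : ∀ z, z < y z) (F : ℕ → ℝ≥0∞) :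
    ∑' z, F z = ∑' t, ∑ z ∈ (Finset.range t).filter (y · = t), F z := by
  have h1 : ∀ z, F z = ∑' t, if y z = t then F z else 0 := fun z => by
    rw [tsum_eq_single (y z) fun t ht => if_neg ht.symm, if_pos rfl]
  rw [tsum_congr h1, ENNReal.tsum_comm]
  refine tsum_congr fun t => ?_
  rw [Finset.sum_filter, tsum_eq_sum]
  intro z hz
  rw [if_neg]
  rintro rfl
  exact hz (Finset.mem_range.2 (hy z))

lemma expect_geo_id {q : unitInterval} (hq : 0 < q) :
    expect (geo q) (fun z => (z : ℝ≥0∞)) = ENNReal.ofReal ((1 - q) / q) := by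
  have hq0 : (0 : ℝ) < q := hq
  have hx : (0 : ℝ) ≤ 1 - q := sub_nonneg.2 q.2.2
  have h := expect_geo_add_one hq
  simp only [Nat.cast_add, Nat.cast_one] at h
  rw [expect_add, expect_const] at h
  refine (ENNReal.add_left_inj ENNReal.one_ne_top).1 (h.trans ?_)
  rw [← ENNReal.ofReal_one, ← ENNReal.ofReal_add (by positivity) zero_le_one]
  congr 1; field_simp; ring

lemma geo_apply_ofReal {q : unitInterval} (hq : 0 < q) (z : ℕ) :
    geo q z = ENNReal.ofReal (q * (1 - q) ^ z) := by
  have hq0 : (0 : ℝ) < q := hq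
  have hx : (0 : ℝ) ≤ 1 - q := sub_nonneg.2 q.2.2
  rw [geo_apply hq, ENNReal.ofReal_mul hq0.le, ENNReal.ofReal_pow hx, mul_comm]

lemma natEntropy_geo {q : unitInterval} (hq : 0 < q) (hq1 : (q : ℝ) < 1) :
    natEntropy (geo q) = ENNReal.ofReal (-Real.log q + -Real.log (1 - q) * ((1 - q) / q)) := by
  have hq0 : (0 : ℝ) < q := hq
  have hx : (0 : ℝ) < 1 - q := sub_pos.2 hq1
  have h1 : 0 ≤ -Real.log q := neg_nonneg.2 (Real.log_nonpos hq0.le hq1.le)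
  have h2 : 0 ≤ -Real.log (1 - q) := neg_nonneg.2 (Real.log_nonpos hx.le (by linarith))
  rw [natEntropy, ENNReal.ofReal_add h1 (by positivity), ENNReal.ofReal_mul h2, ← expect_geo_id hq,
    ← expect_const_mul, ← expect_const (geo q) (ENNReal.ofReal (-Real.log q)), ← expect_add]
  congr 1; ext z
  rw [surprisal, geo_apply_ofReal hq, ENNReal.toReal_ofReal (by positivity),
    Real.log_mul hq0.ne' (by positivity), Real.log_pow, ← ENNReal.ofReal_natCast,
    ← ENNReal.ofReal_mul h2, ← ENNReal.ofReal_add h1 (by positivity)]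
  congr 1; ring

lemma rank_weight_le_one {x : ℝ} (hx0 : 0 ≤ x) (hx1 : x ≤ 1) {t : ℕ} (ht : 0 < t) (k : ℕ) :
    x ^ k / ∑ i ∈ Finset.range t, x ^ i ≤ 1 := by
  rw [div_le_one (sum_range_pow_pos hx0 ht)]
  refine (pow_le_one₀ hx0 hx1).trans ?_
  rw [← pow_zero x]
  exact Finset.single_le_sum (f := fun i => x ^ i) (fun i _ => pow_nonneg hx0 i)
    (Finset.mem_range.2 ht)

/-- The entropy of an output `T = V + Z` of the timing channel, where `V` depends on `Z`, is at
least the expected leakage.  Given `T = t`, the variable `Z` is restricted to a subset of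
`{0, …, t - 1}`, and its conditional entropy is at most that for the full set. -/
lemma expect_leakage_le_natEntropy {q : unitInterval} (hq : 0 < q) {y : ℕ → ℕ}
    (hy : ∀ z, z < y z) :
    expect ((geo q).map y) (fun t => ENNReal.ofReal (leakage (1 - q) t)) ≤
      natEntropy ((geo q).map y) := by
  have hq0 : (0 : ℝ) < q := hq
  rcases q.2.2.lt_or_eq with hq1 | hq1
  swap
  · have h : ∀ t, leakage (1 - q) t = 0 := by
      intro t
      rw [leakage, hq1, sub_self]
      rcases t.eq_zero_or_pos with rfl | ht
      · simp
      · rw [zero_pow ht.ne']; simp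
    simp [h, expect]
  have hx : (0 : ℝ) < 1 - q := sub_pos.2 hq1
  set x : ℝ := 1 - q with hxdef
  have hx1 : x < 1 := by rw [hxdef]; linarith
  have hy0 : ∀ z, 0 < y z := fun z => (Nat.zero_le z).trans_lt (hy z)
  have hl : 0 ≤ -Real.log x := neg_nonneg.2 (Real.log_nonpos hx.le hx1.le)
  set J := (geo q).map y with hJ
  set A : ℕ → Finset ℕ := fun t => (Finset.range t).filter (y · = t) with hA
  have hAlt : ∀ t, ∀ z ∈ A t, z < t := fun t z hz => Finset.mem_range.1 (Finset.mem_filter.1 hz).1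
  have hAy : ∀ t, ∀ z ∈ A t, y z = t := fun t z hz => (Finset.mem_filter.1 hz).2
  set W : ℕ → ℝ := fun t => ∑ i ∈ Finset.range t, x ^ i with hW
  have hWpos : ∀ t, 0 < t → 0 < W t := fun t ht => sum_range_pow_pos hx.le ht
  -- a conditional distribution of `Z` given the output, and its product with that of the output
  set b : ℕ → ℝ≥0∞ := fun z => ENNReal.ofReal (x ^ rank (A (y z)) z / W (y z)) with hb
  have hb1 : ∀ z, b z ≤ 1 := fun z =>
    ENNReal.ofReal_le_one.2 (rank_weight_le_one hx.le hx1.le (hy0 z) _)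
  have hb0 : ∀ z, b z ≠ 0 := fun z =>
    (ENNReal.ofReal_pos.2 (div_pos (pow_pos hx _) (hWpos _ (hy0 z)))).ne'
  have hJ0 : ∀ z, geo q z ≠ 0 → J (y z) ≠ 0 := by
    intro z hz
    rw [← PMF.mem_support_iff, hJ, PMF.mem_support_map_iff]
    exact ⟨z, hz, rfl⟩
  have hsum : ∑' z, J (y z) * b z ≤ 1 := by
    rw [tsum_fibers hy, ← J.tsum_coe]
    refine ENNReal.tsum_le_tsum fun t => ?_
    have h1 : ∑ z ∈ A t, J (y z) * b z =
        J t * ENNReal.ofReal (∑ z ∈ A t, x ^ rank (A t) z / W t) := by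
      rw [ENNReal.ofReal_sum_of_nonneg fun z _ =>
        div_nonneg (pow_nonneg hx.le _) (Finset.sum_nonneg fun i _ => pow_nonneg hx.le _),
        Finset.mul_sum]
      exact Finset.sum_congr rfl fun z hz => by rw [hb]; simp only [hAy t z hz]; rfl
    change ∑ z ∈ A t, J (y z) * b z ≤ J t
    rw [h1]
    refine mul_le_of_le_one_right' (ENNReal.ofReal_le_one.2 ?_)
    rw [← Finset.sum_div, sum_pow_rank]
    refine div_le_one_of_le₀ (Finset.sum_le_sum_of_subset_of_nonneg ?_ fun i _ _ =>
      pow_nonneg hx.le _) (Finset.sum_nonneg fun i _ => pow_nonneg hx.le _)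
    have := Finset.card_le_card fun a ha => Finset.mem_range.2 (hAlt t a ha)
    rw [Finset.card_range] at this
    exact Finset.range_subset_range.2 this
  have hgibbs := natEntropy_le_expect (geo q) hsum fun z hz => mul_ne_zero (hJ0 z hz) (hb0 z)
  have hsplit : expect (geo q) (fun z => surprisal (J (y z) * b z)) ≤
      natEntropy J + expect (geo q) fun z => surprisal (b z) := by
    rw [natEntropy]
    nth_rewrite 2 [hJ]
    rw [expect_map, ← expect_add]
    exact expect_mono fun z => surprisal_mul_le (J.coe_le_one _) (hb1 z)
  -- the conditional entropy, with the help of the bound on the mean rank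
  have hcond : expect (geo q) (fun z => surprisal (b z)) ≤
      expect (geo q) fun z => ENNReal.ofReal (truncatedEntropy x (y z)) := by
    rw [expect, expect, tsum_fibers hy fun z => geo q z * surprisal (b z),
      tsum_fibers hy fun z => geo q z * ENNReal.ofReal (truncatedEntropy x (y z))]
    refine ENNReal.tsum_le_tsum fun t => ?_
    change ∑ z ∈ A t, geo q z * surprisal (b z) ≤
      ∑ z ∈ A t, geo q z * ENNReal.ofReal (truncatedEntropy x (y z))
    rcases t.eq_zero_or_pos with rfl | ht
    · simp [hA]
    have h1 : ∀ z ∈ A t, geo q z * surprisal (b z) =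
        ENNReal.ofReal (q * (Real.log (W t) * x ^ z + -Real.log x * (rank (A t) z * x ^ z))) := by
      intro z hz
      rw [geo_apply_ofReal hq, surprisal, hb]
      simp only [hAy t z hz]
      rw [ENNReal.toReal_ofReal (div_nonneg (pow_nonneg hx.le _) (hWpos t ht).le),
        ← ENNReal.ofReal_mul (by positivity), Real.log_div (pow_pos hx _).ne' (hWpos t ht).ne',
        Real.log_pow]
      congr 1; ring
    have h2 : ∀ z ∈ A t, geo q z * ENNReal.ofReal (truncatedEntropy x (y z)) =
        ENNReal.ofReal (q * (x ^ z * truncatedEntropy x t)) := by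
      intro z hz
      rw [geo_apply_ofReal hq, hAy t z hz, ← ENNReal.ofReal_mul (by positivity)]
      congr 1; ring
    have hlogW : 0 ≤ Real.log (W t) := by
      refine Real.log_nonneg ?_
      have := rank_weight_le_one hx.le hx1.le ht 0
      rwa [pow_zero, div_le_one (hWpos t ht)] at this
    rw [Finset.sum_congr rfl h1, Finset.sum_congr rfl h2,
      ← ENNReal.ofReal_sum_of_nonneg fun z _ => by positivity,
      ← ENNReal.ofReal_sum_of_nonneg fun z _ => mul_nonneg hq0.le
        (mul_nonneg (pow_nonneg hx.le _) (truncatedEntropy_nonneg hx.le hx1.le ht)),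
      ← Finset.mul_sum, ← Finset.mul_sum, Finset.sum_add_distrib, ← Finset.mul_sum,
      ← Finset.mul_sum, ← Finset.sum_mul]
    refine ENNReal.ofReal_le_ofReal (mul_le_mul_of_nonneg_left ?_ hq0.le)
    have h3 := mean_rank_le hx.le hx1.le (hAlt t)
    have h4 : ∑ z ∈ A t, (rank (A t) z : ℝ) * x ^ z ≤ (∑ z ∈ A t, x ^ z) *
        ((∑ i ∈ Finset.range t, (i : ℝ) * x ^ i) / W t) := by
      rw [← mul_div_assoc, le_div_iff₀ (hWpos t ht)]
      exact h3
    have h5 := mul_le_mul_of_nonneg_left h4 hl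
    rw [truncatedEntropy]
    linarith
  -- both summands of the entropy of `Z`
  have hH : natEntropy (geo q) =
      expect (geo q) (fun z => ENNReal.ofReal (leakage x (y z))) +
        expect (geo q) fun z => ENNReal.ofReal (truncatedEntropy x (y z)) := by
    rw [← expect_add, natEntropy_geo hq hq1, ← expect_const (geo q)
      (ENNReal.ofReal (-Real.log q + -Real.log (1 - q) * ((1 - q) / q)))]
    congr 1; ext z
    rw [← ENNReal.ofReal_add (leakage_nonneg hx.le hx1.le _)
      (truncatedEntropy_nonneg hx.le hx1.le (hy0 z)),
      leakage_add_truncatedEntropy hx hx1 (hy0 z), hxdef]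
    congr 3 <;> ring_nf
  have hfin : expect (geo q) (fun z => ENNReal.ofReal (truncatedEntropy x (y z))) ≠ ∞ := by
    have : natEntropy (geo q) ≠ ∞ := by rw [natEntropy_geo hq hq1]; exact ENNReal.ofReal_ne_top
    rw [hH] at this
    exact (ENNReal.add_ne_top.1 this).2
  rw [hJ, expect_map, ← hJ]
  refine (ENNReal.add_le_add_iff_right hfin).1 ?_
  rw [← hH]
  exact hgibbs.trans (hsplit.trans (by gcongr))

/-! ### The converse for codes over the timing channel -/

/-- The law of the first `m` output times, newest first, under the rule `r`. -/
noncomputable def timesLaw (q : unitInterval) (r : List ℕ → ℕ) (m : ℕ) : PMF (List ℕ) :=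
  (iidList (geo q) m).map (times r)

lemma timesLaw_succ (q : unitInterval) (r : List ℕ → ℕ) (m : ℕ) :
    timesLaw q r (m + 1) = (iidList (geo q) m).bind fun l =>
      ((geo q).map fun z => r (z :: l) + z).map fun t => t :: times r l :=
  ext_of_expect fun F => by
    simp only [timesLaw, expect_map, expect_bind, expect_iidList_succ, times]

lemma sum_leakage_le_natEntropy {q : unitInterval} (hq : 0 < q) {r : List ℕ → ℕ}
    (hr : ∀ l, 1 ≤ r l) (m : ℕ) :
    ∑ k ∈ Finset.range m, expect (iidList (geo q) (k + 1))
      (fun l => ENNReal.ofReal (leakage (1 - q) ((times r l).headD 0))) ≤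
        natEntropy (timesLaw q r m) := by
  induction m with
  | zero => simp
  | succ m ih =>
    rw [Finset.sum_range_succ, timesLaw_succ]
    refine le_trans (add_le_add ih ?_) (add_natEntropy_le (iidList (geo q) m) (times r)
      fun l => (geo q).map fun z => r (z :: l) + z)
    rw [expect_iidList_succ]
    refine expect_mono fun l => ?_
    have h := expect_leakage_le_natEntropy hq (y := fun z => r (z :: l) + z) fun z => by
      have := hr (z :: l); omega
    rw [expect_map] at h
    exact h

/-- The law of a list (newest first) of `m` independent entries with the given laws. -/
noncomputable def indepList (p : ℕ → PMF ℕ) : ℕ → PMF (List ℕ)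
  | 0 => PMF.pure []
  | m + 1 => (indepList p m).bind fun l => (p m).map fun t => t :: l

lemma indepList_cons (p : ℕ → PMF ℕ) (m t : ℕ) (l : List ℕ) :
    indepList p (m + 1) (t :: l) = indepList p m l * p m t :=
  bind_map_cons_apply _ (fun _ => p m) t l

section Messages

variable {W : Type} [Fintype W] [Nonempty W]

/-- The law of the output time with index `k`, for a random message. -/
noncomputable def timeLaw (q : unitInterval) (r : W → List ℕ → ℕ) (k : ℕ) : PMF ℕ :=
  (unif W).bind fun w => (iidList (geo q) (k + 1)).map fun l => (times (r w) l).headD 0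

lemma expect_timeLaw (q : unitInterval) (r : W → List ℕ → ℕ) (k : ℕ) (F : ℕ → ℝ≥0∞) :
    expect (timeLaw q r k) F = expect (unif W) fun w =>
      expect (iidList (geo q) (k + 1)) fun l => F ((times (r w) l).headD 0) := by
  simp only [timeLaw, expect_bind, expect_map]

lemma mem_support_unif (w : W) : w ∈ (unif W).support := by
  rw [unif, PMF.support_uniformOfFintype]; exact Set.mem_univ w

lemma indepList_timeLaw_ne_zero {q : unitInterval} (r : W → List ℕ → ℕ) (w : W) {m : ℕ}
    {l : List ℕ} (hl : l ∈ (iidList (geo q) m).support) :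
    indepList (timeLaw q r) m (times (r w) l) ≠ 0 := by
  induction m generalizing l with
  | zero => simp [iidList] at hl; simp [hl, times, indepList]
  | succ m ih =>
    have hl' := hl
    simp only [iidList, PMF.mem_support_bind_iff, PMF.mem_support_map_iff] at hl
    obtain ⟨l₀, hl₀, z, hz, rfl⟩ := hl
    rw [times, indepList_cons]
    refine mul_ne_zero (ih hl₀) ?_
    rw [← PMF.mem_support_iff, timeLaw, PMF.mem_support_bind_iff]
    refine ⟨w, mem_support_unif w, ?_⟩
    rw [PMF.mem_support_map_iff]
    exact ⟨z :: l₀, hl', rfl⟩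

lemma expect_surprisal_indepList_le (q : unitInterval) (r : W → List ℕ → ℕ) (m : ℕ) :
    expect (unif W) (fun w => expect (iidList (geo q) m) fun l =>
      surprisal (indepList (timeLaw q r) m (times (r w) l))) ≤
        ∑ k ∈ Finset.range m, natEntropy (timeLaw q r k) := by
  induction m with
  | zero => simp [iidList, times, indepList, surprisal, expect]
  | succ m ih =>
    rw [Finset.sum_range_succ, natEntropy, expect_timeLaw]
    refine le_trans ?_ (add_le_add_left ih _)
    rw [← expect_add]
    refine expect_mono fun w => ?_
    rw [expect_iidList_succ, expect_iidList_succ, ← expect_add]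
    refine expect_mono fun l => ?_
    rw [← expect_const (geo q) (surprisal (indepList (timeLaw q r) m (times (r w) l))),
      ← expect_add]
    refine expect_mono fun z => ?_
    rw [times, indepList_cons]
    exact surprisal_mul_le (PMF.coe_le_one _ _) (PMF.coe_le_one _ _)

lemma surprisal_natCast_inv {n : ℕ} : surprisal (n : ℝ≥0∞)⁻¹ = ENNReal.ofReal (Real.log n) := by
  rw [surprisal, ENNReal.toReal_inv, ENNReal.toReal_natCast, Real.log_inv, neg_neg]

/-- Fano's inequality for a code over the timing channel.  It is Gibbs' inequality for the joint
law of the message and the output times, compared with independent times and a message that equals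
the decoded one with probability about one half. -/
lemma log_card_add_leakage_le {q : unitInterval} (hq : 0 < q) {r : W → List ℕ → ℕ}
    (hr : ∀ w l, 1 ≤ r w l) (d : List ℕ → W) (m : ℕ) :
    ENNReal.ofReal (Real.log (Fintype.card W)) + ∑ k ∈ Finset.range m,
        expect (timeLaw q r k) (fun t => ENNReal.ofReal (leakage (1 - q) t)) ≤
      ∑ k ∈ Finset.range m, natEntropy (timeLaw q r k) + (ENNReal.ofReal (Real.log 2) +
        ENNReal.ofReal (Real.log (Fintype.card W)) * expect (unif W) fun w =>
          (iidList (geo q) m).toOuterMeasure {l | d (times (r w) l) ≠ w}) := by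
  classical
  set M := Fintype.card W with hM
  have hM0 : (M : ℝ≥0∞) ≠ 0 := by exact_mod_cast Fintype.card_ne_zero
  have hM1 : (M : ℝ≥0∞)⁻¹ ≤ 1 :=
    ENNReal.inv_le_one.2 (by exact_mod_cast Nat.one_le_iff_ne_zero.2 Fintype.card_ne_zero)
  have hMt : (M : ℝ≥0∞) ≠ ∞ := ENNReal.natCast_ne_top _
  have hMi : (M : ℝ≥0∞)⁻¹ ≠ 0 := ENNReal.inv_ne_zero.2 hMt
  set P : W → PMF (List ℕ) := fun w => timesLaw q (r w) m with hP
  set J := blockLaw (unif W) P with hJ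
  set Q := indepList (timeLaw q r) m with hQ
  set g : W → List ℕ → ℝ≥0∞ := fun w t => if d t = w then 1 else (M : ℝ≥0∞)⁻¹ with hg
  have hg1 : ∀ w t, g w t ≤ 1 := fun w t => by rw [hg]; dsimp only; split_ifs <;> simp [hM1]
  have hg0 : ∀ w t, g w t ≠ 0 := fun w t => by rw [hg]; dsimp only; split_ifs <;> simp [hMi]
  have hunif : ∀ w, unif W w = (M : ℝ≥0∞)⁻¹ := fun w => by simp [unif, hM]
  have hJapp : ∀ w t, J (w, t) = (M : ℝ≥0∞)⁻¹ * P w t := by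
    intro w t
    rw [hJ, blockLaw, PMF.bind_apply, tsum_eq_single w]
    · rw [hunif, PMF.map_apply, tsum_eq_single t]
      · simp
      · intro t' ht'; simp [ht'.symm]
    · intro w' hw'
      rw [PMF.map_apply, ENNReal.tsum_eq_zero.2, mul_zero]
      intro t'; simp [hw'.symm]
  have hhalf : (2 : ℝ≥0∞)⁻¹ ≤ 1 := ENNReal.inv_le_one.2 (by norm_num)
  have hhalf0 : (2 : ℝ≥0∞)⁻¹ ≠ 0 := by simp
  have hsum : ∑' b : W × List ℕ, Q b.2 * (2⁻¹ * g b.1 b.2) ≤ 1 := by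
    rw [ENNReal.tsum_prod', ENNReal.tsum_comm, ← Q.tsum_coe]
    refine ENNReal.tsum_le_tsum fun t => ?_
    dsimp only
    rw [ENNReal.tsum_mul_left, ENNReal.tsum_mul_left, tsum_fintype]
    refine mul_le_of_le_one_right' ?_
    have h1 : ∑ w, g w t ≤ 2 := by
      calc ∑ w, g w t ≤ ∑ w, ((if d t = w then 1 else 0) + (M : ℝ≥0∞)⁻¹) :=
            Finset.sum_le_sum fun w _ => by rw [hg]; dsimp only; split_ifs <;> simp
        _ = 2 := by
            rw [Finset.sum_add_distrib, Finset.sum_ite_eq, if_pos (Finset.mem_univ _),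
              Finset.sum_const, Finset.card_univ, ← hM, nsmul_eq_mul, ENNReal.mul_inv_cancel hM0 hMt,
              one_add_one_eq_two]
    calc 2⁻¹ * ∑ w, g w t ≤ 2⁻¹ * 2 := by gcongr
      _ = 1 := ENNReal.inv_mul_cancel (by norm_num) (by norm_num)
  have hQ0 : ∀ w, ∀ t ∈ (P w).support, Q t ≠ 0 := by
    intro w t ht
    simp only [hP, timesLaw, PMF.mem_support_map_iff] at ht
    obtain ⟨l, hl, rfl⟩ := ht
    exact indepList_timeLaw_ne_zero r w hl
  have hgibbs := natEntropy_le_expect J hsum (by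
    rintro ⟨w, t⟩ hwt
    rw [hJapp] at hwt
    exact mul_ne_zero (hQ0 w t ((P w).mem_support_iff t |>.2 (right_ne_zero_of_mul hwt)))
      (mul_ne_zero hhalf0 (hg0 w t)))
  have hleft : ENNReal.ofReal (Real.log M) + ∑ k ∈ Finset.range m,
      expect (timeLaw q r k) (fun t => ENNReal.ofReal (leakage (1 - q) t)) ≤ natEntropy J := by
    have h1 : natEntropy J = expect (unif W) fun w => ENNReal.ofReal (Real.log M) +
        natEntropy (P w) := by
      rw [natEntropy]
      nth_rewrite 1 [hJ]
      rw [expect_blockLaw]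
      congr 1; ext w
      rw [natEntropy, ← expect_const (P w) (ENNReal.ofReal (Real.log M)), ← expect_add]
      refine expect_congr_of_support fun t ht => ?_
      rw [hJapp, surprisal_mul hM1 (PMF.coe_le_one _ _) hMi ((P w).mem_support_iff t |>.1 ht),
        surprisal_natCast_inv]
    have h2 : ∑ k ∈ Finset.range m, expect (timeLaw q r k)
        (fun t => ENNReal.ofReal (leakage (1 - q) t)) = expect (unif W) fun w =>
        ∑ k ∈ Finset.range m, expect (iidList (geo q) (k + 1))
          (fun l => ENNReal.ofReal (leakage (1 - q) ((times (r w) l).headD 0))) := by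
      simp only [expect_timeLaw]
      simp only [expect_unif, ENNReal.div_eq_inv_mul]
      rw [← Finset.mul_sum, Finset.sum_comm]
    rw [h1, expect_add, expect_const, h2]
    exact add_le_add_right (expect_mono fun w => sum_leakage_le_natEntropy hq (hr w) m) _
  refine hleft.trans (hgibbs.trans ?_)
  rw [hJ, expect_blockLaw]
  have hterm : ∀ w t, surprisal (Q t * (2⁻¹ * g w t)) ≤ surprisal (Q t) +
      (ENNReal.ofReal (Real.log 2) + ENNReal.ofReal (Real.log M) * if d t ≠ w then 1 else 0) := by
    intro w t
    refine (surprisal_mul_le (PMF.coe_le_one _ _) (mul_le_one' hhalf (hg1 w t))).trans ?_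
    gcongr
    refine (surprisal_mul_le hhalf (hg1 w t)).trans (le_of_eq ?_)
    congr 1
    · exact_mod_cast surprisal_natCast_inv (n := 2)
    · rw [hg]; dsimp only
      by_cases h : d t = w
      · rw [if_pos h, if_neg (not_not.2 h), mul_zero, surprisal]; simp
      · rw [if_neg h, if_pos h, mul_one, surprisal_natCast_inv]
  refine (expect_mono fun w => expect_mono fun t => hterm w t).trans ?_
  simp only [hP, timesLaw, expect_map, expect_add, expect_const, expect_const_mul]
  refine add_le_add (expect_surprisal_indepList_le q r m) (add_le_add le_rfl (le_of_eq ?_))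
  congr 2; ext w
  rw [toOuterMeasure_eq_expect]
  congr 1; ext l
  by_cases h : d (times (r w) l) = w <;> simp [h]

end Messages

/-! ### Distributions of finite mean and the objective -/

/-- The exponential weights have the largest entropy for a given mean. -/
lemma negMulLog_le (a : ℝ) {y : ℝ} (hy : 0 ≤ y) :
    Real.negMulLog y ≤ a * y + Real.exp (-a - 1) := by
  have h := Real.negMulLog_le_one_sub_self (mul_nonneg hy (Real.exp_pos (a + 1)).le)
  rw [Real.negMulLog_mul, Real.negMulLog, Real.negMulLog, Real.log_exp] at h
  have h1 := mul_le_mul_of_nonneg_right h (Real.exp_pos (-a - 1)).le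
  have h2 : Real.exp (a + 1) * Real.exp (-a - 1) = 1 := by
    rw [← Real.exp_add, ← Real.exp_zero]; congr 1; ring
  rw [Real.negMulLog]
  have h3 : (Real.exp (a + 1) * (-y * Real.log y) + y * (-Real.exp (a + 1) * (a + 1))) *
      Real.exp (-a - 1) = (-y * Real.log y - y * (a + 1)) *
        (Real.exp (a + 1) * Real.exp (-a - 1)) := by ring
  have h4 : (1 - y * Real.exp (a + 1)) * Real.exp (-a - 1) = Real.exp (-a - 1) -
      y * (Real.exp (a + 1) * Real.exp (-a - 1)) := by ring
  rw [h3, h4, h2] at h1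
  linarith

lemma summable_exp_neg {a : ℝ} (ha : 0 < a) : Summable fun t : ℕ => Real.exp (-(a * t) - 1) := by
  have h := (summable_geometric_of_lt_one (Real.exp_pos (-a)).le
    (Real.exp_lt_one_iff.2 (by linarith))).mul_left (Real.exp (-1))
  refine h.congr fun t => ?_
  rw [← Real.exp_nat_mul, ← Real.exp_add]
  congr 1; ring

section TimePMF

variable {p : ℕ → ℝ}

lemma IsTimePMF.le_one (hp : IsTimePMF p) (t : ℕ) : p t ≤ 1 :=
  le_hasSum hp.hasSum t fun s _ => hp.nonneg s

lemma IsTimePMF.negMulLog_nonneg (hp : IsTimePMF p) (t : ℕ) : 0 ≤ Real.negMulLog (p t) :=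
  Real.negMulLog_nonneg (hp.nonneg t) (hp.le_one t)

lemma IsTimePMF.summable_negMulLog (hp : IsTimePMF p) :
    Summable fun t => Real.negMulLog (p t) := by
  refine Summable.of_nonneg_of_le hp.negMulLog_nonneg (fun t => ?_)
    (hp.summable_mean.add (summable_exp_neg one_pos))
  simpa using negMulLog_le (t : ℝ) (hp.nonneg t)

lemma leakage_le {q : unitInterval} (hq : 0 < q) (t : ℕ) :
    leakage (1 - q) t ≤ Real.log 2 / q := by
  have hq0 : (0 : ℝ) < q := hq
  have hx : (0 : ℝ) ≤ 1 - q := sub_nonneg.2 q.2.2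
  have hlog : 0 ≤ Real.log 2 := Real.log_nonneg one_le_two
  rcases t.eq_zero_or_pos with rfl | ht
  · rw [leakage]; simp; positivity
  refine div_le_div₀ hlog Real.binEntropy_le_log_two hq0 ?_
  have := pow_le_of_le_one hx (by linarith) ht.ne'
  linarith

lemma leakage_one_sub_nonneg (q : unitInterval) (t : ℕ) : 0 ≤ leakage (1 - q) t :=
  leakage_nonneg (sub_nonneg.2 q.2.2) (by linarith [q.2.1]) t

lemma IsTimePMF.summable_leakage (hp : IsTimePMF p) {q : unitInterval} (hq : 0 < q) :
    Summable fun t => leakage (1 - q) t * p t :=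
  Summable.of_nonneg_of_le (fun t => mul_nonneg (leakage_one_sub_nonneg q t) (hp.nonneg t))
    (fun t => mul_le_mul_of_nonneg_right (leakage_le hq t) (hp.nonneg t))
    (hp.hasSum.summable.mul_left _)

lemma IsTimePMF.one_le_mean (hp : IsTimePMF p) : 1 ≤ ∑' t : ℕ, (t : ℝ) * p t := by
  rw [← hp.hasSum.tsum_eq]
  refine hp.hasSum.summable.tsum_le_tsum (fun t => ?_) hp.summable_mean
  rcases t.eq_zero_or_pos with rfl | ht
  · simp [hp.zero]
  · exact le_mul_of_one_le_left (hp.nonneg t) (by exact_mod_cast ht)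

lemma leakageObjective_eq (q : unitInterval) (p : ℕ → ℝ) :
    leakageObjective q p = (∑' t, Real.negMulLog (p t) - ∑' t, leakage (1 - q) t * p t) /
      (Real.log 2 * ∑' t : ℕ, (t : ℝ) * p t) := by
  have h : ∀ t, binaryEntropy ((1 - (q : ℝ)) ^ t) / (1 - (1 - (q : ℝ)) ^ t) * p t =
      leakage (1 - q) t * p t / Real.log 2 := fun t => by
    rw [binaryEntropy, leakage]; ring
  rw [leakageObjective, entropy, tsum_congr h, tsum_div_const, ← sub_div, div_div]

lemma IsTimePMF.leakageObjective_le_iff (hp : IsTimePMF p) (q : unitInterval) (C : ℝ) :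
    leakageObjective q p ≤ C ↔ ∑' t, Real.negMulLog (p t) - ∑' t, leakage (1 - q) t * p t ≤
      C * Real.log 2 * ∑' t : ℕ, (t : ℝ) * p t := by
  have hm := hp.one_le_mean
  have hl := Real.log_pos one_lt_two
  rw [leakageObjective_eq, div_le_iff₀ (by positivity), mul_assoc]

end TimePMF

/-- The bound on the objective as an inequality for the entropy of an output time. -/
lemma natEntropy_le_of_leakageObjective_le {q : unitInterval} (hq : 0 < q) {C : ℝ} (hC0 : 0 ≤ C)
    (hC : ∀ f ∈ leakageSet q, leakageObjective q f ≤ C) (p : PMF ℕ) (hp0 : p 0 = 0)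
    (hp : expect p (fun t => (t : ℝ≥0∞)) ≠ ∞)
    (hps : ∀ s, ∑ t ∈ Finset.Icc 1 s, p t ≤ ENNReal.ofReal (1 - (1 - q) ^ s)) :
    natEntropy p ≤ expect p (fun t => ENNReal.ofReal (leakage (1 - q) t)) +
      ENNReal.ofReal (C * Real.log 2) * expect p fun t => (t : ℝ≥0∞) := by
  have hlog : 0 ≤ Real.log 2 := Real.log_nonneg one_le_two
  set f : ℕ → ℝ := fun t => (p t).toReal with hf
  have hpf : ∀ t, p t = ENNReal.ofReal (f t) := fun t =>
    (ENNReal.ofReal_toReal (p.apply_ne_top t)).symm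
  have hf0 : ∀ t, 0 ≤ f t := fun t => ENNReal.toReal_nonneg
  have hmean : Summable fun t : ℕ => (t : ℝ) * f t := by
    have := ENNReal.summable_toReal hp
    refine this.congr fun t => ?_
    rw [ENNReal.toReal_mul, ENNReal.toReal_natCast, mul_comm]
  have hpmf : IsTimePMF f := by
    refine ⟨by simp [hf, hp0], hf0, ?_, hmean⟩
    rw [← tsum_toReal p]
    exact (summable_toReal p).hasSum
  have hx : (0 : ℝ) ≤ 1 - q := sub_nonneg.2 q.2.2
  have hmem : f ∈ leakageSet q := by
    refine ⟨hpmf, fun s _ => ?_⟩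
    have h1 := hps s
    simp only [hpf] at h1
    rw [← ENNReal.ofReal_sum_of_nonneg fun t _ => hf0 t] at h1
    refine (ENNReal.ofReal_le_ofReal_iff ?_).1 h1
    exact sub_nonneg.2 (pow_le_one₀ hx (by linarith [q.2.1]))
  have h := (hpmf.leakageObjective_le_iff q C).1 (hC f hmem)
  have e1 : natEntropy p = ENNReal.ofReal (∑' t, Real.negMulLog (f t)) := by
    rw [ENNReal.ofReal_tsum_of_nonneg hpmf.negMulLog_nonneg hpmf.summable_negMulLog]
    refine tsum_congr fun t => ?_
    change p t * ENNReal.ofReal (-Real.log (f t)) = _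
    rw [hpf, ← ENNReal.ofReal_mul (hf0 t), Real.negMulLog]
    congr 1; ring
  have e2 : expect p (fun t => ENNReal.ofReal (leakage (1 - q) t)) =
      ENNReal.ofReal (∑' t, leakage (1 - q) t * f t) := by
    rw [ENNReal.ofReal_tsum_of_nonneg (fun t => mul_nonneg (leakage_one_sub_nonneg q t) (hf0 t))
      (hpmf.summable_leakage hq)]
    refine tsum_congr fun t => ?_
    rw [hpf, ← ENNReal.ofReal_mul (hf0 t), mul_comm]
  have e3 : expect p (fun t => (t : ℝ≥0∞)) = ENNReal.ofReal (∑' t : ℕ, (t : ℝ) * f t) := by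
    rw [ENNReal.ofReal_tsum_of_nonneg (fun t => mul_nonneg (Nat.cast_nonneg t) (hf0 t)) hmean]
    refine tsum_congr fun t => ?_
    dsimp only
    rw [hpf, ← ENNReal.ofReal_natCast, ← ENNReal.ofReal_mul (hf0 t), mul_comm]
  have hm := hpmf.one_le_mean
  rw [e1, e2, e3, ← ENNReal.ofReal_mul (by positivity), ← ENNReal.ofReal_add
    (tsum_nonneg fun t => mul_nonneg (leakage_one_sub_nonneg q t) (hf0 t)) (by positivity)]
  exact ENNReal.ofReal_le_ofReal (by linarith)

section Messages

variable {W : Type} [Fintype W] [Nonempty W]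

lemma timeLaw_zero (q : unitInterval) {r : W → List ℕ → ℕ} (hr : ∀ w l, 1 ≤ r w l) (k : ℕ) :
    timeLaw q r k 0 = 0 := by
  classical
  rw [← PMF.toOuterMeasure_apply_singleton, toOuterMeasure_eq_expect, expect_timeLaw]
  simp only [expect_iidList_succ]
  refine le_antisymm ?_ zero_le
  rw [← expect_const (unif W) 0]
  refine expect_mono fun w => ?_
  rw [← expect_const (iidList (geo q) k) 0]
  refine expect_mono fun l => ?_
  rw [← expect_const (geo q) 0]
  refine expect_mono fun z => ?_
  rw [Set.indicator_of_notMem]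
  have := hr w (z :: l)
  rw [Set.mem_singleton_iff, times, List.headD_cons]
  omega

/-- An output time is at least one more than the idle time. -/
lemma sum_timeLaw_le {q : unitInterval} (hq : 0 < q) {r : W → List ℕ → ℕ}
    (hr : ∀ w l, 1 ≤ r w l) (k s : ℕ) :
    ∑ t ∈ Finset.Icc 1 s, timeLaw q r k t ≤ ENNReal.ofReal (1 - (1 - q) ^ s) := by
  classical
  have hq0 : (0 : ℝ) < q := hq
  have hx : (0 : ℝ) ≤ 1 - q := sub_nonneg.2 q.2.2
  have hgeo : (geo q).toOuterMeasure (Finset.range s : Set ℕ) =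
      ENNReal.ofReal (1 - (1 - q) ^ s) := by
    rw [PMF.toOuterMeasure_apply_finset]
    simp only [geo_apply_ofReal hq]
    rw [← ENNReal.ofReal_sum_of_nonneg fun z _ => mul_nonneg hq0.le (pow_nonneg hx _),
      ← Finset.mul_sum]
    congr 1
    have := mul_neg_geom_sum (1 - (q : ℝ)) s
    rwa [sub_sub_cancel] at this
  rw [← PMF.toOuterMeasure_apply_finset, toOuterMeasure_eq_expect, expect_timeLaw, ← hgeo,
    ← expect_const (unif W) ((geo q).toOuterMeasure _)]
  refine expect_mono fun w => ?_
  rw [expect_iidList_succ, ← expect_const (iidList (geo q) k) ((geo q).toOuterMeasure _)]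
  refine expect_mono fun l => ?_
  rw [toOuterMeasure_eq_expect]
  refine expect_mono fun z => ?_
  by_cases hz : z < s
  · rw [Set.indicator_of_mem (s := (Finset.range s : Set ℕ)) (by simpa using hz)]
    exact Set.indicator_le_self' (fun _ _ => zero_le) _
  · rw [Set.indicator_of_notMem]
    · exact zero_le
    · have := hr w (z :: l)
      rw [times, List.headD_cons]
      simp
      omega

lemma sum_expect_timeLaw (q : unitInterval) (r : W → List ℕ → ℕ) (m : ℕ) :
    ∑ k ∈ Finset.range m, expect (timeLaw q r k) (fun t => (t : ℝ≥0∞)) =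
      expect (unif W) fun w => expect (iidList (geo q) m) fun l =>
        ((times (r w) l).sum : ℝ≥0∞) := by
  induction m with
  | zero => simp [iidList, times, expect]
  | succ m ih =>
    rw [Finset.sum_range_succ, ih, expect_timeLaw, ← expect_add]
    congr 1; ext w
    rw [expect_iidList_succ, expect_iidList_succ, ← expect_add]
    congr 1; ext l
    rw [← expect_const (geo q) ((times (r w) l).sum : ℝ≥0∞), ← expect_add]
    congr 1; ext z
    rw [times, List.headD_cons, List.sum_cons, Nat.cast_add (r w (z :: l) + z), add_comm]

end Messages

/-- The converse: rates above a bound on the objective are not achievable. -/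
lemma le_of_timingAchievable {q : unitInterval} (hq : 0 < q) {C : ℝ} (hC0 : 0 ≤ C)
    (hC : ∀ f ∈ leakageSet q, leakageObjective q f ≤ C) {R : ℝ} (hR : TimingAchievable q R) :
    R ≤ C := by
  by_contra! hlt
  have hR0 : 0 < R := hC0.trans_lt hlt
  have hq0 : (0 : ℝ) < q := hq
  have hlog := Real.log_pos one_lt_two
  have hε : 0 < (R - C) / (2 * R) := div_pos (by linarith) (by linarith)
  obtain ⟨m, ⟨M, hM, c, hrate, herr⟩, hm⟩ :=
    ((hR _ hε).and (eventually_gt_atTop ⌈2 / (R - C)⌉₊)).exists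
  have hm' : 2 / (R - C) < m := (Nat.le_ceil _).trans_lt (by exact_mod_cast hm)
  have : NeZero M := ⟨hM.ne'⟩
  obtain ⟨r, d, hr, he, ht⟩ := c.exists_rule q
  have hlogb0 : 0 ≤ Real.logb 2 M := Real.logb_nonneg one_lt_two (by exact_mod_cast hM)
  have hlogM0 : 0 ≤ Real.log M := Real.log_nonneg (by exact_mod_cast hM)
  have hTtop : c.expectedTime q ≠ ∞ := by
    intro htop
    rw [htop, ENNReal.mul_top (by simpa using hR0)] at hrate
    exact absurd hrate (by simp)
  obtain ⟨τ, hτ0, hτe⟩ : ∃ τ : ℝ, 0 ≤ τ ∧ c.expectedTime q = ENNReal.ofReal τ :=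
    ⟨_, ENNReal.toReal_nonneg, (ENNReal.ofReal_toReal hTtop).symm⟩
  have hτm : (m : ℝ) ≤ τ := by
    have := timing_expectedTime_ge (m := m) q hr
    rw [← ht, hτe, ← ENNReal.ofReal_natCast, ENNReal.ofReal_le_ofReal_iff hτ0] at this
    exact this
  have hRτ : R * τ * Real.log 2 ≤ Real.log M := by
    rw [hτe, ← ENNReal.ofReal_mul hR0.le, ENNReal.ofReal_le_ofReal_iff hlogb0, Real.logb,
      le_div_iff₀ hlog] at hrate
    exact hrate
  rw [← sum_expect_timeLaw, hτe] at ht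
  have hfin : ∀ k ∈ Finset.range m, expect (timeLaw q r k) (fun t => (t : ℝ≥0∞)) ≠ ∞ :=
    ENNReal.sum_ne_top.1 (by rw [← ht]; exact ENNReal.ofReal_ne_top)
  have hfano := log_card_add_leakage_le hq hr d m
  rw [← he, Fintype.card_fin] at hfano
  set D := ∑ k ∈ Finset.range m,
    expect (timeLaw q r k) (fun t => ENNReal.ofReal (leakage (1 - q) t)) with hD
  have hDtop : D ≠ ∞ := by
    refine ENNReal.sum_ne_top.2 fun k _ => ne_top_of_le_ne_top
      (ENNReal.ofReal_ne_top (r := Real.log 2 / q)) ?_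
    rw [← expect_const (timeLaw q r k) (ENNReal.ofReal (Real.log 2 / q))]
    exact expect_mono fun t => ENNReal.ofReal_le_ofReal (leakage_le hq t)
  have hent : ∑ k ∈ Finset.range m, natEntropy (timeLaw q r k) ≤
      D + ENNReal.ofReal (C * Real.log 2) * ENNReal.ofReal τ := by
    rw [ht, Finset.mul_sum, hD, ← Finset.sum_add_distrib]
    exact Finset.sum_le_sum fun k hk => natEntropy_le_of_leakageObjective_le hq hC0 hC _
      (timeLaw_zero q hr k) (hfin k hk) (sum_timeLaw_le hq hr k)
  have hmain : ENNReal.ofReal (Real.log M) ≤ ENNReal.ofReal (C * Real.log 2) * ENNReal.ofReal τ +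
      (ENNReal.ofReal (Real.log 2) + ENNReal.ofReal (Real.log M) *
        ENNReal.ofReal ((R - C) / (2 * R))) := by
    refine (ENNReal.add_le_add_iff_left hDtop).1 ?_
    rw [add_comm D, ← add_assoc]
    refine hfano.trans (add_le_add hent (add_le_add_right (mul_le_mul_right
      (ENNReal.ofReal_le_ofReal herr) _) _))
  rw [← ENNReal.ofReal_mul (by positivity), ← ENNReal.ofReal_mul hlogM0,
    ← ENNReal.ofReal_add hlog.le (by positivity), ← ENNReal.ofReal_add (by positivity)
    (by positivity), ENNReal.ofReal_le_ofReal_iff (by positivity)] at hmain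
  have h1 : 0 ≤ 1 - (R - C) / (2 * R) := by
    rw [sub_nonneg, div_le_one (by linarith)]; linarith
  have h2 := mul_le_mul_of_nonneg_left hRτ h1
  have h3 : (1 - (R - C) / (2 * R)) * (R * τ * Real.log 2) = (R + C) / 2 * τ * Real.log 2 := by
    field_simp; ring
  have h4 : (R - C) / 2 * τ * Real.log 2 ≤ 1 * Real.log 2 := by linarith
  have h5 := le_of_mul_le_mul_right h4 hlog
  rw [div_lt_iff₀ (by linarith)] at hm'
  have h6 := mul_le_mul_of_nonneg_right hτm (by linarith : 0 ≤ R - C)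
  linarith

/-! ### The maximum of the objective is attained -/

lemma exists_leakageObjective_pos {q : unitInterval} (hq : 0 < q) :
    ∃ f ∈ leakageSet q, 0 < leakageObjective q f := by
  have hq0 : (0 : ℝ) < q := hq
  have hq1 : (q : ℝ) ≤ 1 := q.2.2
  have hlog := Real.log_pos one_lt_two
  -- a geometric distribution of entropy larger than any leakage
  set r : ℝ := q * Real.exp (-(1 / q)) with hr
  have hr0 : 0 < r := mul_pos hq0 (Real.exp_pos _)
  have hexp : Real.exp (-(1 / q)) < 1 := Real.exp_lt_one_iff.2 (neg_lt_zero.2 (by positivity))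
  have hrq : r < q := mul_lt_of_lt_one_right hq0 hexp
  have hs0 : 0 < 1 - r := by linarith
  have hs1 : 1 - r < 1 := by linarith
  set f : ℕ → ℝ := fun t => if t = 0 then 0 else r * (1 - r) ^ (t - 1) with hf
  have hfs : ∀ t, f (t + 1) = r * (1 - r) ^ t := fun t => by simp [hf]
  have hf0 : f 0 = 0 := by simp [hf]
  have hnn : ∀ t, 0 ≤ f t := fun t => by
    rcases t with _ | t
    · exact hf0.ge
    · rw [hfs]; positivity
  have hgeom := (hasSum_geometric_of_lt_one hs0.le hs1).mul_left r
  rw [sub_sub_cancel, mul_inv_cancel₀ hr0.ne'] at hgeom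
  have hsum : HasSum f 1 := by
    rw [← hasSum_nat_add_iff' 1]
    simpa [hfs, hf0] using hgeom
  have hmean : Summable fun t : ℕ => (t : ℝ) * f t := by
    rw [← summable_nat_add_iff 1]
    have h1 := (summable_pow_mul_geometric_of_norm_lt_one 1 (r := 1 - r)
      (by rw [Real.norm_eq_abs, abs_of_pos hs0]; exact hs1)).mul_left r
    refine (h1.add hgeom.summable).congr fun t => ?_
    rw [hfs]; push_cast; ring
  have hp : IsTimePMF f := ⟨hf0, hnn, hsum, hmean⟩
  refine ⟨f, ⟨hp, fun s _ => ?_⟩, ?_⟩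
  · have h1 : ∑ t ∈ Finset.Icc 1 s, f t = 1 - (1 - r) ^ s := by
      induction s with
      | zero => simp
      | succ s ih =>
        rcases s.eq_zero_or_pos with rfl | hs
        · rw [Finset.Icc_self, Finset.sum_singleton, hfs]; ring
        · rw [Finset.sum_Icc_succ_top (by omega), ih hs, hfs]; ring
    rw [h1]
    have := pow_le_pow_left₀ (by linarith : (0 : ℝ) ≤ 1 - q) (by linarith : 1 - (q : ℝ) ≤ 1 - r) s
    linarith
  · have hm := hp.one_le_mean
    rw [leakageObjective_eq]
    refine div_pos (sub_pos.2 ?_) (by positivity)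
    have hD : ∑' t, leakage (1 - q) t * f t ≤ Real.log 2 / q := by
      calc ∑' t, leakage (1 - q) t * f t ≤ ∑' t, Real.log 2 / q * f t :=
            (hp.summable_leakage hq).tsum_le_tsum
              (fun t => mul_le_mul_of_nonneg_right (leakage_le hq t) (hnn t))
              (hsum.summable.mul_left _)
        _ = Real.log 2 / q := by rw [tsum_mul_left, hsum.tsum_eq, mul_one]
    have hH : 1 / (q : ℝ) ≤ ∑' t, Real.negMulLog (f t) := by
      calc 1 / (q : ℝ) = ∑' t, 1 / (q : ℝ) * f t := by rw [tsum_mul_left, hsum.tsum_eq, mul_one]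
        _ ≤ ∑' t, Real.negMulLog (f t) := by
          refine (hsum.summable.mul_left _).tsum_le_tsum (fun t => ?_) hp.summable_negMulLog
          rcases t with _ | t
          · simp [hf0]
          rw [Real.negMulLog, neg_mul, ← mul_neg, mul_comm]
          refine mul_le_mul_of_nonneg_left ?_ (hnn _)
          rw [hfs, Real.log_mul hr0.ne' (pow_pos hs0 t).ne', hr,
            Real.log_mul hq0.ne' (Real.exp_pos _).ne', Real.log_exp, ← hr, Real.log_pow]
          have h1 := Real.log_nonpos hq0.le hq1
          have h2 : (t : ℝ) * Real.log (1 - r) ≤ 0 := mul_nonpos_of_nonneg_of_nonpos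
            (Nat.cast_nonneg t) (Real.log_nonpos hs0.le hs1.le)
          linarith
    have h2 : Real.log 2 / q < 1 / q := by
      refine div_lt_div_of_pos_right ?_ hq0
      linarith [Real.log_two_lt_d9]
    linarith

/-- The entropy grows more slowly than any multiple of the mean. -/
lemma IsTimePMF.entropy_le {p : ℕ → ℝ} (hp : IsTimePMF p) {a : ℝ} (ha : 0 < a) :
    ∑' t, Real.negMulLog (p t) ≤
      a * ∑' t : ℕ, (t : ℝ) * p t + ∑' t : ℕ, Real.exp (-(a * t) - 1) := by
  rw [← tsum_mul_left, ← (hp.summable_mean.mul_left a).tsum_add (summable_exp_neg ha)]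
  refine hp.summable_negMulLog.tsum_le_tsum (fun t => ?_)
    ((hp.summable_mean.mul_left a).add (summable_exp_neg ha))
  have := negMulLog_le (a * t) (hp.nonneg t)
  linarith

lemma IsTimePMF.leakage_tsum_nonneg {p : ℕ → ℝ} (hp : IsTimePMF p) (q : unitInterval) :
    0 ≤ ∑' t, leakage (1 - q) t * p t :=
  tsum_nonneg fun t => mul_nonneg (leakage_one_sub_nonneg q t) (hp.nonneg t)

lemma bddAbove_leakageObjective (q : unitInterval) :
    BddAbove (leakageObjective q '' leakageSet q) := by
  have hlog := Real.log_pos one_lt_two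
  set K := ∑' t : ℕ, Real.exp (-(1 * t) - 1) with hK
  have hK0 : 0 ≤ K := tsum_nonneg fun t => (Real.exp_pos _).le
  refine ⟨(1 + K) / Real.log 2, ?_⟩
  rintro _ ⟨p, ⟨hp, -⟩, rfl⟩
  rw [hp.leakageObjective_le_iff, div_mul_cancel₀ _ hlog.ne']
  have h1 := hp.entropy_le one_pos
  have h2 := hp.leakage_tsum_nonneg q
  have h3 := mul_le_mul_of_nonneg_left hp.one_le_mean hK0
  linarith

/-- Markov's inequality for a distribution on the positive integers. -/
lemma IsTimePMF.one_sub_div_le {p : ℕ → ℝ} (hp : IsTimePMF p) {B : ℝ}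
    (hB : ∑' t : ℕ, (t : ℝ) * p t ≤ B) {n : ℕ} (hn : 0 < n) :
    1 - B / n ≤ ∑ t ∈ Finset.range n, p t := by
  have hn0 : (0 : ℝ) < n := by exact_mod_cast hn
  have h1 := hp.hasSum.summable.sum_add_tsum_nat_add n
  have h2 := hp.summable_mean.sum_add_tsum_nat_add n
  rw [hp.hasSum.tsum_eq] at h1
  have h3 : n * ∑' t, p (t + n) ≤ ∑' t : ℕ, ((t + n : ℕ) : ℝ) * p (t + n) := by
    rw [← tsum_mul_left]
    refine Summable.tsum_le_tsum (fun t => mul_le_mul_of_nonneg_right ?_ (hp.nonneg _))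
      (((summable_nat_add_iff n).2 hp.hasSum.summable).mul_left _)
      ((summable_nat_add_iff n).2 hp.summable_mean)
    push_cast
    linarith [(Nat.cast_nonneg t : (0 : ℝ) ≤ t)]
  have h4 : 0 ≤ ∑ t ∈ Finset.range n, (t : ℝ) * p t :=
    Finset.sum_nonneg fun t _ => mul_nonneg (Nat.cast_nonneg t) (hp.nonneg t)
  rw [sub_le_iff_le_add, ← sub_le_iff_le_add', le_div_iff₀ hn0]
  have h5 : 1 - ∑ t ∈ Finset.range n, p t = ∑' t, p (t + n) := by linarith
  rw [h5, mul_comm]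
  linarith

/-- The set of distributions is closed under pointwise limits with bounded mean. -/
lemma mem_leakageSet_of_tendsto {q : unitInterval} {u : ℕ → ℕ → ℝ} {f : ℕ → ℝ} {B : ℝ}
    (hu : ∀ n, u n ∈ leakageSet q) (hB : ∀ n, ∑' t : ℕ, (t : ℝ) * u n t ≤ B)
    (hlim : ∀ t, Tendsto (fun n => u n t) atTop (nhds (f t))) : f ∈ leakageSet q := by
  have hnn : ∀ t, 0 ≤ f t := fun t => ge_of_tendsto' (hlim t) fun n => (hu n).1.nonneg t
  have hsum1 : ∀ n, ∑ t ∈ Finset.range n, f t ≤ 1 := fun n =>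
    le_of_tendsto' (tendsto_finsetSum _ fun t _ => hlim t) fun k =>
      sum_le_hasSum _ (fun t _ => (hu k).1.nonneg t) (hu k).1.hasSum
  have hs : Summable f := summable_of_sum_range_le hnn hsum1
  have hmean : Summable fun t : ℕ => (t : ℝ) * f t := by
    refine summable_of_sum_range_le (c := B) (fun t => mul_nonneg (Nat.cast_nonneg t) (hnn t))
      fun n => ?_
    refine le_of_tendsto' (tendsto_finsetSum _ fun t _ => (hlim t).const_mul (t : ℝ)) fun k => ?_
    exact ((hu k).1.summable_mean.sum_le_tsum _ fun t _ =>
      mul_nonneg (Nat.cast_nonneg t) ((hu k).1.nonneg t)).trans (hB k)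
  have htot : ∑' t, f t = 1 := by
    refine le_antisymm (hs.tsum_le_of_sum_range_le hsum1) ?_
    have h1 : Tendsto (fun n : ℕ => 1 - B / (n : ℝ)) atTop (nhds (1 - 0)) :=
      tendsto_const_nhds.sub (tendsto_const_div_atTop_nhds_zero_nat B)
    rw [sub_zero] at h1
    refine le_of_tendsto h1 ((eventually_gt_atTop 0).mono fun n hn => ?_)
    refine le_trans ?_ (hs.sum_le_tsum (Finset.range n) fun t _ => hnn t)
    exact ge_of_tendsto' (tendsto_finsetSum _ fun t _ => hlim t) fun k =>
      (hu k).1.one_sub_div_le (hB k) hn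
  refine ⟨⟨tendsto_nhds_unique (hlim 0) ?_, hnn, ?_, hmean⟩, fun s hs => ?_⟩
  · simp only [(hu _).1.zero]; exact tendsto_const_nhds
  · rw [← htot]; exact hs.hasSum
  · exact le_of_tendsto' (tendsto_finsetSum _ fun t _ => hlim t) fun k => (hu k).2 s hs

/-- The supremum is attained, by the limit of a maximizing sequence. -/
lemma exists_isGreatest_leakageObjective {q : unitInterval} (hq : 0 < q) :
    ∃ C : ℝ, 0 ≤ C ∧ IsGreatest (leakageObjective q '' leakageSet q) C := by
  have hlog := Real.log_pos one_lt_two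
  obtain ⟨f₀, hf₀, hpos⟩ := exists_leakageObjective_pos hq
  have hbdd := bddAbove_leakageObjective q
  have hne : (leakageObjective q '' leakageSet q).Nonempty := ⟨_, f₀, hf₀, rfl⟩
  set C := sSup (leakageObjective q '' leakageSet q) with hCdef
  have hC0 : 0 < C := hpos.trans_le (le_csSup hbdd ⟨f₀, hf₀, rfl⟩)
  have hCle : ∀ f ∈ leakageSet q, leakageObjective q f ≤ C := fun f hf =>
    le_csSup hbdd ⟨f, hf, rfl⟩
  obtain ⟨v, hvmono, hvlim, hvmem⟩ := exists_seq_tendsto_sSup hne hbdd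
  rw [← hCdef] at hvlim
  -- a maximizing sequence with bounded means
  obtain ⟨k, hk⟩ := (hvlim.eventually (eventually_gt_nhds (half_lt_self hC0))).exists
  choose u hu hobj using fun n => hvmem (n + k)
  have hulim : Tendsto (fun n => leakageObjective q (u n)) atTop (nhds C) := by
    simp only [hobj]; exact hvlim.comp (tendsto_add_atTop_nat k)
  have huC : ∀ n, C / 2 < leakageObjective q (u n) := fun n => by
    rw [hobj]; exact hk.trans_le (hvmono (Nat.le_add_left k n))
  set a := C * Real.log 2 / 4 with ha
  have ha0 : 0 < a := by positivity
  set B := (∑' t : ℕ, Real.exp (-(a * t) - 1)) / a with hB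
  have hmean : ∀ n, ∑' t : ℕ, (t : ℝ) * u n t ≤ B := by
    intro n
    have h1 := (not_congr ((hu n).1.leakageObjective_le_iff q (C / 2))).1 (huC n).not_ge
    have h2 := (hu n).1.entropy_le ha0
    have h3 := (hu n).1.leakage_tsum_nonneg q
    rw [hB, le_div_iff₀ ha0]
    rw [ha] at h2 ⊢
    linarith
  have hcpt : IsCompact (Set.pi Set.univ fun _ : ℕ => Set.Icc (0 : ℝ) 1) :=
    isCompact_univ_pi fun _ => isCompact_Icc
  obtain ⟨f, -, φ, hφ, hφlim⟩ := hcpt.tendsto_subseq (x := u) fun n t _ =>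
    ⟨(hu n).1.nonneg t, (hu n).1.le_one t⟩
  have hlim : ∀ t, Tendsto (fun n => u (φ n) t) atTop (nhds (f t)) := tendsto_pi_nhds.1 hφlim
  have hf : f ∈ leakageSet q := mem_leakageSet_of_tendsto (fun n => hu (φ n))
    (fun n => hmean (φ n)) hlim
  -- Fatou's lemma for the nonnegative deviations from the bound `negMulLog_le`
  set c := C * Real.log 2 with hc
  have hc0 : 0 < c := by positivity
  set G : ℕ → ℝ → ℝ := fun t y =>
    c * (t * y) + Real.exp (-(c * t) - 1) - Real.negMulLog y + leakage (1 - q) t * y with hG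
  set K := ∑' t : ℕ, Real.exp (-(c * t) - 1) with hK
  have hG0 : ∀ t y, 0 ≤ y → 0 ≤ G t y := by
    intro t y hy
    have h1 := negMulLog_le (c * t) hy
    have h2 := mul_nonneg (leakage_one_sub_nonneg q t) hy
    simp only [hG]
    linarith
  have hGsum : ∀ p, IsTimePMF p → HasSum (fun t => G t (p t))
      (c * ∑' t : ℕ, (t : ℝ) * p t + K - ∑' t, Real.negMulLog (p t) +
        ∑' t, leakage (1 - q) t * p t) := fun p hp =>
    (((hp.summable_mean.hasSum.mul_left c).add (summable_exp_neg hc0).hasSum).sub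
      hp.summable_negMulLog.hasSum).add (hp.summable_leakage hq).hasSum
  have hbound : ∀ n, ∑' t, G t (u n t) ≤ K + (C - leakageObjective q (u n)) * (Real.log 2 * B) := by
    intro n
    rw [(hGsum _ (hu n).1).tsum_eq]
    have hm := (hu n).1.one_le_mean
    have h1 := leakageObjective_eq q (u n)
    rw [eq_div_iff (by positivity)] at h1
    have h2 : (C - leakageObjective q (u n)) * (Real.log 2 * ∑' t : ℕ, (t : ℝ) * u n t) ≤
        (C - leakageObjective q (u n)) * (Real.log 2 * B) :=
      mul_le_mul_of_nonneg_left (mul_le_mul_of_nonneg_left (hmean n) hlog.le)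
        (sub_nonneg.2 (hCle _ (hu n)))
    rw [hc]
    linarith
  have hboundlim : Tendsto (fun n => K + (C - leakageObjective q (u (φ n))) * (Real.log 2 * B))
      atTop (nhds K) := by
    have := (((tendsto_const_nhds (x := C)).sub (hulim.comp hφ.tendsto_atTop)).mul_const
      (Real.log 2 * B)).const_add K
    simpa using this
  have hfatou : ∑' t, G t (f t) ≤ K := by
    refine (hGsum f hf.1).summable.tsum_le_of_sum_range_le fun N => ?_
    refine le_of_tendsto_of_tendsto' (tendsto_finsetSum _ fun t _ => ?_) hboundlim
      fun n => ((hGsum _ (hu (φ n)).1).summable.sum_le_tsum (Finset.range N)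
        fun t _ => hG0 t _ ((hu (φ n)).1.nonneg t)).trans (hbound (φ n))
    have hcont : Continuous (G t) := by
      simp only [hG]
      fun_prop
    exact (hcont.tendsto _).comp (hlim t)
  rw [(hGsum f hf.1).tsum_eq] at hfatou
  refine ⟨C, hC0.le, ⟨f, hf, le_antisymm (hCle f hf) ?_⟩, ?_⟩
  · have hm := hf.1.one_le_mean
    rw [leakageObjective_eq, le_div_iff₀ (by positivity)]
    rw [hc] at hfatou
    linarith
  · rintro _ ⟨p, hp, rfl⟩
    exact hCle p hp

end BEHC

theorem theorem2 (q : unitInterval) (hq : 0 < q) :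
    BEHC.timingCapacity q = BEHC.capacity q ∧
    ∃ C : ℝ, IsGreatest (BEHC.leakageObjective q '' BEHC.leakageSet q) C ∧
      BEHC.timingCapacity q ≤ (C : EReal) := by
  obtain ⟨C, hC0, hC⟩ := BEHC.exists_isGreatest_leakageObjective hq
  refine ⟨le_antisymm (BEHC.timingCapacity_le_capacity hq) (BEHC.capacity_le_timingCapacity hq),
    C, hC, iSup₂_le fun R hR => ?_⟩
  exact_mod_cast BEHC.le_of_timingAchievable hq hC0 (fun f hf => hC.2 ⟨f, hf, rfl⟩) hR
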